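/- **Lemma (DOWSS, time to clear the environment).** Let $\mathcal E\subset\mathbb R^2$ be the closed region bounded by a simple closed polygon with $r$ reflex vertices (interior angle $>\pi$), and let $N$ agents with searchlights be at points $p^{[0]},\dots,p^{[N-1]}\in\mathcal E$. A point $q$ is visible from $p$ if $[p,q]\subset\mathcal E$; $\mathcal V(p)$ is the set of points visible from $p$, and the ray of a searchlight is the part of $\mathcal V(p)$ on the half-line from $p$ in its current direction. Assume that every point of $\mathcal E$ is visible from some agent, and that every connected component of the visibility graph of the agents contains an agent on $\partial\mathcal E$. Let one agent on $\partial\mathcal E$ be designated as the root. *DOWSS.* Initially only the root is engaged, to clear $\mathcal E$, and all other agents are idle with their searchlights off. An agent at $p$ that is engaged to clear a region $R$ (connected interior) aims instantaneously at the clockwise-most direction in which it can aim at a point of $R$, switches its searchlight on, and slews counterclockwise with constant angular speed $\omega>0$ to the counterclockwise-most such direction. At every visibility gap of $p$ with respect to $R$ (a segment $[a,b]\subset\partial\mathcal V(p)$ with $]a,b[\subset\operatorname{int}R$ and $a,b\in\partial R$) it pauses, keeping its searchlight on, until the regions behind the gap (the connected components of $\operatorname{int}R\setminus\mathcal V(p)$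 bordering on it) have been cleared one after the other. For each such region $R'$ it engages, as its child, an arbitrary idle agent $l$ with $p^{[l]}\notin\operatorname{int}R'$ and $\mathcal V(p^{[l]})\cap\operatorname{int}R'\neq\emptyset$, which clears $R'$ in the same way. On reaching its final direction, with no gaps left, an agent switches its searchlight off, reports to its parent and becomes idle. Communication and processing take no time. An execution goes on as long as some action is possible. *Clearing.* Two points of $\mathcal E$ are separable at time $t$ if every curve joining them in the interior of $\mathcal E$ (end points on $\partial\mathcal E$ being allowed) contains a point illuminated at time $t$. A point is contaminated at time $0$ iff it is not illuminated; $x$ is contaminated at time $t>0$ iff there is a point $y$ that is contaminated at some $t'\in[0,t[$, is not illuminated at any time in $[t',t]$, and is nonseparable from $x$ at time $t$ (contamination being the least relation with these properties). $\mathcal E$ is clear at time $t$ if none of its points is contaminated at time $t$. Then an execution of DOWSS exists, and in every execution, whatever helpers are chosen, all agents have finished and $\mathcal E$ is clear at some time $$T\;\le\;\frac{2\pi}{\omega}\left(1+r+r^2+\dots+r^{N-1}\right),$$ where the right-hand side equals $\frac{2\pi}{\omega}\,\frac{1-r^{N}}{1-r}$ if $r\neq 1$. -/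

import Mathlib

namespace Searchlight

/-! ## Simple polygonal environments (the plane is identified with the complex numbers) -/

/-- A closed polygonal curve is simple if it has at least three vertices, all distinct, two
consecutive edges meet only in their common vertex, and other edges are disjoint. -/
structure IsSimple {n : ℕ} (P : Polygon ℂ n) : Prop where
  three_le : 3 ≤ n
  injective : Function.Injective P.vertices
  adjacent : ∀ i, P.edgeSet ℝ i ∩ P.edgeSet ℝ (finRotate n i) = {P (finRotate n i)}
  disjoint : ∀ i j, i ≠ j → j ≠ finRotate n i → i ≠ finRotate n j →
    Disjoint (P.edgeSet ℝ i) (P.edgeSet ℝ j)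

/-- The closed region enclosed by a polygon: its boundary, together with the points whose
connected component in the complement of the boundary is bounded. -/
def environment {n : ℕ} (P : Polygon ℂ n) : Set ℂ :=
  P.boundary ℝ ∪ {x | x ∉ P.boundary ℝ ∧
    Bornology.IsBounded (connectedComponentIn (P.boundary ℝ)ᶜ x)}

/-- A vertex is reflex if the interior angle there exceeds `π`, that is, if the environment is
not convex in any neighbourhood of the vertex. -/
def IsReflex {n : ℕ} (P : Polygon ℂ n) (i : Fin n) : Prop :=
  ∀ ε > 0, ¬ Convex ℝ (environment P ∩ Metric.ball (P i) ε)

/-- The number of reflex vertices. -/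
noncomputable def reflexCount {n : ℕ} (P : Polygon ℂ n) : ℕ :=
  {i : Fin n | IsReflex P i}.ncard

/-! ## Visibility -/

/-- The set of points of `E` that are visible from `p`. -/
def visibilitySet (E : Set ℂ) (p : ℂ) : Set ℂ :=
  {q | segment ℝ p q ⊆ E}

/-- The ray of a searchlight located at `p` and aimed in direction `θ`. -/
def ray (E : Set ℂ) (p : ℂ) (θ : ℝ) : Set ℂ :=
  {x | x ∈ visibilitySet E p ∧ ∃ ρ : ℝ, 0 ≤ ρ ∧ x = p + ρ * Complex.exp (θ * Complex.I)}

/-- The visibility graph of the agents. -/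
def visibilityGraph {N : ℕ} (E : Set ℂ) (p : Fin N → ℂ) : SimpleGraph (Fin N) :=
  SimpleGraph.fromRel fun i j => p j ∈ visibilitySet E (p i)

/-- The standing assumptions on a searchlight instance (besides simplicity of the polygon). -/
structure StandingAssumptions {n N : ℕ} (P : Polygon ℂ n) (p : Fin N → ℂ) : Prop where
  mem : ∀ i, p i ∈ environment P
  visible : ∀ x ∈ environment P, ∃ i, x ∈ visibilitySet (environment P) (p i)
  boundary : ∀ i, ∃ j, (visibilityGraph (environment P) p).Reachable i j ∧ p j ∈ P.boundary ℝ

/-! ## Contamination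

`lit t` is the set of points illuminated at time `t`. -/

/-- `x` and `y` can be joined by a curve that runs in the interior of `E` (its end points may lie
on the boundary) and that contains no point of `L`. -/
def Nonseparable (E L : Set ℂ) (x y : ℂ) : Prop :=
  ∃ γ : Path x y, (∀ s, s ≠ 0 → s ≠ 1 → γ s ∈ interior E) ∧ ∀ s, γ s ∉ L

/-- `Contaminated E lit x t`: the point `x` is contaminated at time `t`.  The recursive
characterization of contamination is read as an inductive definition: contamination at a
positive time is traced back, in finitely many stages, to contamination at time zero. -/
inductive Contaminated (E : Set ℂ) (lit : ℝ → Set ℂ) : ℂ → ℝ → Prop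
  | init (x : ℂ) : x ∈ E → x ∉ lit 0 → Contaminated E lit x 0
  | spread (x y : ℂ) (t' t : ℝ) : x ∈ E → Contaminated E lit y t' → t' < t →
      (∀ s ∈ Set.Icc t' t, y ∉ lit s) → Nonseparable E (lit t) x y → Contaminated E lit x t

/-- The environment `E` is clear at time `t`. -/
def IsClear (E : Set ℂ) (lit : ℝ → Set ℂ) (t : ℝ) : Prop :=
  ∀ x ∈ E, ¬ Contaminated E lit x t

/-! ## The geometric computations of an agent

A subregion `R` is represented by its interior `Q`, a connected open set. -/

/-- `[a, b]` is a visibility gap of `p` with respect to the region with interior `Q`. -/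
def IsVisibilityGap (E : Set ℂ) (p : ℂ) (Q : Set ℂ) (a b : ℂ) : Prop :=
  openSegment ℝ a b ⊆ Q ∧ segment ℝ a b ⊆ frontier (visibilitySet E p) ∧
    a ∈ frontier Q ∧ b ∈ frontier Q

/-- `C` is (the interior of) a semiconvex subregion that a visibility gap in direction `φ` hides
from `p`: a connected component of the part of `Q` that `p` does not see, bordering on such a
gap. -/
def IsGapRegion (E : Set ℂ) (p : ℂ) (Q C : Set ℂ) (φ : ℝ) : Prop :=
  (∃ x ∈ Q \ visibilitySet E p, C = connectedComponentIn (Q \ visibilitySet E p) x) ∧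
  ∃ a b, IsVisibilityGap E p Q a b ∧ openSegment ℝ a b ⊆ frontier C ∧
    a ∈ ray E p φ ∧ b ∈ ray E p φ

/-- `p` can aim in direction `φ` at some point (other than `p`) of the closed region. -/
def CanAim (E : Set ℂ) (p : ℂ) (Q : Set ℂ) (φ : ℝ) : Prop :=
  ∃ x ∈ ray E p φ, x ≠ p ∧ x ∈ closure Q

/-- `α` and `β` are the clockwise-most and the counterclockwise-most directions (start and finish
angle) in which `p` can aim at some point of the region. -/
structure IsSweepRange (E : Set ℂ) (p : ℂ) (Q : Set ℂ) (α β : ℝ) : Prop where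
  le : α ≤ β
  lt : β < α + 2 * Real.pi
  start : CanAim E p Q α
  finish : CanAim E p Q β
  between : ∀ φ, CanAim E p Q φ → ∃ k : ℤ, φ + 2 * Real.pi * k ∈ Set.Icc α β

/-- An agent can help to clear the region iff it is not in the interior of the region and sees
part of that interior. -/
def CanHelp (E : Set ℂ) (p : ℂ) (Q : Set ℂ) : Prop :=
  p ∉ Q ∧ (Q ∩ visibilitySet E p).Nonempty

/-! ## The Distributed One Way Sweep Strategy

Communication and processing take no time, so the exchange of help request, volunteering and
engagement is one instantaneous step, and so is the report of completion. -/

/-- The local variables of an agent that is engaged in clearing a region. -/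
structure Task (N : ℕ) where
  /-- The agent to which completion is reported; `none` for the root. -/
  parent : Option (Fin N)
  /-- The current direction of the searchlight, which is switched on. -/
  angle : ℝ
  /-- The finish angle. -/
  finish : ℝ
  /-- The regions behind visibility gaps, with the gap angles, for which no child has been
  engaged yet. -/
  gaps : Set (Set ℂ × ℝ)
  /-- The child which is at present clearing the region behind a gap, if any. -/
  child : Option (Fin N)

/-- The task of an agent at `p` that has just been engaged to clear the region with interior `Q`:
it has computed the start angle `α`, the finish angle `β` and the gaps, has aimed at the start
angle and has switched its searchlight on. -/
def newTask {N : ℕ} (E : Set ℂ) (p : ℂ) (parent : Option (Fin N)) (Q : Set ℂ) (α β : ℝ) :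
    Task N where
  parent := parent
  angle := α
  finish := β
  gaps := {g | IsGapRegion E p Q g.1 g.2 ∧ g.2 ∈ Set.Icc α β}
  child := none

/-- A state of the network: the time and, for every agent, its task; an agent without a task is
idle, with its searchlight off, and listens for help requests. -/
structure Config (N : ℕ) where
  time : ℝ
  task : Fin N → Option (Task N)

/-- `φ` is the next angle at which the sweep has to stop: the angle of the next gap, or the finish
angle if there are no gaps left. -/
def IsNextAngle {N : ℕ} (τ : Task N) (φ : ℝ) : Prop :=
  ((∃ C, (C, φ) ∈ τ.gaps) ∨ (τ.gaps = ∅ ∧ φ = τ.finish)) ∧ ∀ g ∈ τ.gaps, φ ≤ g.2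

/-- Initially only the root has a task, which is to clear the whole environment. -/
def IsInitial {N : ℕ} (E : Set ℂ) (p : Fin N → ℂ) (root : Fin N) (c : Config N) : Prop :=
  c.time = 0 ∧ (∀ i, i ≠ root → c.task i = none) ∧
  ∃ α β, IsSweepRange E (p root) (interior E) α β ∧
    c.task root = some (newTask E (p root) none (interior E) α β)

/-- The actions of the agents executing the strategy with angular speed `ω`. -/
inductive Step {N : ℕ} (E : Set ℂ) (p : Fin N → ℂ) (ω : ℝ) : Config N → Config N → Prop
  /-- An agent that is not waiting for a child slews counterclockwise to its next angle. -/
  | slew (c : Config N) (i : Fin N) (τ : Task N) (φ : ℝ) :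
      c.task i = some τ → τ.child = none → IsNextAngle τ φ → τ.angle < φ →
      Step E p ω c
        { time := c.time + (φ - τ.angle) / ω
          task := Function.update c.task i (some { τ with angle := φ }) }
  /-- An agent `i` paused at a gap engages an arbitrary idle agent `l` that is able to help. -/
  | engage (c : Config N) (i l : Fin N) (τ : Task N) (C : Set ℂ) (α β : ℝ) :
      c.task i = some τ → τ.child = none → (C, τ.angle) ∈ τ.gaps →
      c.task l = none → CanHelp E (p l) C → IsSweepRange E (p l) C α β →
      Step E p ω c
        { time := c.time
          task := Function.update
            (Function.update c.task i
              (some { τ with gaps := τ.gaps \ {(C, τ.angle)}, child := some l }))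
            l (some (newTask E (p l) (some i) C α β)) }
  /-- An agent that has reached its finish angle and has no gaps left switches its searchlight
  off, becomes idle, and reports completion to its parent. -/
  | complete (c : Config N) (i : Fin N) (τ : Task N) :
      c.task i = some τ → τ.child = none → τ.gaps = ∅ → τ.angle = τ.finish →
      Step E p ω c
        { time := c.time
          task := fun k => if k = i then none else
            (c.task k).map fun σ => if τ.parent = some k then { σ with child := none } else σ }

/-- A (maximal) execution: the network performs steps as long as some step is possible. -/
def IsExecution {N : ℕ} (E : Set ℂ) (p : Fin N → ℂ) (root : Fin N) (ω : ℝ)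
    (f : ℕ → Config N) : Prop :=
  IsInitial E p root (f 0) ∧
  ∀ k, Step E p ω (f k) (f (k + 1)) ∨ ((∀ c, ¬ Step E p ω (f k) c) ∧ f (k + 1) = f k)

/-- The direction, at time `t`, of the searchlight of an agent that has task `τ` since time `t₀`:
it slews with angular speed `ω` unless it is waiting for a child. -/
noncomputable def Task.angleAt {N : ℕ} (τ : Task N) (ω t₀ t : ℝ) : ℝ :=
  if τ.child = none then τ.angle + ω * (t - t₀) else τ.angle

/-- The set of points illuminated at time `t` in the execution `f`.  Searchlights stay on up to
and including the instant at which they are switched off. -/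
def illuminated {N : ℕ} (E : Set ℂ) (p : Fin N → ℂ) (ω : ℝ) (f : ℕ → Config N) (t : ℝ) : Set ℂ :=
  {x | ∃ k i τ, t ∈ Set.Icc (f k).time (f (k + 1)).time ∧ (f k).task i = some τ ∧
    x ∈ ray E (p i) (τ.angleAt ω (f k).time t)}

/-- The root has finished, and all agents are idle. -/
def Config.IsDone {N : ℕ} (c : Config N) : Prop :=
  ∀ i, c.task i = none

end Searchlight

namespace Searchlight

open Set Metric Filter Topology

/-! ## Planar preliminaries -/

/-! The geometry enters through the properties collected in `PolyEnv`: the environment is compact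
with connected complement, looks like a cone near every point, has connected inside and outside in
small discs about its points, and is locally convex except at the finitely many reflex vertices.
They follow from a Jordan curve theorem for simple polygons, which is proved with winding numbers
(`IsSimple.jordan`, `IsSimple.polyEnv`).

The main topological tool is `PolyEnv.exists_visible_on_line`: since `E` has no holes, a continuum
in `E` that joins points visible from `p` on the two sides of a line through `p` meets this line in
a visible point. Hence a component of `Q` hidden from a point `p` outside `Q` has its frontier in
`Q` on a single half-line from `p`, so it lies behind a gap (`IsHiddenComponent.frontier_same_dir`,
`IsHiddenComponent.isGapRegion`). It inherits the properties in `Region` (`IsGapRegion.region`),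
among them that an agent outside the region misses it in some direction, so that a sweep takes less
than a full turn. Every gap emanates from a reflex vertex, and distinct gaps in one sweep from
distinct vertices, so a sweep meets at most `r` gap regions
(`IsSweepRange.gaps_finite_and_ncard_le`).

The engaged agents form a stack: all but the newest wait for a child, and the regions are nested. A
region behind a gap is hidden from every engaged agent, so whoever can help is idle. A helper
exists, since otherwise a component of the visibility graph would be trapped in the open region and
contain no agent on the boundary (`StandingAssumptions.exists_canHelp`). So the strategy never gets
stuck, and the stack has height at most `N`. If `T d` bounds the time for a task with `d` ancestors,
then `T d = 2π/ω + r * T (d + 1)`, which sums to the geometric series. The proof phrases this as a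
potential of the stack (`stackTime`) that pays for the elapsed time; an integer potential
(`stackSteps`) gives termination.

For clearing, `dirty` is the set for which engaged agents are still responsible. The part of its
frontier in the interior of `E` is always lit (`IsStack.frontier_dirty_subset`), so a curve that
avoids the light stays in its closure, and an unlit point is not lost from the closure by a sweep or
an action. Thus every contaminated point lies in the closure of the dirty set, which is empty once
the stack is. -/

theorem mem_segment_iff_real {a b x : ℂ} :
    x ∈ segment ℝ a b ↔ ∃ t : ℝ, 0 ≤ t ∧ t ≤ 1 ∧ x = a + t * (b - a) := by
  rw [segment_eq_image']
  constructor
  · rintro ⟨t, ⟨h0, h1⟩, rfl⟩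
    exact ⟨t, h0, h1, by simp⟩
  · rintro ⟨t, h0, h1, rfl⟩
    exact ⟨t, ⟨h0, h1⟩, by simp⟩

theorem mem_openSegment_iff_real {a b x : ℂ} :
    x ∈ openSegment ℝ a b ↔ ∃ t : ℝ, 0 < t ∧ t < 1 ∧ x = a + t * (b - a) := by
  rw [openSegment_eq_image']
  constructor
  · rintro ⟨t, ⟨h0, h1⟩, rfl⟩
    exact ⟨t, h0, h1, by simp⟩
  · rintro ⟨t, h0, h1, rfl⟩
    exact ⟨t, ⟨h0, h1⟩, by simp⟩

theorem isClosed_segment (a b : ℂ) : IsClosed (segment ℝ a b) := by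
  rw [segment_eq_image']
  exact (isCompact_Icc.image (by fun_prop)).isClosed

theorem isCompact_segment (a b : ℂ) : IsCompact (segment ℝ a b) := by
  rw [segment_eq_image']
  exact isCompact_Icc.image (by fun_prop)

/-- The quotient is a nonpositive real `-t` only if `x` divides the segment in the ratio `1 : t`. So
`log ((b - x) / (a - x))` is continuous off the segment, and such logarithms serve as contributions
to winding numbers. -/
theorem div_mem_slitPlane {a b x : ℂ} (h : x ∉ segment ℝ a b) :
    (b - x) / (a - x) ∈ Complex.slitPlane := by
  have hax : a - x ≠ 0 := by
    intro h0
    apply h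
    rw [← sub_eq_zero.1 h0]
    exact left_mem_segment ℝ a b
  by_contra hs
  rw [Complex.mem_slitPlane_iff] at hs
  push Not at hs
  apply h
  obtain ⟨h1, h2⟩ := hs
  set t : ℝ := -((b - x) / (a - x)).re with ht
  have ht0 : 0 ≤ t := by linarith
  have hz : (b - x) / (a - x) = -(t : ℂ) := by
    apply Complex.ext <;> simp [ht, h2]
  rw [div_eq_iff hax] at hz
  have h1t : (1 + t : ℂ) ≠ 0 := by
    have : (1 + t : ℝ) ≠ 0 := by positivity
    exact_mod_cast this
  refine mem_segment_iff_real.2 ⟨1 / (1 + t), by positivity, ?_, ?_⟩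
  · rw [div_le_one (by positivity)]; linarith
  · push_cast
    field_simp
    linear_combination -hz

/-- The values lie in the countable, hence totally disconnected, set `2πiℤ`. This is the form in
which the local constancy of winding numbers is used. -/
theorem _root_.IsPreconnected.eq_of_exp_eq_one {X : Type*} [TopologicalSpace X] {S : Set X}
    (hS : IsPreconnected S) {f : X → ℂ} (hf : ContinuousOn f S)
    (h : ∀ x ∈ S, Complex.exp (f x) = 1) {x y : X} (hx : x ∈ S) (hy : y ∈ S) : f x = f y := by
  have hc : ({z : ℂ | Complex.exp z = 1}).Countable := by
    refine (countable_range fun n : ℤ => (n : ℂ) * (2 * Real.pi * Complex.I)).mono ?_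
    intro z hz
    obtain ⟨n, hn⟩ := Complex.exp_eq_one_iff.1 hz
    exact ⟨n, hn.symm⟩
  exact hc.isTotallyDisconnected _ (image_subset_iff.2 h) (hS.image f hf)
    (mem_image_of_mem f hx) (mem_image_of_mem f hy)

theorem exists_polar (z : ℂ) :
    ∃ θ : ℝ, 0 ≤ θ ∧ θ < 2 * Real.pi ∧ z = ‖z‖ * Complex.exp (θ * Complex.I) := by
  have hp := Real.pi_pos
  have h := Complex.norm_mul_exp_arg_mul_I z
  by_cases h0 : 0 ≤ z.arg
  · exact ⟨z.arg, h0, by linarith [Complex.arg_le_pi z], h.symm⟩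
  · refine ⟨z.arg + 2 * Real.pi, by linarith [Complex.neg_pi_lt_arg z], by linarith, ?_⟩
    push_cast
    rw [add_mul, Complex.exp_add, Complex.exp_two_pi_mul_I, mul_one, h]

theorem exp_mul_I_eq_iff {a b : ℝ} :
    Complex.exp (a * Complex.I) = Complex.exp (b * Complex.I) ↔
      ∃ k : ℤ, a = b + 2 * Real.pi * k := by
  rw [Complex.exp_eq_exp_iff_exists_int]
  constructor
  · rintro ⟨k, hk⟩
    refine ⟨k, ?_⟩
    have h2 : (a : ℂ) = b + 2 * Real.pi * k := by
      apply mul_right_cancel₀ Complex.I_ne_zero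
      rw [hk]; ring
    exact_mod_cast h2
  · rintro ⟨k, rfl⟩
    exact ⟨k, by push_cast; ring⟩

theorem polar_unique {r s a b : ℝ} (hr : 0 < r) (hs : 0 < s)
    (h : r * Complex.exp (a * Complex.I) = s * Complex.exp (b * Complex.I)) :
    r = s ∧ ∃ k : ℤ, a = b + 2 * Real.pi * k := by
  have h1 := congrArg norm h
  rw [norm_mul, norm_mul, Complex.norm_exp_ofReal_mul_I, Complex.norm_exp_ofReal_mul_I,
    Complex.norm_real, Complex.norm_real, mul_one, mul_one, Real.norm_of_nonneg hr.le,
    Real.norm_of_nonneg hs.le] at h1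
  refine ⟨h1, exp_mul_I_eq_iff.1 ?_⟩
  subst h1
  exact mul_left_cancel₀ (by exact_mod_cast hr.ne') h

theorem int_eq_zero_of_shift {a b c d : ℝ} {k : ℤ} (h : a = b + 2 * Real.pi * k)
    (ha : c ≤ a) (ha' : a ≤ d) (hb : c ≤ b) (hb' : b ≤ d) (hcd : d < c + 2 * Real.pi) : k = 0 := by
  have hp := Real.pi_pos
  have h1 : (k : ℝ) < 1 := by
    by_contra hk
    nlinarith
  have h2 : (-1 : ℝ) < k := by
    by_contra hk
    nlinarith
  have h3 : k < 1 := by exact_mod_cast h1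
  have h4 : -1 < k := by exact_mod_cast h2
  omega

/-- An open sector of a disc. -/
def sector (y d : ℂ) (ε a b : ℝ) : Set ℂ :=
  (fun q : ℝ × ℝ => y + q.1 * d * Complex.exp (q.2 * Complex.I)) '' (Ioo 0 ε ×ˢ Ioo a b)

theorem isPreconnected_sector (y d : ℂ) (ε a b : ℝ) : IsPreconnected (sector y d ε a b) :=
  (isPreconnected_Ioo.prod isPreconnected_Ioo).image _ (by fun_prop)

theorem mem_closure_sector {y d : ℂ} {ε a b r θ : ℝ} (hab : a < b) (hε : 0 < ε)
    (hr : 0 ≤ r) (hr' : r ≤ ε) (ha : a ≤ θ) (hb : θ ≤ b) :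
    y + r * d * Complex.exp (θ * Complex.I) ∈ closure (sector y d ε a b) := by
  have hf : Continuous fun q : ℝ × ℝ => y + q.1 * d * Complex.exp (q.2 * Complex.I) := by fun_prop
  apply image_closure_subset_closure_image hf
  refine ⟨(r, θ), ?_, rfl⟩
  rw [closure_prod_eq, closure_Ioo hε.ne, closure_Ioo hab.ne]
  exact ⟨⟨hr, hr'⟩, ha, hb⟩

/-- The two rays that emanate from `y` in the directions `d` and `d * exp (I * Θ)` cut a disc into
two sectors. -/
theorem ball_diff_rays {y d : ℂ} (hd : ‖d‖ = 1) {ε Θ : ℝ} (h0 : 0 < Θ)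
    (h2 : Θ < 2 * Real.pi) :
    ball y ε \ {x | ∃ r : ℝ, 0 ≤ r ∧
        (x = y + r * d ∨ x = y + r * d * Complex.exp (Θ * Complex.I))} =
      sector y d ε 0 Θ ∪ sector y d ε Θ (2 * Real.pi) := by
  have hd0 : d ≠ 0 := by rintro rfl; simp at hd
  ext x
  constructor
  · rintro ⟨hx, hx'⟩
    have hxy : (x - y) / d ≠ 0 := by
      intro h
      apply hx'
      refine ⟨0, le_rfl, Or.inl ?_⟩
      rw [div_eq_zero_iff, or_iff_left hd0, sub_eq_zero] at h
      simp [h]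
    obtain ⟨θ, hθ0, hθ2, hz⟩ := exists_polar ((x - y) / d)
    have hn : ‖(x - y) / d‖ = ‖x - y‖ := by rw [norm_div, hd, div_one]
    rw [hn] at hz
    have hx2 : x = y + (‖x - y‖ : ℝ) * d * Complex.exp (θ * Complex.I) := by
      rw [div_eq_iff hd0] at hz
      linear_combination hz
    have hpos : 0 < ‖x - y‖ := by
      rw [← hn]; exact norm_pos_iff.2 hxy
    have hlt : ‖x - y‖ < ε := by rwa [mem_ball, dist_eq_norm] at hx
    have hne0 : θ ≠ 0 := by
      rintro rfl
      exact hx' ⟨‖x - y‖, hpos.le, Or.inl (by simpa using hx2)⟩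
    have hneΘ : θ ≠ Θ := by
      rintro rfl
      exact hx' ⟨‖x - y‖, hpos.le, Or.inr hx2⟩
    rcases lt_or_gt_of_ne hneΘ with h | h
    · exact Or.inl ⟨(‖x - y‖, θ), ⟨⟨hpos, hlt⟩, lt_of_le_of_ne hθ0 (Ne.symm hne0), h⟩, hx2.symm⟩
    · exact Or.inr ⟨(‖x - y‖, θ), ⟨⟨hpos, hlt⟩, h, hθ2⟩, hx2.symm⟩
  · have key : ∀ r θ : ℝ, 0 < r → r < ε → 0 < θ → θ < 2 * Real.pi → θ ≠ Θ →
        y + r * d * Complex.exp (θ * Complex.I) ∈ ball y ε \ {x | ∃ r : ℝ, 0 ≤ r ∧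
        (x = y + r * d ∨ x = y + r * d * Complex.exp (Θ * Complex.I))} := by
      intro r θ hr hrε hθ hθ2 hne
      refine ⟨?_, ?_⟩
      · rw [mem_ball, dist_eq_norm, add_sub_cancel_left, norm_mul, norm_mul, hd,
          Complex.norm_exp_ofReal_mul_I, Complex.norm_real, Real.norm_of_nonneg hr.le]
        simpa using hrε
      · rintro ⟨s, hs, h⟩
        have hs0 : 0 < s := by
          rcases hs.eq_or_lt with h' | h'
          · exfalso
            subst h'
            have : (r : ℂ) * d * Complex.exp (θ * Complex.I) = 0 := by simpa using h
            simp [hr.ne', hd0] at this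
          · exact h'
        rcases h with h | h
        · have : (r : ℂ) * Complex.exp (θ * Complex.I) = s * Complex.exp ((0 : ℝ) * Complex.I) := by
            apply mul_left_cancel₀ hd0
            simp only [Complex.ofReal_zero, zero_mul, Complex.exp_zero, mul_one]
            linear_combination h
          obtain ⟨-, k, hk⟩ := polar_unique hr hs0 this
          have hp := Real.pi_pos
          have h1 : (0 : ℝ) < k := by
            by_contra hk'
            nlinarith
          have h2 : (k : ℝ) < 1 := by
            by_contra hk'
            nlinarith
          have h3 : 0 < k := by exact_mod_cast h1
          have h4 : k < 1 := by exact_mod_cast h2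
          omega
        · have : (r : ℂ) * Complex.exp (θ * Complex.I) = s * Complex.exp (Θ * Complex.I) := by
            apply mul_left_cancel₀ hd0
            linear_combination h
          obtain ⟨-, k, hk⟩ := polar_unique hr hs0 this
          have hp := Real.pi_pos
          have h1 : (-1 : ℝ) < k := by
            by_contra hk'
            nlinarith
          have h2 : (k : ℝ) < 1 := by
            by_contra hk'
            nlinarith
          have h3 : -1 < k := by exact_mod_cast h1
          have h4 : k < 1 := by exact_mod_cast h2
          have h5 : k = 0 := by omega
          apply hne
          rw [hk, h5]
          simp
    rintro (⟨⟨r, θ⟩, ⟨⟨hr, hr'⟩, h, h'⟩, rfl⟩ | ⟨⟨r, θ⟩, ⟨⟨hr, hr'⟩, h, h'⟩, rfl⟩)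
    · exact key r θ hr hr' h (h'.trans h2) h'.ne
    · exact key r θ hr hr' (h0.trans h) h' h.ne'

/-- Two segments that meet only in their common end point `y` cut every small disc about `y` into
two connected pieces, both of which accumulate at all points of the segments. -/
theorem exists_sectors {B : Set ℂ} {y c₁ c₂ : ℂ} (h1 : c₁ ≠ y) (h2 : c₂ ≠ y)
    (h12 : segment ℝ y c₁ ∩ segment ℝ y c₂ = {y}) {ε₀ : ℝ}
    (hB : ∀ x ∈ ball y ε₀, (x ∈ B ↔ x ∈ segment ℝ y c₁ ∪ segment ℝ y c₂))
    {ε : ℝ} (hε : 0 < ε) (hε0 : ε ≤ ε₀) (hε1 : ε ≤ ‖c₁ - y‖) (hε2 : ε ≤ ‖c₂ - y‖) :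
    ∃ S₁ S₂, IsPreconnected S₁ ∧ IsPreconnected S₂ ∧ ball y ε \ B = S₁ ∪ S₂ ∧
      B ∩ ball y ε ⊆ closure S₁ ∧ B ∩ ball y ε ⊆ closure S₂ := by
  have hn1 : 0 < ‖c₁ - y‖ := norm_pos_iff.2 (sub_ne_zero.2 h1)
  have hn2 : 0 < ‖c₂ - y‖ := norm_pos_iff.2 (sub_ne_zero.2 h2)
  have hn1' : ((‖c₁ - y‖ : ℝ) : ℂ) ≠ 0 := by exact_mod_cast hn1.ne'
  have hn2' : ((‖c₂ - y‖ : ℝ) : ℂ) ≠ 0 := by exact_mod_cast hn2.ne'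
  set d : ℂ := (c₁ - y) / (‖c₁ - y‖ : ℝ) with hd_def
  have hd : ‖d‖ = 1 := by
    rw [hd_def, norm_div, Complex.norm_real, norm_norm, div_self hn1.ne']
  have hd0 : d ≠ 0 := by rintro h; rw [h] at hd; simp at hd
  have hc1 : c₁ - y = ‖c₁ - y‖ * d := by rw [hd_def]; field_simp
  obtain ⟨Θ, hΘ0, hΘ2, hz'⟩ := exists_polar ((c₂ - y) / d)
  rw [norm_div, hd, div_one, div_eq_iff hd0] at hz'
  -- If both segments had the same direction, their points at distance `ε` from `y` would coincide.
  have hΘ : Θ ≠ 0 := by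
    rintro rfl
    have hc2 : c₂ - y = ‖c₂ - y‖ * d := by simpa using hz'
    have hm : y + (ε : ℂ) * d ∈ segment ℝ y c₁ ∩ segment ℝ y c₂ := by
      constructor
      · refine mem_segment_iff_real.2 ⟨ε / ‖c₁ - y‖, by positivity, (div_le_one hn1).2 hε1, ?_⟩
        rw [Complex.ofReal_div]; field_simp; linear_combination -(ε : ℂ) * hc1
      · refine mem_segment_iff_real.2 ⟨ε / ‖c₂ - y‖, by positivity, (div_le_one hn2).2 hε2, ?_⟩
        rw [Complex.ofReal_div]; field_simp; linear_combination -(ε : ℂ) * hc2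
    rw [h12] at hm
    have : (ε : ℂ) * d = 0 := by simpa using hm
    simp [hε.ne', hd0] at this
  have hΘ0' : 0 < Θ := lt_of_le_of_ne hΘ0 (Ne.symm hΘ)
  have hBr : ∀ x ∈ ball y ε, x ∈ B ↔ ∃ r : ℝ, 0 ≤ r ∧
        (x = y + r * d ∨ x = y + r * d * Complex.exp (Θ * Complex.I)) := by
    intro x hx
    rw [hB x (ball_subset_ball hε0 hx)]
    have hx' : ‖x - y‖ < ε := by rwa [mem_ball, dist_eq_norm] at hx
    constructor
    · rintro (h | h)
      · obtain ⟨t, ht0, -, rfl⟩ := mem_segment_iff_real.1 h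
        refine ⟨t * ‖c₁ - y‖, by positivity, Or.inl ?_⟩
        rw [Complex.ofReal_mul]
        linear_combination (t : ℂ) * hc1
      · obtain ⟨t, ht0, -, rfl⟩ := mem_segment_iff_real.1 h
        refine ⟨t * ‖c₂ - y‖, by positivity, Or.inr ?_⟩
        rw [Complex.ofReal_mul]
        linear_combination (t : ℂ) * hz'
    · rintro ⟨r, hr, rfl | rfl⟩
      · left
        have hr' : r < ε := by
          simpa [hd, Real.norm_of_nonneg hr, abs_of_nonneg hr] using hx'
        refine mem_segment_iff_real.2 ⟨r / ‖c₁ - y‖, by positivity, ?_, ?_⟩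
        · rw [div_le_one hn1]; linarith
        · rw [Complex.ofReal_div]; field_simp; linear_combination -(r : ℂ) * hc1
      · right
        have hr' : r < ε := by
          rw [add_sub_cancel_left, norm_mul, norm_mul, hd, Complex.norm_exp_ofReal_mul_I,
            Complex.norm_real, Real.norm_of_nonneg hr, mul_one, mul_one] at hx'
          exact hx'
        refine mem_segment_iff_real.2 ⟨r / ‖c₂ - y‖, by positivity, ?_, ?_⟩
        · rw [div_le_one hn2]; linarith
        · push_cast
          field_simp
          linear_combination -(r : ℂ) * hz'
  have hpi := Real.pi_pos
  refine ⟨sector y d ε 0 Θ, sector y d ε Θ (2 * Real.pi), isPreconnected_sector _ _ _ _ _,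
    isPreconnected_sector _ _ _ _ _, ?_, ?_, ?_⟩
  · rw [← ball_diff_rays hd hΘ0' hΘ2]
    ext x
    constructor
    · rintro ⟨hx, hxB⟩
      exact ⟨hx, fun h => hxB ((hBr x hx).2 h)⟩
    · rintro ⟨hx, hxB⟩
      exact ⟨hx, fun h => hxB ((hBr x hx).1 h)⟩
  all_goals
    rintro x ⟨hxB, hx⟩
    obtain ⟨r, hr, h⟩ := (hBr x hx).1 hxB
    have hr' : r ≤ ε := by
      rw [mem_ball, dist_eq_norm] at hx
      rcases h with rfl | rfl
      · rw [add_sub_cancel_left, norm_mul, hd,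
          Complex.norm_real, Real.norm_of_nonneg hr, mul_one] at hx
        exact hx.le
      · rw [add_sub_cancel_left, norm_mul, norm_mul, hd, Complex.norm_exp_ofReal_mul_I,
          Complex.norm_real, Real.norm_of_nonneg hr, mul_one, mul_one] at hx
        exact hx.le
  · rcases h with rfl | rfl
    · simpa using mem_closure_sector (y := y) (d := d) hΘ0' hε hr hr' le_rfl hΘ0
    · exact mem_closure_sector hΘ0' hε hr hr' hΘ0 le_rfl
  · rcases h with rfl | rfl
    -- For the second sector the first ray is reached at the angle `2π` instead of `0`.
    · have := mem_closure_sector (y := y) (d := d) hΘ2 hε hr hr' hΘ2.le le_rfl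
      push_cast at this
      rwa [Complex.exp_two_pi_mul_I, mul_one] at this
    · exact mem_closure_sector hΘ2 hε hr hr' le_rfl hΘ2.le

/-! ## Locally conic sets -/

/-- Near `q`, the set `S` is a cone with apex `q`. -/
def Conic (S : Set ℂ) (q : ℂ) : Prop :=
  ∃ ε > 0, ∀ x ∈ ball q ε, ∀ s : ℝ, 0 < s → s ≤ 1 → (q + s * (x - q) ∈ S ↔ x ∈ S)

theorem scale_mem_ball {q x : ℂ} {ε s : ℝ} (hx : x ∈ ball q ε) (h0 : 0 < s) (h1 : s ≤ 1) :
    q + s * (x - q) ∈ ball q ε := by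
  rw [mem_ball, dist_eq_norm] at hx ⊢
  rw [add_sub_cancel_left, norm_mul, Complex.norm_real, Real.norm_of_nonneg h0.le]
  nlinarith [norm_nonneg (x - q)]

theorem Conic.compl {S : Set ℂ} {q : ℂ} (h : Conic S q) : Conic Sᶜ q := by
  obtain ⟨ε, hε, h⟩ := h
  exact ⟨ε, hε, fun x hx s h0 h1 => not_congr (h x hx s h0 h1)⟩

theorem Conic.inter {S T : Set ℂ} {q : ℂ} (hS : Conic S q) (hT : Conic T q) :
    Conic (S ∩ T) q := by
  obtain ⟨ε, hε, hS⟩ := hS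
  obtain ⟨δ, hδ, hT⟩ := hT
  exact ⟨min ε δ, lt_min hε hδ, fun x hx s h0 h1 => and_congr
    (hS x (ball_subset_ball (min_le_left _ _) hx) s h0 h1)
    (hT x (ball_subset_ball (min_le_right _ _) hx) s h0 h1)⟩

theorem Conic.iUnion {n : ℕ} {S : Fin n → Set ℂ} {q : ℂ} (h : ∀ i, Conic (S i) q) :
    Conic (⋃ i, S i) q := by
  choose ε hε h using h
  obtain ⟨δ, hδ0, hδ⟩ : ∃ δ > 0, ∀ i, δ ≤ ε i := by
    rcases isEmpty_or_nonempty (Fin n) with hn | hn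
    · exact ⟨1, one_pos, fun i => hn.elim i⟩
    · obtain ⟨i, hi⟩ := Finite.exists_min ε
      exact ⟨ε i, hε i, hi⟩
  refine ⟨δ, hδ0, fun x hx s h0 h1 => ?_⟩
  simp only [mem_iUnion]
  exact exists_congr fun i => h i x (ball_subset_ball (hδ i) hx) s h0 h1

/-- The segment from a point of `S` to its scaled copy consists of scaled copies, so it stays in `S`
and joins the two inside one component. -/
theorem Conic.component {S : Set ℂ} {q : ℂ} (h : Conic S q) (y : ℂ) :
    Conic (connectedComponentIn S y) q := by
  obtain ⟨ε, hε, h⟩ := h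
  refine ⟨ε, hε, fun x hx s h0 h1 => ?_⟩
  have key : x ∈ S → segment ℝ x (q + s * (x - q)) ⊆ S := by
    intro hxS z hz
    obtain ⟨t, ht0, ht1, rfl⟩ := mem_segment_iff_real.1 hz
    have : x + t * (q + s * (x - q) - x) = q + ((1 - t * (1 - s) : ℝ) : ℂ) * (x - q) := by
      push_cast; ring
    rw [this]
    rcases ht1.lt_or_eq with ht | ht
    · exact (h x hx _ (by nlinarith) (by nlinarith)).2 hxS
    · exact (h x hx _ (by rw [ht]; linarith) (by nlinarith)).2 hxS
  constructor
  · intro hm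
    have hS := (h x hx s h0 h1).1 (connectedComponentIn_subset _ _ hm)
    rw [connectedComponentIn_eq hm]
    exact (convex_segment _ _).isPreconnected.subset_connectedComponentIn
      (right_mem_segment ℝ _ _) (key hS) (left_mem_segment ℝ _ _)
  · intro hm
    have hS := connectedComponentIn_subset _ _ hm
    rw [connectedComponentIn_eq hm]
    exact (convex_segment _ _).isPreconnected.subset_connectedComponentIn
      (left_mem_segment ℝ _ _) (key hS) (right_mem_segment ℝ _ _)

theorem conic_segment (a b q : ℂ) : Conic (segment ℝ a b) q := by
  by_cases hq : q ∈ segment ℝ a b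
  · obtain ⟨t, ht0, ht1, hqt⟩ := mem_segment_iff_real.1 hq
    by_cases hab : a = b
    · subst hab
      have : q = a := by simpa using hqt
      subst this
      refine ⟨1, one_pos, fun x _ s h0 _ => ?_⟩
      simp [h0.ne', sub_eq_zero]
    have hn : 0 < ‖b - a‖ := norm_pos_iff.2 (sub_ne_zero.2 (Ne.symm hab))
    -- The radius is at most the distance from `q` to each end point of the segment other than `q`
    -- itself; an end point equal to `q` imposes no condition.
    obtain ⟨ε, hε, h1, h2⟩ : ∃ ε > 0, (t < 1 → ε ≤ (1 - t) * ‖b - a‖) ∧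
        (0 < t → ε ≤ t * ‖b - a‖) := by
      rcases ht0.eq_or_lt with h | h
      · refine ⟨(1 - t) * ‖b - a‖, mul_pos (by linarith) hn, fun _ => le_rfl, fun h' => ?_⟩
        linarith
      · rcases ht1.eq_or_lt with h' | h'
        · exact ⟨t * ‖b - a‖, mul_pos h hn, fun h'' => by linarith, fun _ => le_rfl⟩
        · exact ⟨min ((1 - t) * ‖b - a‖) (t * ‖b - a‖),
            lt_min (mul_pos (by linarith) hn) (mul_pos h hn), fun _ => min_le_left _ _,
            fun _ => min_le_right _ _⟩
    refine ⟨ε, hε, fun x hx s hs0 hs1 => ⟨fun hm => ?_, fun hm => ?_⟩⟩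
    · obtain ⟨u, hu0, hu1, hu⟩ := mem_segment_iff_real.1 hm
      have hs : (s : ℂ) ≠ 0 := by exact_mod_cast hs0.ne'
      have hxq : x - q = ((u - t) / s : ℝ) * (b - a) := by
        push_cast
        field_simp
        linear_combination hu - hqt
      have hd : |(u - t) / s| * ‖b - a‖ < ε := by
        rw [mem_ball, dist_eq_norm, hxq, norm_mul, Complex.norm_real] at hx
        exact hx
      refine mem_segment_iff_real.2 ⟨t + (u - t) / s, ?_, ?_, ?_⟩
      · by_contra hneg
        push Not at hneg
        rcases ht0.eq_or_lt with h | h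
        · have : 0 ≤ (u - t) / s := div_nonneg (by linarith) hs0.le
          linarith
        · have h3 := h2 h
          have h4 := neg_abs_le ((u - t) / s)
          nlinarith
      · by_contra hneg
        push Not at hneg
        rcases ht1.eq_or_lt with h | h
        · have : (u - t) / s ≤ 0 := div_nonpos_of_nonpos_of_nonneg (by linarith) hs0.le
          linarith
        · have h3 := h1 h
          have h4 := le_abs_self ((u - t) / s)
          nlinarith
      · rw [Complex.ofReal_add]
        linear_combination hxq + hqt
    · refine (convex_segment a b).segment_subset hq hm
        (mem_segment_iff_real.2 ⟨s, hs0.le, hs1, rfl⟩)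
  · obtain ⟨ε, hε, h⟩ := Metric.isOpen_iff.1 (isClosed_segment a b).isOpen_compl q hq
    exact ⟨ε, hε, fun x hx s h0 h1 =>
      iff_of_false (h (scale_mem_ball hx h0 h1)) (h hx)⟩

theorem scale_mem_closure {S : Set ℂ} {q x : ℂ} {ε s : ℝ} (hx : x ∈ ball q ε)
    (h : ∀ y ∈ ball q ε, y ∈ S → q + s * (y - q) ∈ S) (hm : x ∈ closure S) :
    q + s * (x - q) ∈ closure S := by
  have hf : Continuous fun y : ℂ => q + s * (y - q) := by fun_prop
  have : x ∈ closure (S ∩ ball q ε) := by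
    rw [inter_comm]
    exact isOpen_ball.inter_closure ⟨hx, hm⟩
  refine closure_mono ?_ (image_closure_subset_closure_image hf ⟨x, this, rfl⟩)
  rintro _ ⟨y, ⟨hyS, hy⟩, rfl⟩
  exact h y hy hyS

theorem Conic.closure {S : Set ℂ} {q : ℂ} (h : Conic S q) : Conic (closure S) q := by
  obtain ⟨ε, hε, h⟩ := h
  refine ⟨ε, hε, fun x hx s h0 h1 => ⟨fun hm => ?_, fun hm => ?_⟩⟩
  · have hs : (s : ℂ) ≠ 0 := by exact_mod_cast h0.ne'
    have hx' : q + s * (x - q) ∈ ball q (s * ε) := by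
      rw [mem_ball, dist_eq_norm] at hx ⊢
      rw [add_sub_cancel_left, norm_mul, Complex.norm_real, Real.norm_of_nonneg h0.le]
      exact mul_lt_mul_of_pos_left hx h0
    -- The converse direction scales up by `1 / s`, which is legitimate in the smaller ball of
    -- radius `s * ε`.
    have := scale_mem_closure (s := s⁻¹) hx' (fun y hy hyS => ?_) hm
    · convert this using 1
      push_cast
      field_simp
      ring
    · refine (h _ ?_ s h0 h1).1 ?_
      · rw [mem_ball, dist_eq_norm] at hy ⊢
        rw [add_sub_cancel_left, norm_mul, Complex.norm_real, norm_inv, Real.norm_of_nonneg h0.le]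
        rw [inv_mul_lt_iff₀ h0]
        exact hy
      · convert hyS using 1
        push_cast
        field_simp
        ring
  · exact scale_mem_closure hx (fun y hy hyS => (h y hy s h0 h1).2 hyS) hm

theorem Conic.interior {S : Set ℂ} {q : ℂ} (h : Conic S q) : Conic (interior S) q := by
  have := h.compl.closure.compl
  rwa [closure_compl, compl_compl] at this

/-! ## Local structure of the boundary of a simple polygon -/

section Polygon

variable {n : ℕ} {P : Polygon ℂ n}

theorem edgeSet_eq_segment (P : Polygon ℂ n) (i : Fin n) :
    P.edgeSet ℝ i = segment ℝ (P i) (P (finRotate n i)) :=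
  affineSegment_eq_segment ℝ _ _

theorem mem_boundary_iff {x : ℂ} :
    x ∈ P.boundary ℝ ↔ ∃ i, x ∈ segment ℝ (P i) (P (finRotate n i)) := by
  simp only [Polygon.boundary, mem_iUnion, edgeSet_eq_segment]

theorem isCompact_boundary (P : Polygon ℂ n) : IsCompact (P.boundary ℝ) := by
  refine isCompact_iUnion fun i => ?_
  rw [edgeSet_eq_segment]
  exact isCompact_segment _ _

theorem conic_boundary (P : Polygon ℂ n) (q : ℂ) : Conic (P.boundary ℝ) q :=
  Conic.iUnion fun i => by
    rw [edgeSet_eq_segment]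
    exact conic_segment _ _ _

namespace IsSimple

theorem rotate_ne (hP : IsSimple P) (i : Fin n) : finRotate n i ≠ i := by
  obtain ⟨m, rfl⟩ : ∃ m, n = m + 2 := ⟨n - 2, by have := hP.three_le; omega⟩
  rw [finRotate_apply]
  simp

theorem vertex_ne (hP : IsSimple P) (i : Fin n) : P (finRotate n i) ≠ P i :=
  fun h => hP.rotate_ne i (hP.injective h)

theorem isPreconnected_boundary (hP : IsSimple P) : IsPreconnected (P.boundary ℝ) := by
  obtain ⟨m, rfl⟩ : ∃ m, n = m + 1 := ⟨n - 1, by have := hP.three_le; omega⟩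
  refine IsPreconnected.iUnion_of_chain (fun i => ?_) (fun i => ?_)
  · rw [edgeSet_eq_segment]
    exact (convex_segment _ _).isPreconnected
  · simp only [edgeSet_eq_segment]
    -- The edges form a chain in the linear order of the indices. The successor of the last index is
    -- itself, so the chain does not use that the polygon closes up.
    by_cases hi : i = Fin.last m
    · refine ⟨P i, left_mem_segment ℝ _ _, ?_⟩
      have : Order.succ i = i := by
        rw [hi]; exact Order.succ_eq_iff_isMax.2 isMax_top
      rw [this]
      exact left_mem_segment ℝ _ _
    · refine ⟨P (finRotate _ i), right_mem_segment ℝ _ _, ?_⟩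
      have : Order.succ i = finRotate _ i := by
        rw [finRotate_apply]
        rw [Fin.orderSucc_eq]
        obtain ⟨j, rfl⟩ := Fin.exists_castSucc_eq.2 hi
        simp
      rw [this]
      exact left_mem_segment ℝ _ _

theorem mem_edge_of_vertex (hP : IsSimple P) {i j : Fin n}
    (h : P (finRotate n i) ∈ P.edgeSet ℝ j) : j = i ∨ j = finRotate n i := by
  by_contra hne
  push Not at hne
  have hi : P (finRotate n i) ∈ P.edgeSet ℝ i := by
    rw [edgeSet_eq_segment]; exact right_mem_segment ℝ _ _
  by_cases hij : i = finRotate n j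
  · have := hP.adjacent j
    rw [← hij] at this
    have h2 : P (finRotate n i) ∈ ({P i} : Set ℂ) := by
      rw [← this]; exact ⟨h, hi⟩
    exact hP.vertex_ne i h2
  · exact disjoint_left.1 (hP.disjoint i j (Ne.symm hne.1) hne.2 hij) hi h

theorem mem_edge_of_not_vertex (hP : IsSimple P) {i j : Fin n} {y : ℂ}
    (hy : ∀ k, P k ≠ y) (hi : y ∈ P.edgeSet ℝ i) (hj : y ∈ P.edgeSet ℝ j) : j = i := by
  by_contra hne
  by_cases h1 : j = finRotate n i
  · have := hP.adjacent i
    rw [← h1] at this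
    have h2 : y ∈ ({P j} : Set ℂ) := by rw [← this]; exact ⟨hi, hj⟩
    exact hy _ (mem_singleton_iff.1 h2).symm
  by_cases h2 : i = finRotate n j
  · have := hP.adjacent j
    rw [← h2] at this
    have h2 : y ∈ ({P i} : Set ℂ) := by rw [← this]; exact ⟨hj, hi⟩
    exact hy _ (mem_singleton_iff.1 h2).symm
  exact disjoint_left.1 (hP.disjoint i j (Ne.symm hne) h1 h2) hi hj

end IsSimple

theorem segment_split {a b y : ℂ} (hy : y ∈ segment ℝ a b) (hya : y ≠ a) (hyb : y ≠ b) :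
    segment ℝ a b = segment ℝ y b ∪ segment ℝ y a ∧ segment ℝ y b ∩ segment ℝ y a = {y} := by
  obtain ⟨t, ht0, ht1, h⟩ := mem_segment_iff_real.1 hy
  have hab : b - a ≠ 0 := by
    intro h0
    rw [h0] at h
    exact hya (by simpa using h)
  have ht0' : 0 < t := by
    rcases ht0.eq_or_lt with h0 | h0
    · subst h0
      exact absurd (by simpa using h) hya
    · exact h0
  have ht1' : t < 1 := by
    rcases ht1.lt_or_eq with h0 | h0
    · exact h0
    · subst h0
      exact absurd (by simpa using h) hyb
  constructor
  · apply subset_antisymm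
    · intro x hx
      obtain ⟨s, hs0, hs1, hs⟩ := mem_segment_iff_real.1 hx
      rcases le_total t s with hts | hts
      · left
        have h1t : (1 - t : ℂ) ≠ 0 := by
          have : (1 - t : ℝ) ≠ 0 := by linarith
          exact_mod_cast this
        refine mem_segment_iff_real.2 ⟨(s - t) / (1 - t), div_nonneg (by linarith) (by linarith),
          (div_le_one (by linarith)).2 (by linarith), ?_⟩
        push_cast
        field_simp
        rw [hs, h]; ring
      · right
        have h1t : (t : ℂ) ≠ 0 := by exact_mod_cast ht0'.ne'
        refine mem_segment_iff_real.2 ⟨(t - s) / t, div_nonneg (by linarith) (by linarith),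
          (div_le_one (by linarith)).2 (by linarith), ?_⟩
        push_cast
        field_simp
        rw [hs, h]; ring
    · refine union_subset ?_ ?_
      · exact (convex_segment a b).segment_subset hy (right_mem_segment ℝ _ _)
      · exact (convex_segment a b).segment_subset hy (left_mem_segment ℝ _ _)
  · apply subset_antisymm
    · rintro x ⟨h1, h2⟩
      obtain ⟨s, hs0, hs1, hs⟩ := mem_segment_iff_real.1 h1
      obtain ⟨r, hr0, hr1, hr⟩ := mem_segment_iff_real.1 h2
      have h3 : ((s * (1 - t) + r * t : ℝ) : ℂ) * (b - a) = 0 := by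
        push_cast
        rw [hs] at hr
        rw [h] at hr
        linear_combination hr
      rw [mul_eq_zero, or_iff_left hab] at h3
      have h4 : s * (1 - t) + r * t = 0 := by exact_mod_cast h3
      have h6 : 0 ≤ r * t := mul_nonneg hr0 ht0'.le
      have h5 : s = 0 := by nlinarith
      rw [hs, h5]
      simp
    · rintro x rfl
      exact ⟨left_mem_segment ℝ _ _, left_mem_segment ℝ _ _⟩

theorem exists_ball_disjoint_edges (P : Polygon ℂ n) (y : ℂ) (J : Set (Fin n))
    (hJ : ∀ j, y ∈ P.edgeSet ℝ j → j ∈ J) :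
    ∃ ε > 0, ∀ x ∈ ball y ε, ∀ j, x ∈ P.edgeSet ℝ j → j ∈ J := by
  have hc : IsClosed (⋃ j ∈ Jᶜ, P.edgeSet ℝ j) := by
    refine (toFinite _).isClosed_biUnion fun j _ => ?_
    rw [edgeSet_eq_segment]
    exact isClosed_segment _ _
  obtain ⟨ε, hε, h⟩ := Metric.isOpen_iff.1 hc.isOpen_compl y (by
    simp only [mem_compl_iff, mem_iUnion, not_exists]
    exact fun j hj hy => hj (hJ j hy))
  refine ⟨ε, hε, fun x hx j hj => ?_⟩
  by_contra hjJ
  exact h hx (mem_biUnion (show j ∈ Jᶜ from hjJ) hj)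

/-- Near a boundary point the boundary consists of two segments. -/
theorem IsSimple.exists_local_boundary (hP : IsSimple P) {y : ℂ} (hy : y ∈ P.boundary ℝ) :
    ∃ c₁ c₂ : ℂ, ∃ ε > 0, c₁ ≠ y ∧ c₂ ≠ y ∧ segment ℝ y c₁ ∩ segment ℝ y c₂ = {y} ∧
      (∀ x ∈ ball y ε, (x ∈ P.boundary ℝ ↔ x ∈ segment ℝ y c₁ ∪ segment ℝ y c₂)) ∧
      ((∀ k, P k ≠ y) → y ∈ segment ℝ c₁ c₂) := by
  by_cases hv : ∃ k, P k = y
  · obtain ⟨k, hk⟩ := hv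
    obtain ⟨i, rfl⟩ := (finRotate n).surjective k
    obtain ⟨ε, hε, h⟩ := exists_ball_disjoint_edges P y {j | j = i ∨ j = finRotate n i}
      (fun j hj => hP.mem_edge_of_vertex (by rwa [hk]))
    refine ⟨P (finRotate n (finRotate n i)), P i, ε, hε, ?_, ?_, ?_, ?_,
      fun h => absurd hk (h _)⟩
    · rw [← hk]; exact hP.vertex_ne _
    · rw [← hk]; exact (hP.vertex_ne _).symm
    · have := hP.adjacent i
      rw [edgeSet_eq_segment, edgeSet_eq_segment, hk] at this
      rw [inter_comm, segment_symm ℝ y (P i)]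
      exact this
    · intro x hx
      rw [segment_symm ℝ y (P i), ← hk, ← edgeSet_eq_segment, ← edgeSet_eq_segment]
      constructor
      · intro hm
        obtain ⟨j, hj⟩ := mem_iUnion.1 hm
        rcases h x hx j hj with rfl | rfl
        · exact Or.inr hj
        · exact Or.inl hj
      · rintro (hm | hm) <;> exact mem_iUnion.2 ⟨_, hm⟩
  · push Not at hv
    obtain ⟨i, hi⟩ := mem_iUnion.1 hy
    obtain ⟨ε, hε, h⟩ := exists_ball_disjoint_edges P y {i}
      (fun j hj => hP.mem_edge_of_not_vertex hv hi hj)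
    have hi' := hi
    rw [edgeSet_eq_segment] at hi'
    obtain ⟨h1, h2⟩ := segment_split hi' (hv _).symm (hv _).symm
    refine ⟨P (finRotate n i), P i, ε, hε, hv _, hv _, h2, fun x hx => ?_, fun _ => ?_⟩
    · rw [← h1, ← edgeSet_eq_segment]
      constructor
      · intro hm
        obtain ⟨j, hj⟩ := mem_iUnion.1 hm
        rwa [← show j = i from h x hx j hj]
      · exact fun hm => mem_iUnion.2 ⟨_, hm⟩
    · rwa [segment_symm]

theorem IsSimple.exists_split (hP : IsSimple P) {y : ℂ} (hy : y ∈ P.boundary ℝ) :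
    ∃ ε₀ > 0, ∀ ε, 0 < ε → ε ≤ ε₀ → ∃ S₁ S₂, IsPreconnected S₁ ∧ IsPreconnected S₂ ∧
      ball y ε \ P.boundary ℝ = S₁ ∪ S₂ ∧ P.boundary ℝ ∩ ball y ε ⊆ closure S₁ ∧
      P.boundary ℝ ∩ ball y ε ⊆ closure S₂ := by
  obtain ⟨c₁, c₂, ε, hε, h1, h2, h12, hB, -⟩ := hP.exists_local_boundary hy
  refine ⟨min ε (min ‖c₁ - y‖ ‖c₂ - y‖), lt_min hε (lt_min (norm_pos_iff.2 (sub_ne_zero.2 h1))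
    (norm_pos_iff.2 (sub_ne_zero.2 h2))), fun δ hδ hδ' => ?_⟩
  exact exists_sectors h1 h2 h12 hB hδ (hδ'.trans (min_le_left _ _))
    (hδ'.trans ((min_le_right _ _).trans (min_le_left _ _)))
    (hδ'.trans ((min_le_right _ _).trans (min_le_right _ _)))

/-! ## The Jordan curve theorem for simple polygons -/

theorem boundary_nonempty (hP : IsSimple P) : (P.boundary ℝ).Nonempty :=
  ⟨P ⟨0, by have := hP.three_le; omega⟩,
    mem_boundary_iff.2 ⟨_, left_mem_segment ℝ _ _⟩⟩

theorem isOpen_component {B : Set ℂ} (hB : IsClosed B) (x : ℂ) :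
    IsOpen (connectedComponentIn Bᶜ x) :=
  hB.isOpen_compl.connectedComponentIn

/-- A relatively closed component: limits of a component of an open set lie in the component or
outside the open set. -/
theorem mem_component_of_mem_closure {O : Set ℂ} (hO : IsOpen O) {x z : ℂ}
    (hz : z ∈ closure (connectedComponentIn O x)) (hzO : z ∈ O) :
    z ∈ connectedComponentIn O x := by
  obtain ⟨w, hw1, hw2⟩ := mem_closure_iff.1 hz _ (hO.connectedComponentIn (x := z))
    (mem_connectedComponentIn hzO)
  rw [connectedComponentIn_eq hw2, ← connectedComponentIn_eq hw1]
  exact mem_connectedComponentIn hzO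

/-- Near a boundary point there are only two sectors of the complement, and each accumulates at all
nearby boundary points. So the set of boundary points in the closure of the component is open in the
boundary; it is also closed, and it is nonempty since otherwise the component would be the whole
plane. The boundary is connected. -/
theorem IsSimple.boundary_subset_closure_component (hP : IsSimple P) {x : ℂ}
    (hx : x ∉ P.boundary ℝ) :
    P.boundary ℝ ⊆ closure (connectedComponentIn (P.boundary ℝ)ᶜ x) := by
  set B := P.boundary ℝ with hBdef
  set U := connectedComponentIn Bᶜ x with hU
  have hBc : IsClosed B := (isCompact_boundary P).isClosed
  have hUo : IsOpen U := isOpen_component hBc x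
  have hxU : x ∈ U := mem_connectedComponentIn hx
  have hUB : U ⊆ Bᶜ := connectedComponentIn_subset _ _
  set u : Set ℂ := {y | ∃ ε > 0, B ∩ ball y ε ⊆ closure U} with hu
  have huo : IsOpen u := by
    rw [Metric.isOpen_iff]
    rintro y ⟨ε, hε, h⟩
    refine ⟨ε / 2, by positivity, fun z hz => ⟨ε / 2, by positivity, ?_⟩⟩
    refine (inter_subset_inter_right _ (ball_subset_ball' ?_)).trans h
    rw [mem_ball] at hz
    linarith
  have hlocal : ∀ y ∈ B, y ∈ closure U → y ∈ u := by
    intro y hy hyU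
    obtain ⟨ε, hε, h⟩ := hP.exists_split hy
    obtain ⟨S₁, S₂, h1, h2, h12, hc1, hc2⟩ := h ε hε le_rfl
    refine ⟨ε, hε, ?_⟩
    obtain ⟨w, hw, hwU⟩ := mem_closure_iff.1 hyU _ isOpen_ball (mem_ball_self hε)
    have hw12 : w ∈ S₁ ∪ S₂ := by rw [← h12]; exact ⟨hw, hUB hwU⟩
    have hsub : S₁ ∪ S₂ ⊆ Bᶜ := by rw [← h12]; exact fun z hz => hz.2
    rw [hU, connectedComponentIn_eq hwU]
    rcases hw12 with hw1 | hw1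
    · exact hc1.trans (closure_mono (h1.subset_connectedComponentIn hw1
        (subset_union_left.trans hsub)))
    · exact hc2.trans (closure_mono (h2.subset_connectedComponentIn hw1
        (subset_union_right.trans hsub)))
  by_contra hnot
  obtain ⟨y, hyB, hyU⟩ := not_subset.1 hnot
  have hne : (B ∩ u).Nonempty := by
    by_contra hemp
    have hclosed : closure U ⊆ U := by
      intro z hz
      by_cases hzB : z ∈ B
      · exact absurd ⟨z, hzB, hlocal z hzB hz⟩ hemp
      · exact mem_component_of_mem_closure hBc.isOpen_compl hz hzB
    have : U = univ := IsClopen.eq_univ ⟨isClosed_of_closure_subset hclosed, hUo⟩ ⟨x, hxU⟩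
    exact hUB (this ▸ mem_univ y) hyB
  obtain ⟨z, hzB, hzu, hzv⟩ := hP.isPreconnected_boundary u (closure U)ᶜ huo
    isClosed_closure.isOpen_compl
    (fun z hz => by
      by_cases h : z ∈ closure U
      · exact Or.inl (hlocal z hz h)
      · exact Or.inr h) hne ⟨y, hyB, hyU⟩
  obtain ⟨ε, hε, h⟩ := hzu
  exact hzv (h ⟨hzB, mem_ball_self hε⟩)

end Polygon

/-! ### Winding numbers and the two sides of an edge -/

section Polygon

variable {n : ℕ} {P : Polygon ℂ n}

/-- The contribution of the `j`-th edge to the winding number of the polygon about `x`. -/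
noncomputable def edgeLog (P : Polygon ℂ n) (j : Fin n) (x : ℂ) : ℂ :=
  Complex.log ((P (finRotate n j) - x) / (P j - x))

theorem vertex_sub_ne_zero {j : Fin n} {x : ℂ} (hx : x ∉ P.edgeSet ℝ j) : P j - x ≠ 0 := by
  intro h
  apply hx
  rw [edgeSet_eq_segment, ← sub_eq_zero.1 h]
  exact left_mem_segment ℝ _ _

theorem continuousAt_edgeLog {j : Fin n} {x : ℂ} (hx : x ∉ P.edgeSet ℝ j) :
    ContinuousAt (edgeLog P j) x := by
  have h0 := vertex_sub_ne_zero hx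
  rw [edgeSet_eq_segment] at hx
  exact ContinuousAt.clog ((continuousAt_const.sub continuousAt_id).div
    (continuousAt_const.sub continuousAt_id) h0) (div_mem_slitPlane hx)

/-- The product of the quotients telescopes around the closed polygon. So the sum of the logarithms
is `2πi` times an integer, the winding number. -/
theorem exp_sum_edgeLog {x : ℂ} (hx : x ∉ P.boundary ℝ) :
    Complex.exp (∑ j, edgeLog P j x) = 1 := by
  have hv : ∀ j, P j - x ≠ 0 := fun j => vertex_sub_ne_zero fun h => hx (mem_iUnion.2 ⟨j, h⟩)
  rw [Complex.exp_sum]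
  have : ∀ j, Complex.exp (edgeLog P j x) = (P (finRotate n j) - x) / (P j - x) := fun j =>
    Complex.exp_log (div_ne_zero (hv _) (hv _))
  simp only [this]
  rw [Finset.prod_div_distrib, Equiv.prod_comp (finRotate n) (fun j => P j - x)]
  exact div_self (Finset.prod_ne_zero_iff.2 fun j _ => hv j)

/-- With the edge as unit of length, these are the quotients for a point at distance `δ` to the left
of the midpoint, and in `tendsto_log_right` to the right of it. They approach `-1` from the two
sides of the branch cut, which produces a jump of `2πi`. -/
theorem tendsto_log_left :
    Tendsto (fun δ : ℝ => Complex.log ((1 / 2 - δ * Complex.I) / (-(1 / 2) - δ * Complex.I)))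
      (𝓝[>] 0) (𝓝 (Real.pi * Complex.I)) := by
  have h := Complex.tendsto_log_nhdsWithin_im_nonneg_of_re_neg_of_im_zero (z := -1) (by simp)
    (by simp)
  simp only [norm_neg, norm_one, Real.log_one, Complex.ofReal_zero, zero_add] at h
  refine h.comp (tendsto_nhdsWithin_iff.2 ⟨?_, ?_⟩)
  · have hc : ContinuousAt
        (fun δ : ℝ => (1 / 2 - δ * Complex.I) / (-(1 / 2) - δ * Complex.I)) 0 := by
      refine ContinuousAt.div (by fun_prop) (by fun_prop) ?_
      norm_num
    have := hc.tendsto.mono_left (nhdsWithin_le_nhds (s := Ioi 0))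
    convert this using 2
    norm_num
  · filter_upwards [self_mem_nhdsWithin] with δ hδ
    simp only [mem_Ioi] at hδ
    simp only [Complex.div_im]
    simp
    have : 0 < Complex.normSq (-2⁻¹ - δ * Complex.I) := by
      simp [Complex.normSq_apply]
      positivity
    rw [← sub_nonneg, ← sub_div]
    apply div_nonneg _ this.le
    norm_num
    linarith

theorem tendsto_log_right :
    Tendsto (fun δ : ℝ => Complex.log ((1 / 2 + δ * Complex.I) / (-(1 / 2) + δ * Complex.I)))
      (𝓝[>] 0) (𝓝 (-(Real.pi * Complex.I))) := by
  have h := Complex.tendsto_log_nhdsWithin_im_neg_of_re_neg_of_im_zero (z := -1) (by simp)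
    (by simp)
  simp only [norm_neg, norm_one, Real.log_one, Complex.ofReal_zero, zero_sub] at h
  refine h.comp (tendsto_nhdsWithin_iff.2 ⟨?_, ?_⟩)
  · have hc : ContinuousAt
        (fun δ : ℝ => (1 / 2 + δ * Complex.I) / (-(1 / 2) + δ * Complex.I)) 0 := by
      refine ContinuousAt.div (by fun_prop) (by fun_prop) ?_
      norm_num
    have := hc.tendsto.mono_left (nhdsWithin_le_nhds (s := Ioi 0))
    convert this using 2
    norm_num
  · filter_upwards [self_mem_nhdsWithin] with δ hδ
    simp only [mem_Ioi] at hδ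
    simp only [Complex.div_im]
    simp
    have : 0 < Complex.normSq (-2⁻¹ + δ * Complex.I) := by
      simp [Complex.normSq_apply]
      positivity
    rw [← sub_neg, ← sub_div]
    apply div_neg_of_neg_of_pos _ this
    norm_num
    linarith

/-- The two sides of an edge belong to different components of the complement. -/
theorem IsSimple.sides_not_subset (hP : IsSimple P) (i : Fin n) {U : Set ℂ}
    (hU : IsPreconnected U) (hUB : U ⊆ (P.boundary ℝ)ᶜ) {ε : ℝ} (hε : 0 < ε) :
    ¬ ball ((P i + P (finRotate n i)) / 2) ε \ P.boundary ℝ ⊆ U := by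
  intro hsub
  set a := P i with ha
  set b := P (finRotate n i) with hb
  set y := (a + b) / 2 with hy
  set u := b - a with hu
  have hu0 : u ≠ 0 := sub_ne_zero.2 (hP.vertex_ne i)
  have hyi : y ∈ P.edgeSet ℝ i := by
    rw [edgeSet_eq_segment]
    exact mem_segment_iff_real.2 ⟨1 / 2, by norm_num, by norm_num, by
      rw [← ha, ← hb, hy]; push_cast; ring⟩
  have hya : y ≠ a := by
    intro h
    apply hu0
    rw [hu]
    linear_combination 2 * h - 2 * hy
  have hyb : y ≠ b := by
    intro h
    apply hu0
    rw [hu]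
    linear_combination -2 * h + 2 * hy
  have hyj : ∀ j, y ∈ P.edgeSet ℝ j → j = i := by
    intro j hj
    by_contra hne
    by_cases h1 : j = finRotate n i
    · have := hP.adjacent i
      rw [← h1] at this
      have h2 : y ∈ ({P j} : Set ℂ) := by rw [← this]; exact ⟨hyi, hj⟩
      rw [h1] at h2
      exact hyb h2
    by_cases h2 : i = finRotate n j
    · have := hP.adjacent j
      rw [← h2] at this
      have h2 : y ∈ ({P i} : Set ℂ) := by rw [← this]; exact ⟨hj, hyi⟩
      exact hya h2
    exact disjoint_left.1 (hP.disjoint i j (Ne.symm hne) h1 h2) hyi hj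
  obtain ⟨η, hη, hball⟩ := exists_ball_disjoint_edges P y {i} hyj
  have hoff : ∀ δ : ℝ, δ ≠ 0 → y + δ * Complex.I * u ∉ P.edgeSet ℝ i := by
    intro δ hδ hm
    rw [edgeSet_eq_segment] at hm
    obtain ⟨t, -, -, ht⟩ := mem_segment_iff_real.1 hm
    rw [← ha, ← hb] at ht
    have h3 : ((1 / 2 - t : ℂ) + δ * Complex.I) * u = 0 := by
      rw [hy, ← hu] at ht
      rw [hu] at ht ⊢
      linear_combination ht
    rw [mul_eq_zero, or_iff_left hu0] at h3
    have h4 := congrArg Complex.im h3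
    simp at h4
    exact hδ h4
  have hcont : Tendsto (fun δ : ℝ => y + δ * Complex.I * u) (𝓝[>] 0) (𝓝 y) := by
    have : Continuous (fun δ : ℝ => y + δ * Complex.I * u) := by fun_prop
    have := (this.tendsto 0).mono_left (nhdsWithin_le_nhds (s := Ioi 0))
    simpa using this
  have hcont' : Tendsto (fun δ : ℝ => y - δ * Complex.I * u) (𝓝[>] 0) (𝓝 y) := by
    have : Continuous (fun δ : ℝ => y - δ * Complex.I * u) := by fun_prop
    have := (this.tendsto 0).mono_left (nhdsWithin_le_nhds (s := Ioi 0))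
    simpa using this
  have hmem : ∀ x ∈ ball y ε, x ∈ ball y η → x ∉ P.edgeSet ℝ i → x ∈ U := by
    intro x hx hx' hxi
    refine hsub ⟨hx, fun h => ?_⟩
    obtain ⟨j, hj⟩ := mem_iUnion.1 h
    have : j = i := hball x hx' j hj
    exact hxi (this ▸ hj)
  have hwc : ContinuousOn (fun x => ∑ j, edgeLog P j x) U := by
    intro x hx
    refine ContinuousAt.continuousWithinAt ?_
    exact tendsto_finsetSum _ fun j _ =>
      continuousAt_edgeLog fun h => hUB hx (mem_iUnion.2 ⟨j, h⟩)
  -- If both sides of the edge near its midpoint lay in the connected set `U`, the winding number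
  -- would take the same value on both sides.
  have heq : ∀ᶠ δ : ℝ in 𝓝[>] 0, (∑ j, edgeLog P j (y + δ * Complex.I * u)) -
      (∑ j, edgeLog P j (y - δ * Complex.I * u)) = 0 := by
    filter_upwards [self_mem_nhdsWithin, hcont (ball_mem_nhds y hε), hcont (ball_mem_nhds y hη),
      hcont' (ball_mem_nhds y hε), hcont' (ball_mem_nhds y hη)] with δ hδ h1 h2 h3 h4
    rw [sub_eq_zero]
    refine hU.eq_of_exp_eq_one hwc (fun x hx => exp_sum_edgeLog (hUB hx))
      (hmem _ h1 h2 (hoff δ (ne_of_gt hδ))) (hmem _ h3 h4 ?_)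
    have := hoff (-δ) (neg_ne_zero.2 (ne_of_gt hδ))
    push_cast at this
    rwa [neg_mul, neg_mul, ← sub_eq_add_neg] at this
  -- All summands other than the `i`-th are continuous at the midpoint, so the whole jump comes from
  -- this edge.
  have hlim : Tendsto (fun δ : ℝ => (∑ j, edgeLog P j (y + δ * Complex.I * u)) -
      (∑ j, edgeLog P j (y - δ * Complex.I * u))) (𝓝[>] 0)
      (𝓝 (2 * Real.pi * Complex.I)) := by
    have hfun : ∀ δ : ℝ, (∑ j, edgeLog P j (y + δ * Complex.I * u)) -
        (∑ j, edgeLog P j (y - δ * Complex.I * u)) =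
        (Complex.log ((1 / 2 - δ * Complex.I) / (-(1 / 2) - δ * Complex.I)) -
          Complex.log ((1 / 2 + δ * Complex.I) / (-(1 / 2) + δ * Complex.I))) +
        ((∑ j ∈ Finset.univ.erase i, edgeLog P j (y + δ * Complex.I * u)) -
          (∑ j ∈ Finset.univ.erase i, edgeLog P j (y - δ * Complex.I * u))) := by
      intro δ
      rw [← Finset.add_sum_erase _ _ (Finset.mem_univ i),
        ← Finset.add_sum_erase _ (fun j => edgeLog P j (y - δ * Complex.I * u))
          (Finset.mem_univ i)]
      have e1 : edgeLog P i (y + δ * Complex.I * u) =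
          Complex.log ((1 / 2 - δ * Complex.I) / (-(1 / 2) - δ * Complex.I)) := by
        unfold edgeLog
        rw [← mul_div_mul_right _ (-(1 / 2) - δ * Complex.I) hu0, ← ha, ← hb]
        congr 2 <;> rw [hy, hu] <;> ring
      have e2 : edgeLog P i (y - δ * Complex.I * u) =
          Complex.log ((1 / 2 + δ * Complex.I) / (-(1 / 2) + δ * Complex.I)) := by
        unfold edgeLog
        rw [← mul_div_mul_right _ (-(1 / 2) + δ * Complex.I) hu0, ← ha, ← hb]
        congr 2 <;> rw [hy, hu] <;> ring
      rw [e1, e2]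
      ring
    simp_rw [hfun]
    have hrest : ContinuousAt (fun x => ∑ j ∈ Finset.univ.erase i, edgeLog P j x) y :=
      tendsto_finsetSum _ fun j hj => continuousAt_edgeLog fun h =>
        (Finset.ne_of_mem_erase hj) (hyj j h)
    have h1 := (hrest.tendsto.comp hcont).sub (hrest.tendsto.comp hcont')
    have h2 := (tendsto_log_left.sub tendsto_log_right).add h1
    have e : 2 * Real.pi * Complex.I = Real.pi * Complex.I - -(Real.pi * Complex.I) +
        (∑ j ∈ Finset.univ.erase i, edgeLog P j y - ∑ j ∈ Finset.univ.erase i, edgeLog P j y) := by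
      ring
    rw [e]
    exact h2
  have h0 := tendsto_nhds_unique (hlim.congr' heq) tendsto_const_nhds
  simp [Real.pi_ne_zero] at h0

theorem isPreconnected_norm_gt (M : ℝ) : IsPreconnected {x : ℂ | M < ‖x‖} := by
  by_cases hM : 0 ≤ M
  · have : {x : ℂ | M < ‖x‖} = (fun q : ℝ × ℝ => (q.1 : ℂ) * Complex.exp (q.2 * Complex.I)) ''
        (Ioi M ×ˢ univ) := by
      ext x
      constructor
      · intro hx
        exact ⟨(‖x‖, x.arg), ⟨hx, mem_univ _⟩, Complex.norm_mul_exp_arg_mul_I x⟩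
      · rintro ⟨⟨r, θ⟩, ⟨hr, -⟩, rfl⟩
        have hr' : M < r := hr
        simp only [mem_ofPred_eq, norm_mul, Complex.norm_exp_ofReal_mul_I, Complex.norm_real,
          mul_one]
        exact hr'.trans_le (le_abs_self r)
    rw [this]
    exact (isPreconnected_Ioi.prod isPreconnected_univ).image _ (by fun_prop)
  · have : {x : ℂ | M < ‖x‖} = univ := by
      ext x
      simp only [mem_ofPred_eq, mem_univ, iff_true]
      push Not at hM
      exact hM.trans_le (norm_nonneg x)
    rw [this]
    exact isPreconnected_univ

theorem not_isBounded_norm_gt (M : ℝ) : ¬ Bornology.IsBounded {x : ℂ | M < ‖x‖} := by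
  intro h
  obtain ⟨R, hR⟩ := h.exists_norm_le
  have := hR ((|M| + |R| + 1 : ℝ) : ℂ) (by
    rw [mem_ofPred_eq, Complex.norm_real, Real.norm_of_nonneg (by positivity)]
    linarith [le_abs_self M, abs_nonneg R])
  rw [Complex.norm_real, Real.norm_of_nonneg (by positivity)] at this
  linarith [abs_nonneg M, le_abs_self R]

/-- The Jordan curve theorem for simple polygons. -/
theorem IsSimple.jordan (hP : IsSimple P) :
    ∃ I O : Set ℂ, IsOpen I ∧ IsOpen O ∧ IsPreconnected I ∧ IsPreconnected O ∧
      Disjoint I O ∧ I ∪ O = (P.boundary ℝ)ᶜ ∧ P.boundary ℝ ⊆ closure I ∧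
      P.boundary ℝ ⊆ closure O ∧ Bornology.IsBounded I ∧ environment P = P.boundary ℝ ∪ I := by
  set B := P.boundary ℝ with hB
  have hBc : IsClosed B := (isCompact_boundary P).isClosed
  obtain ⟨M, hM⟩ := (isCompact_boundary P).isBounded.exists_norm_le
  have hfarB : {x : ℂ | M < ‖x‖} ⊆ Bᶜ := fun x hx hxB => absurd (hM x hxB) (not_le.2 hx)
  set x₀ : ℂ := ((|M| + 1 : ℝ) : ℂ) with hx0
  have hx0M : x₀ ∈ {x : ℂ | M < ‖x‖} := by
    rw [mem_ofPred_eq, hx0, Complex.norm_real, Real.norm_of_nonneg (by positivity)]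
    linarith [le_abs_self M]
  set O := connectedComponentIn Bᶜ x₀ with hO
  have hfarO : {x : ℂ | M < ‖x‖} ⊆ O :=
    (isPreconnected_norm_gt M).subset_connectedComponentIn hx0M hfarB
  have hOunb : ¬ Bornology.IsBounded O := fun h => not_isBounded_norm_gt M (h.subset hfarO)
  have hbd : ∀ x ∈ Bᶜ, connectedComponentIn Bᶜ x ≠ O →
      Bornology.IsBounded (connectedComponentIn Bᶜ x) := by
    intro x hx hne
    refine (isBounded_closedBall (x := (0 : ℂ)) (r := M)).subset fun z hz => ?_
    by_contra hzM
    rw [mem_closedBall, dist_zero_right, not_le] at hzM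
    exact hne (by rw [hO, connectedComponentIn_eq hz, ← connectedComponentIn_eq (hfarO hzM)])
  obtain ⟨i₀⟩ : Nonempty (Fin n) := ⟨⟨0, by have := hP.three_le; omega⟩⟩
  set y := (P i₀ + P (finRotate n i₀)) / 2 with hy
  have hyB : y ∈ B := mem_boundary_iff.2 ⟨i₀, mem_segment_iff_real.2
    ⟨1 / 2, by norm_num, by norm_num, by rw [hy]; push_cast; ring⟩⟩
  obtain ⟨ε, hε, h⟩ := hP.exists_split hyB
  obtain ⟨S₁, S₂, h1, h2, h12, hc1, hc2⟩ := h ε hε le_rfl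
  have hsub : S₁ ∪ S₂ ⊆ Bᶜ := by rw [← h12]; exact fun z hz => hz.2
  have hyb : y ∈ B ∩ ball y ε := ⟨hyB, mem_ball_self hε⟩
  obtain ⟨x₁, hx1⟩ : S₁.Nonempty := closure_nonempty_iff.1 ⟨y, hc1 hyb⟩
  obtain ⟨x₂, hx2⟩ : S₂.Nonempty := closure_nonempty_iff.1 ⟨y, hc2 hyb⟩
  have hs1 : S₁ ⊆ connectedComponentIn Bᶜ x₁ :=
    h1.subset_connectedComponentIn hx1 (subset_union_left.trans hsub)
  have hs2 : S₂ ⊆ connectedComponentIn Bᶜ x₂ :=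
    h2.subset_connectedComponentIn hx2 (subset_union_right.trans hsub)
  have hx1B : x₁ ∈ Bᶜ := hsub (Or.inl hx1)
  have hx2B : x₂ ∈ Bᶜ := hsub (Or.inr hx2)
  have hne : connectedComponentIn Bᶜ x₁ ≠ connectedComponentIn Bᶜ x₂ := by
    intro he
    apply hP.sides_not_subset i₀ (isPreconnected_connectedComponentIn (x := x₁))
      (connectedComponentIn_subset _ _) hε
    rw [h12]
    exact union_subset hs1 (he ▸ hs2)
  -- Every component accumulates at `y`, hence meets one of the two sectors there, hence is one of
  -- at most two components.
  have htwo : ∀ x ∈ Bᶜ, connectedComponentIn Bᶜ x = connectedComponentIn Bᶜ x₁ ∨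
      connectedComponentIn Bᶜ x = connectedComponentIn Bᶜ x₂ := by
    intro x hx
    have := hP.boundary_subset_closure_component hx hyB
    obtain ⟨w, hw, hwU⟩ := mem_closure_iff.1 this _ isOpen_ball (mem_ball_self hε)
    have hw12 : w ∈ S₁ ∪ S₂ := by
      rw [← h12]; exact ⟨hw, connectedComponentIn_subset _ _ hwU⟩
    rw [connectedComponentIn_eq hwU]
    rcases hw12 with hw1 | hw1
    · exact Or.inl (connectedComponentIn_eq (hs1 hw1)).symm
    · exact Or.inr (connectedComponentIn_eq (hs2 hw1)).symm
  have hx0B : x₀ ∈ Bᶜ := hfarB hx0M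
  -- One of the two components is the unbounded `O`; the point `x₃` marks the other one.
  obtain ⟨x₃, hx3B, hx3, htwo'⟩ : ∃ x₃ ∈ Bᶜ, connectedComponentIn Bᶜ x₃ ≠ O ∧
      ∀ x ∈ Bᶜ, connectedComponentIn Bᶜ x = connectedComponentIn Bᶜ x₃ ∨
        connectedComponentIn Bᶜ x = O := by
    rcases htwo x₀ hx0B with h0 | h0
    · refine ⟨x₂, hx2B, fun h => hne (by rw [← h0, h]), fun x hx => ?_⟩
      rw [hO, h0]
      exact (htwo x hx).symm
    · refine ⟨x₁, hx1B, fun h => hne (by rw [← h0, h]), fun x hx => ?_⟩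
      rw [hO, h0]
      exact htwo x hx
  refine ⟨connectedComponentIn Bᶜ x₃, O, isOpen_component hBc _, isOpen_component hBc _,
    isPreconnected_connectedComponentIn, isPreconnected_connectedComponentIn, ?_, ?_,
    hP.boundary_subset_closure_component hx3B, hP.boundary_subset_closure_component hx0B,
    hbd _ hx3B hx3, ?_⟩
  · rw [disjoint_left]
    intro z hz hzO
    exact hx3 (by rw [hO, connectedComponentIn_eq hz, ← connectedComponentIn_eq hzO])
  · refine subset_antisymm (union_subset (connectedComponentIn_subset _ _)
      (connectedComponentIn_subset _ _)) fun x hx => ?_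
    rcases htwo' x hx with h | h
    · exact Or.inl (h ▸ mem_connectedComponentIn hx)
    · exact Or.inr (h ▸ mem_connectedComponentIn hx)
  · unfold environment
    congr 1
    ext x
    constructor
    · rintro ⟨hx, hxb⟩
      rcases htwo' x hx with h | h
      · exact h ▸ mem_connectedComponentIn hx
      · exact absurd (h ▸ hxb) hOunb
    · intro hx
      refine ⟨connectedComponentIn_subset _ _ hx, ?_⟩
      rw [← connectedComponentIn_eq hx]
      exact hbd _ hx3B hx3

end Polygon

/-! ### Polygonal environments -/

/-- The properties of a closed polygonal region on which everything else is based.  The set `V`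
contains the points where the region fails to be locally convex. -/
structure PolyEnv (E V : Set ℂ) : Prop where
  compact : IsCompact E
  compl_conn : IsPreconnected Eᶜ
  int_conn : IsConnected (interior E)
  subset_closure : E ⊆ closure (interior E)
  loc : ∀ y ∈ E, ∃ ε₀ > 0, ∀ ε, 0 < ε → ε ≤ ε₀ →
    IsPreconnected (interior E ∩ ball y ε) ∧ IsPreconnected (ball y ε \ E)
  conic : ∀ q, Conic E q
  finite : V.Finite
  convexAt : ∀ x ∉ V, ∃ ε > 0, Convex ℝ (E ∩ ball x ε)

theorem isLinearMap_div_im (d : ℂ) : IsLinearMap ℝ fun x : ℂ => (x / d).im :=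
  ⟨fun x y => by simp [add_div], fun c x => by
    simp [mul_div_assoc]⟩

section Polygon

variable {n : ℕ} {P : Polygon ℂ n}

/-- Away from the vertices, a set bounded by a simple polygon is locally convex. -/
theorem IsSimple.convexAt_edge (hP : IsSimple P) {I O : Set ℂ} (hI : IsOpen I) (hO : IsOpen O)
    (hdisj₀ : Disjoint I O) (hU : I ∪ O = (P.boundary ℝ)ᶜ) {y : ℂ} (hy : y ∈ P.boundary ℝ)
    (hv : ∀ k, P k ≠ y) : ∃ ε > 0, Convex ℝ ((P.boundary ℝ ∪ I) ∩ ball y ε) := by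
  obtain ⟨c₁, c₂, ε, hε, h1, h2, -, hB, hflat⟩ := hP.exists_local_boundary hy
  obtain ⟨t, ht0, ht1, ht⟩ := mem_segment_iff_real.1 (hflat hv)
  set d := c₁ - y with hd
  have hd0 : d ≠ 0 := sub_ne_zero.2 h1
  have ht1' : t < 1 := by
    refine lt_of_le_of_ne ht1 fun h => h2 ?_
    rw [ht, h]; push_cast; ring
  have ht0' : 0 < t := by
    refine lt_of_le_of_ne ht0 fun h => h1 ?_
    rw [ht, ← h]; push_cast; ring
  have htc : (t : ℂ) ≠ 0 := by exact_mod_cast ht0'.ne'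
  have hc2 : c₂ - y = -((1 - t) / t : ℝ) * d := by
    rw [hd]; push_cast; field_simp; linear_combination -ht
  set l : ℝ := (1 - t) / t with hl
  have hl0 : 0 < l := div_pos (by linarith) ht0'
  have hdn : 0 < ‖d‖ := norm_pos_iff.2 hd0
  obtain ⟨δ, hδ, hδε, hδd, hδl⟩ : ∃ δ > 0, δ ≤ ε ∧ δ ≤ ‖d‖ ∧ δ ≤ l * ‖d‖ :=
    ⟨min ε (min ‖d‖ (l * ‖d‖)), lt_min hε (lt_min hdn (mul_pos hl0 hdn)), min_le_left _ _,
      (min_le_right _ _).trans (min_le_left _ _), (min_le_right _ _).trans (min_le_right _ _)⟩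
  -- In the small ball both edge pieces reach the rim, so the boundary fills the whole line through
  -- `y` in the direction `d`.
  have hBd : ∀ x ∈ ball y δ, x ∈ P.boundary ℝ ↔ (x / d).im = (y / d).im := by
    intro x hx
    rw [hB x (ball_subset_ball hδε hx)]
    constructor
    · rintro (h | h)
      · obtain ⟨s, -, -, rfl⟩ := mem_segment_iff_real.1 h
        rw [add_div, mul_div_assoc, div_self hd0]
        simp
      · obtain ⟨s, -, -, rfl⟩ := mem_segment_iff_real.1 h
        have : (y + s * (c₂ - y)) / d = y / d + ((-(s * l) : ℝ) : ℂ) := by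
          rw [hc2]; push_cast; field_simp
        rw [this, Complex.add_im, Complex.ofReal_im, add_zero]
    · intro h
      have hr : x - y = (((x - y) / d).re : ℂ) * d := by
        have : (((x - y) / d).re : ℂ) = (x - y) / d := by
          apply Complex.ext
          · simp
          · rw [sub_div, Complex.sub_im, h]; simp
        rw [this, div_mul_cancel₀ _ hd0]
      set r := ((x - y) / d).re
      have hrn : |r| * ‖d‖ < δ := by
        rw [mem_ball, dist_eq_norm, hr, norm_mul, Complex.norm_real] at hx
        exact hx
      rcases le_total 0 r with h0 | h0
      · left
        rw [abs_of_nonneg h0] at hrn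
        exact mem_segment_iff_real.2 ⟨r, h0, by nlinarith, by linear_combination hr⟩
      · right
        rw [abs_of_nonpos h0] at hrn
        refine mem_segment_iff_real.2 ⟨-r / l, div_nonneg (by linarith) hl0.le, ?_, ?_⟩
        · rw [div_le_one hl0]; nlinarith
        · rw [hc2]
          have : (l : ℂ) ≠ 0 := by exact_mod_cast hl0.ne'
          push_cast; field_simp
          linear_combination hr
  have hlin := isLinearMap_div_im d
  have side : ∀ S : Set ℂ, Convex ℝ S → (∀ x ∈ S ∩ ball y δ, (x / d).im ≠ (y / d).im) →
      S ∩ ball y δ ⊆ I ∨ S ∩ ball y δ ⊆ O := by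
    intro S hS hne
    refine (hS.inter (convex_ball y δ)).isPreconnected.subset_or_subset hI hO hdisj₀ ?_
    rw [hU]
    intro x hx hxB
    exact hne x hx ((hBd x hx.2).1 hxB)
  have hp := side {x | (y / d).im < (x / d).im} (convex_halfSpace_gt hlin _) fun x hx => hx.1.ne'
  have hm := side {x | (x / d).im < (y / d).im} (convex_halfSpace_lt hlin _) fun x hx => hx.1.ne
  have hIB : ∀ x ∈ I, x ∉ P.boundary ℝ := fun x hx => by
    have : x ∈ (P.boundary ℝ)ᶜ := hU ▸ Or.inl hx
    exact this
  have hOB : ∀ x ∈ O, x ∉ P.boundary ℝ ∪ I := fun x hx h => by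
    have h3 : x ∈ (P.boundary ℝ)ᶜ := hU ▸ Or.inr hx
    rcases h with h | h
    · exact h3 h
    · exact disjoint_left.1 hdisj₀ h hx
  have build : ∀ S : Set ℂ, Convex ℝ S →
      (∀ x ∈ ball y δ, x ∈ P.boundary ℝ ∪ I ↔ x ∈ S) →
      ∃ ε > 0, Convex ℝ ((P.boundary ℝ ∪ I) ∩ ball y ε) := by
    intro S hS h
    refine ⟨δ, hδ, ?_⟩
    have : (P.boundary ℝ ∪ I) ∩ ball y δ = S ∩ ball y δ := by
      ext x
      exact and_congr_left fun hx => h x hx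
    rw [this]
    exact hS.inter (convex_ball y δ)
  -- Each open half-disc belongs to `I` or to `O`. In all four combinations the set is locally
  -- everything, a half-plane or a line, so there is no need to exclude the cases that do not occur.
  rcases hp with hp | hp <;> rcases hm with hm | hm
  · refine build univ convex_univ fun x hx => iff_of_true ?_ (mem_univ _)
    rcases lt_trichotomy (x / d).im (y / d).im with h | h | h
    · exact Or.inr (hm ⟨h, hx⟩)
    · exact Or.inl ((hBd x hx).2 h)
    · exact Or.inr (hp ⟨h, hx⟩)
  · refine build {x | (y / d).im ≤ (x / d).im} (convex_halfSpace_ge hlin _) fun x hx => ?_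
    rw [mem_ofPred_eq]
    rcases lt_trichotomy (x / d).im (y / d).im with h | h | h
    · exact iff_of_false (hOB x (hm ⟨h, hx⟩)) (not_le.2 h)
    · exact iff_of_true (Or.inl ((hBd x hx).2 h)) h.ge
    · exact iff_of_true (Or.inr (hp ⟨h, hx⟩)) h.le
  · refine build {x | (x / d).im ≤ (y / d).im} (convex_halfSpace_le hlin _) fun x hx => ?_
    rw [mem_ofPred_eq]
    rcases lt_trichotomy (x / d).im (y / d).im with h | h | h
    · exact iff_of_true (Or.inr (hm ⟨h, hx⟩)) h.le
    · exact iff_of_true (Or.inl ((hBd x hx).2 h)) h.le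
    · exact iff_of_false (hOB x (hp ⟨h, hx⟩)) (not_le.2 h)
  · refine build {x | (x / d).im = (y / d).im} (convex_hyperplane hlin _) fun x hx => ?_
    rw [mem_ofPred_eq]
    rcases lt_trichotomy (x / d).im (y / d).im with h | h | h
    · exact iff_of_false (hOB x (hm ⟨h, hx⟩)) h.ne
    · exact iff_of_true (Or.inl ((hBd x hx).2 h)) h
    · exact iff_of_false (hOB x (hp ⟨h, hx⟩)) h.ne'

/-- Boundary points are limits of the outer component, so the interior of the environment is exactly
the inner component. Conicity passes from segments to their union, the boundary, and then to
components of its complement. Local convexity at a vertex that is not reflex is the definition of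
reflex. -/
theorem IsSimple.polyEnv (hP : IsSimple P) :
    PolyEnv (environment P) {x | ∃ i, IsReflex P i ∧ P i = x} ∧
      ∀ x ∈ P.boundary ℝ, x ∈ environment P ∧ x ∉ interior (environment P) := by
  obtain ⟨I, O, hI, hO, hIc, hOc, hdisj₀, hU, hBI, hBO, hIb, hE⟩ := hP.jordan
  set B := P.boundary ℝ with hB
  have hBc := isCompact_boundary P
  have hEc : (environment P)ᶜ = O := by
    rw [hE]
    ext x
    constructor
    · intro hx
      have : x ∈ I ∪ O := by
        rw [hU]; exact fun h => hx (Or.inl h)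
      exact this.resolve_left fun h => hx (Or.inr h)
    · rintro hx (h | h)
      · have : x ∈ Bᶜ := hU ▸ Or.inr hx
        exact this h
      · exact disjoint_left.1 hdisj₀ h hx
  have hEcl : IsClosed (environment P) := by
    rw [← isOpen_compl_iff, hEc]; exact hO
  have hBint : ∀ x ∈ B, x ∉ interior (environment P) := by
    intro x hx hxi
    obtain ⟨w, hw1, hw2⟩ := mem_closure_iff.1 (hBO hx) _ isOpen_interior hxi
    rw [← hEc] at hw2
    exact hw2 (interior_subset hw1)
  have hint : interior (environment P) = I := by
    apply subset_antisymm
    · intro x hx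
      have := interior_subset hx
      rw [hE] at this
      exact this.resolve_left fun h => hBint x h hx
    · exact interior_maximal (by rw [hE]; exact subset_union_right) hI
  have hconic : ∀ q, Conic (environment P) q := by
    intro q
    have hIcomp : ∀ x ∈ I, I = connectedComponentIn Bᶜ x := by
      intro x hx
      apply subset_antisymm
      · exact hIc.subset_connectedComponentIn hx (hU ▸ subset_union_left)
      · refine isPreconnected_connectedComponentIn.subset_left_of_subset_union hI hO hdisj₀ ?_ ?_
        · rw [hU]; exact connectedComponentIn_subset _ _
        · exact ⟨x, mem_connectedComponentIn (hU ▸ Or.inl hx), hx⟩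
    rw [hE]
    obtain ⟨x, hx⟩ : I.Nonempty := closure_nonempty_iff.1 ((boundary_nonempty hP).mono hBI)
    have hIq : Conic I q := by
      rw [hIcomp x hx]
      exact (conic_boundary P q).compl.component x
    have := ((conic_boundary P q).compl.inter hIq.compl).compl
    rwa [compl_inter, compl_compl, compl_compl] at this
  refine ⟨⟨?_, ?_, ?_, ?_, ?_, hconic, ?_, ?_⟩, fun x hx => ⟨?_, hBint x hx⟩⟩
  · refine Metric.isCompact_of_isClosed_isBounded hEcl ?_
    rw [hE]
    exact hBc.isBounded.union hIb
  · rw [hEc]; exact hOc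
  · rw [hint]
    exact ⟨closure_nonempty_iff.1 ((boundary_nonempty hP).mono hBI), hIc⟩
  · rw [hint, hE]
    exact union_subset hBI subset_closure
  · intro y hy
    by_cases hyB : y ∈ B
    · obtain ⟨ε₀, hε₀, h⟩ := hP.exists_split hyB
      refine ⟨ε₀, hε₀, fun ε hε hle => ?_⟩
      obtain ⟨S₁, S₂, h1, h2, h12, hc1, hc2⟩ := h ε hε hle
      have hyb : y ∈ B ∩ ball y ε := ⟨hyB, mem_ball_self hε⟩
      have hsub : S₁ ∪ S₂ ⊆ Bᶜ := by rw [← h12]; exact fun z hz => hz.2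
      have hIball : interior (environment P) ∩ ball y ε = I ∩ (S₁ ∪ S₂) := by
        rw [hint, ← h12]
        ext x
        constructor
        · rintro ⟨hx, hxb⟩
          exact ⟨hx, hxb, by have : x ∈ Bᶜ := hU ▸ Or.inl hx
                             exact this⟩
        · rintro ⟨hx, hxb, -⟩
          exact ⟨hx, hxb⟩
      have hOball : ball y ε \ environment P = O ∩ (S₁ ∪ S₂) := by
        rw [sdiff_eq, hEc, ← h12]
        ext x
        constructor
        · rintro ⟨hxb, hx⟩
          exact ⟨hx, hxb, by have : x ∈ Bᶜ := hU ▸ Or.inr hx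
                             exact this⟩
        · rintro ⟨hx, hxb, -⟩
          exact ⟨hxb, hx⟩
      have hI' : (I ∩ (S₁ ∪ S₂)).Nonempty := by
        obtain ⟨w, hw1, hw2⟩ := mem_closure_iff.1 (hBI hyB) _ isOpen_ball (mem_ball_self hε)
        rw [← hIball, hint]
        exact ⟨w, hw2, hw1⟩
      have hO' : (O ∩ (S₁ ∪ S₂)).Nonempty := by
        obtain ⟨w, hw1, hw2⟩ := mem_closure_iff.1 (hBO hyB) _ isOpen_ball (mem_ball_self hε)
        rw [← hOball, sdiff_eq, hEc]
        exact ⟨w, hw1, hw2⟩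
      have key : ∀ S T X Y : Set ℂ, S ⊆ X → T ⊆ Y → Disjoint X Y → X ∩ (S ∪ T) = S := by
        intro S T X Y hS hT hXY
        ext x
        constructor
        · rintro ⟨hx, h | h⟩
          · exact h
          · exact absurd (hT h) (disjoint_left.1 hXY hx)
        · exact fun h => ⟨hS h, Or.inl h⟩
      rw [hIball, hOball]
      -- Each sector lies in one of the two components. As both components accumulate at `y`, one
      -- sector is inside and the other outside.
      have e1 := h1.subset_or_subset hI hO hdisj₀ (by rw [hU]; exact subset_union_left.trans hsub)
      have e2 := h2.subset_or_subset hI hO hdisj₀ (by rw [hU]; exact subset_union_right.trans hsub)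
      rcases e1 with e1 | e1 <;> rcases e2 with e2 | e2
      · obtain ⟨w, hw, hw'⟩ := hO'
        exact absurd hw (disjoint_left.1 hdisj₀ (union_subset e1 e2 hw'))
      · rw [key S₁ S₂ I O e1 e2 hdisj₀, union_comm, key S₂ S₁ O I e2 e1 hdisj₀.symm]
        exact ⟨h1, h2⟩
      · rw [key S₁ S₂ O I e1 e2 hdisj₀.symm, union_comm, key S₂ S₁ I O e2 e1 hdisj₀]
        exact ⟨h2, h1⟩
      · obtain ⟨w, hw, hw'⟩ := hI'
        exact absurd (union_subset e1 e2 hw') (disjoint_left.1 hdisj₀ hw)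
    · have hyI : y ∈ I := by
        rw [hE] at hy
        exact hy.resolve_left hyB
      obtain ⟨ε₀, hε₀, h⟩ := Metric.isOpen_iff.1 hI y hyI
      refine ⟨ε₀, hε₀, fun ε hε hle => ?_⟩
      have hb : ball y ε ⊆ I := (ball_subset_ball hle).trans h
      rw [hint, inter_eq_right.2 hb, sdiff_eq_empty.2 (hb.trans (hint ▸ interior_subset))]
      exact ⟨(convex_ball y ε).isPreconnected, isPreconnected_empty⟩
  · exact (toFinite (P '' {i | IsReflex P i})).subset fun x ⟨i, hi, h⟩ => ⟨i, hi, h⟩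
  · intro x hx
    by_cases hxE : x ∈ environment P
    · by_cases hxB : x ∈ B
      · by_cases hv : ∃ k, P k = x
        · obtain ⟨k, rfl⟩ := hv
          by_contra hcon
          push Not at hcon
          exact hx ⟨k, hcon, rfl⟩
        · push Not at hv
          rw [hE]
          exact hP.convexAt_edge hI hO hdisj₀ hU hxB hv
      · have hxI : x ∈ I := by
          rw [hE] at hxE
          exact hxE.resolve_left hxB
        obtain ⟨ε, hε, h⟩ := Metric.isOpen_iff.1 hI x hxI
        refine ⟨ε, hε, ?_⟩
        rw [inter_eq_right.2 (h.trans (hint ▸ interior_subset))]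
        exact convex_ball x ε
    · obtain ⟨ε, hε, h⟩ := Metric.isOpen_iff.1 hEcl.isOpen_compl x hxE
      refine ⟨ε, hε, ?_⟩
      rw [show environment P ∩ ball x ε = ∅ from
        eq_empty_iff_forall_notMem.2 fun z hz => h hz.2 hz.1]
      exact convex_empty
  · rw [hE]; exact Or.inl hx

end Polygon

/-! ## Visibility -/

section Visibility

variable {E V : Set ℂ} {p q z : ℂ}

theorem mem_visibilitySet_iff :
    q ∈ visibilitySet E p ↔ ∀ t : ℝ, 0 ≤ t → t ≤ 1 → p + t * (q - p) ∈ E := by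
  constructor
  · intro h t h0 h1
    exact h (mem_segment_iff_real.2 ⟨t, h0, h1, rfl⟩)
  · intro h x hx
    obtain ⟨t, h0, h1, rfl⟩ := mem_segment_iff_real.1 hx
    exact h t h0 h1

theorem visible_comm : q ∈ visibilitySet E p ↔ p ∈ visibilitySet E q := by
  change segment ℝ p q ⊆ E ↔ segment ℝ q p ⊆ E
  rw [segment_symm]

theorem visibilitySet_subset : visibilitySet E p ⊆ E :=
  fun _ hq => hq (right_mem_segment ℝ _ _)

theorem mem_of_visible (hq : q ∈ visibilitySet E p) : p ∈ E :=
  hq (left_mem_segment ℝ _ _)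

theorem visible_of_mem_segment (hq : q ∈ visibilitySet E p) (hz : z ∈ segment ℝ p q) :
    z ∈ visibilitySet E p :=
  ((convex_segment p q).segment_subset (left_mem_segment ℝ _ _) hz).trans hq

theorem isClosed_visibilitySet (hE : IsClosed E) (p : ℂ) : IsClosed (visibilitySet E p) := by
  have : visibilitySet E p = ⋂ t : Icc (0 : ℝ) 1, {q | p + (t : ℝ) * (q - p) ∈ E} := by
    ext q
    rw [mem_visibilitySet_iff, mem_iInter]
    exact ⟨fun h t => h t t.2.1 t.2.2, fun h t h0 h1 => h ⟨t, h0, h1⟩⟩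
  rw [this]
  exact isClosed_iInter fun t => hE.preimage (by fun_prop)

theorem segment_subset_union_of_collinear {s : ℝ} (hq : q = z + s * (p - z)) :
    segment ℝ p q ⊆ segment ℝ p z ∪ segment ℝ z q := by
  intro x hx
  obtain ⟨t, h0, h1, rfl⟩ := mem_segment_iff_real.1 hx
  have hx : p + t * (q - p) = z + ((1 - t * (1 - s) : ℝ) : ℂ) * (p - z) := by
    rw [hq]; push_cast; ring
  rw [hx]
  by_cases h : 0 ≤ 1 - t * (1 - s)
  · by_cases h' : 1 - t * (1 - s) ≤ 1
    · left
      rw [segment_symm]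
      exact mem_segment_iff_real.2 ⟨_, h, h', rfl⟩
    · right
      push Not at h'
      have hs : 1 < s := by nlinarith
      refine mem_segment_iff_real.2 ⟨(1 - t * (1 - s)) / s, by positivity, ?_, ?_⟩
      · rw [div_le_one (by linarith)]; nlinarith
      · rw [hq]
        have : (s : ℂ) ≠ 0 := by
          have : s ≠ 0 := by linarith
          exact_mod_cast this
        push_cast; field_simp; ring
  · right
    push Not at h
    have hs : s < 0 := by nlinarith
    refine mem_segment_iff_real.2 ⟨(1 - t * (1 - s)) / s, div_nonneg_of_nonpos h.le hs.le, ?_, ?_⟩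
    · rw [div_le_one_of_neg hs]; nlinarith
    · rw [hq]
      have : (s : ℂ) ≠ 0 := by exact_mod_cast hs.ne
      push_cast; field_simp; ring

/-- The segment from `p` to `q` is covered by the segments from `p` to `z` and from `z` to `q`,
whatever the order of the three points on their line; accordingly `s` is an arbitrary real number.
-/
theorem visible_of_collinear {s : ℝ} (hz : z ∈ visibilitySet E p) (hq : q ∈ visibilitySet E z)
    (h : q = z + s * (p - z)) : q ∈ visibilitySet E p :=
  (segment_subset_union_of_collinear h).trans (union_subset hz hq)

theorem eq_real_mul_of_im_div_eq_zero {a d : ℂ} (hd : d ≠ 0) (h : (a / d).im = 0) :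
    a = ((a / d).re : ℂ) * d := by
  have : ((a / d).re : ℂ) = a / d := by
    apply Complex.ext <;> simp [h]
  rw [this, div_mul_cancel₀ _ hd]

/-! ### Visibility across a line, by continuous logarithms -/

namespace PolyEnv

theorem isClosed (h : PolyEnv E V) : IsClosed E := h.compact.isClosed

/-- The function `w - x` has a continuous logarithm on `E` if `x` is not in `E`. -/
theorem exists_log (h : PolyEnv E V) {x : ℂ} (hx : x ∉ E) :
    ∃ g : ℂ → ℂ, ContinuousOn g E ∧ ∀ w ∈ E, Complex.exp (g w) = w - x := by
  set G : Set ℂ := {x | x ∉ E ∧ ∃ g : ℂ → ℂ, ContinuousOn g E ∧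
    ∀ w ∈ E, Complex.exp (g w) = w - x} with hG
  have step : ∀ x ∈ G, ∀ y, y ∉ E → (∀ w ∈ E, ‖x - y‖ < ‖w - x‖) → y ∈ G := by
    rintro x ⟨hx, g, hg, hgx⟩ y hy hxy
    have hne : ∀ w ∈ E, w - x ≠ 0 := fun w hw h0 => hx (by rwa [sub_eq_zero.1 h0] at hw)
    have hs : ∀ w ∈ E, (w - y) / (w - x) ∈ Complex.slitPlane := by
      intro w hw
      have : (w - y) / (w - x) = 1 + (x - y) / (w - x) := by
        field_simp [hne w hw]; ring
      rw [this]
      apply Complex.mem_slitPlane_of_norm_lt_one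
      rw [norm_div, div_lt_one (norm_pos_iff.2 (hne w hw))]
      exact hxy w hw
    refine ⟨hy, fun w => g w + Complex.log ((w - y) / (w - x)), ?_, fun w hw => ?_⟩
    · refine hg.add (ContinuousOn.clog ?_ hs)
      exact ContinuousOn.div (by fun_prop) (by fun_prop) hne
    · rw [Complex.exp_add, hgx w hw, Complex.exp_log (Complex.slitPlane_ne_zero (hs w hw))]
      field_simp [hne w hw]
  have hEc : IsOpen Eᶜ := h.isClosed.isOpen_compl
  have hGo : IsOpen G := by
    rw [Metric.isOpen_iff]
    rintro x hx
    obtain ⟨ε, hε, hball⟩ := Metric.isOpen_iff.1 hEc x hx.1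
    refine ⟨ε, hε, fun y hy => step x hx y (hball hy) fun w hw => ?_⟩
    rw [mem_ball, dist_comm, dist_eq_norm] at hy
    by_contra hlt
    push Not at hlt
    refine hball ?_ hw
    rw [mem_ball, dist_eq_norm]
    exact hlt.trans_lt hy
  have hGc : closure G ∩ Eᶜ ⊆ G := by
    rintro y ⟨hy, hyE⟩
    obtain ⟨ε, hε, hball⟩ := Metric.isOpen_iff.1 hEc y hyE
    obtain ⟨x, hx, hxG⟩ := mem_closure_iff.1 hy _ isOpen_ball
      (mem_ball_self (half_pos hε) : y ∈ ball y (ε / 2))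
    refine step x hxG y hyE fun w hw => ?_
    rw [mem_ball, dist_eq_norm] at hx
    by_contra hlt
    push Not at hlt
    refine hball ?_ hw
    rw [mem_ball, dist_eq_norm]
    calc ‖w - y‖ = ‖(w - x) + (x - y)‖ := by ring_nf
      _ ≤ ‖w - x‖ + ‖x - y‖ := norm_add_le _ _
      _ < ε := by linarith
  obtain ⟨M, hM⟩ := h.compact.isBounded.exists_norm_le
  -- For a point far to the left, all `w - x` have positive real part, so the principal logarithm
  -- does.
  have hfar : ((-(|M| + 1) : ℝ) : ℂ) ∈ G := by
    have hre : ∀ w ∈ E, 0 < (w - ((-(|M| + 1) : ℝ) : ℂ)).re := by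
      intro w hw
      have h1 := hM w hw
      have h2 := (abs_le.1 (Complex.abs_re_le_norm w)).1
      rw [Complex.sub_re, Complex.ofReal_re]
      linarith [le_abs_self M]
    refine ⟨fun hmem => ?_, fun w => Complex.log (w - ((-(|M| + 1) : ℝ) : ℂ)), ?_,
      fun w hw => ?_⟩
    · have := hre _ hmem
      simp at this
    · exact ContinuousOn.clog (by fun_prop) fun w hw => Or.inl (hre w hw)
    · exact Complex.exp_log (Complex.slitPlane_ne_zero (Or.inl (hre w hw)))
  have hsub := h.compl_conn.subset_of_closure_inter_subset hGo ⟨_, hfar.1, hfar⟩ hGc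
  exact (hsub hx).2

/-- On every half-line from a point `p` of `E` there is a point outside `E` that precedes all points
of a compact set `K ⊆ E` none of whose points on the half-line is visible from `p`. -/
theorem exists_notMem_before (h : PolyEnv E V) {K : Set ℂ} {e : ℂ} (hp : p ∈ E)
    (hK : IsCompact K) (hKE : K ⊆ E) (hpK : p ∉ K) (he : e ≠ 0)
    (hinv : ∀ r : ℝ, 0 < r → p + r * e ∈ K → p + r * e ∉ visibilitySet E p) :
    ∃ r : ℝ, 0 < r ∧ p + r * e ∉ E ∧ ∀ s : ℝ, 0 ≤ s → s ≤ r → p + s * e ∉ K := by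
  set A : Set ℝ := {r | 0 ≤ r ∧ p + r * e ∈ K} with hA
  by_cases hne : A.Nonempty
  · have hAc : IsClosed A := by
      have : A = Ici 0 ∩ (fun r : ℝ => p + r * e) ⁻¹' K := rfl
      rw [this]
      exact isClosed_Ici.inter (hK.isClosed.preimage (by fun_prop))
    have hbdd : BddBelow A := ⟨0, fun r hr => hr.1⟩
    have hmem := hAc.csInf_mem hne hbdd
    -- This is the first point of `K` on the half-line. It is not visible, so some point before it
    -- lies outside `E`. If the half-line misses `K`, any sufficiently distant point will do.
    set ρ := sInf A with hρ
    have hρ0 : 0 < ρ := by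
      refine lt_of_le_of_ne hmem.1 fun h0 => hpK ?_
      have := hmem.2
      rwa [← h0, Complex.ofReal_zero, zero_mul, add_zero] at this
    have := hinv ρ hρ0 hmem.2
    rw [mem_visibilitySet_iff] at this
    push Not at this
    obtain ⟨t, ht0, ht1, ht⟩ := this
    have e1 : p + t * (p + ρ * e - p) = p + ((t * ρ : ℝ) : ℂ) * e := by push_cast; ring
    rw [e1] at ht
    have ht0' : 0 < t := by
      refine lt_of_le_of_ne ht0 fun h0 => ht ?_
      rwa [← h0, zero_mul, Complex.ofReal_zero, zero_mul, add_zero]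
    have ht1' : t < 1 := by
      refine lt_of_le_of_ne ht1 fun h0 => ht ?_
      rw [h0, one_mul]
      exact hKE hmem.2
    refine ⟨t * ρ, mul_pos ht0' hρ0, ht, fun s hs0 hs hsK => ?_⟩
    have := csInf_le hbdd (show s ∈ A from ⟨hs0, hsK⟩)
    rw [← hρ] at this
    nlinarith
  · obtain ⟨M, hM⟩ := h.compact.isBounded.exists_norm_le
    have he' : 0 < ‖e‖ := norm_pos_iff.2 he
    refine ⟨(|M| + ‖p‖ + 1) / ‖e‖, by positivity, fun hmem => ?_,
      fun s hs0 _ hsK => hne ⟨s, hs0, hsK⟩⟩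
    have h1 := hM _ hmem
    have h2 : ‖(((|M| + ‖p‖ + 1) / ‖e‖ : ℝ) : ℂ) * e‖ = |M| + ‖p‖ + 1 := by
      rw [norm_mul, Complex.norm_real, Real.norm_of_nonneg (by positivity),
        div_mul_cancel₀ _ he'.ne']
    have h3 := norm_sub_le (p + (((|M| + ‖p‖ + 1) / ‖e‖ : ℝ) : ℂ) * e) p
    rw [add_sub_cancel_left, h2] at h3
    linarith [le_abs_self M]

theorem arg_neg_sub_arg_of_im_neg {v : ℂ} (hv : v.im < 0) : (-v).arg - v.arg = Real.pi := by
  rw [Complex.arg_neg_eq_arg_add_pi_of_im_neg hv]; ring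

theorem arg_neg_sub_arg_of_im_pos {v : ℂ} (hv : 0 < v.im) : (-v).arg - v.arg = -Real.pi := by
  rw [Complex.arg_neg_eq_arg_sub_pi_of_im_pos hv]; ring

theorem im_inv_div {a d : ℂ} : (d / a).im = -(a / d).im * Complex.normSq (d / a) := by
  by_cases ha : a = 0
  · simp [ha]
  by_cases hd : d = 0
  · simp [hd]
  have : a / d = (d / a)⁻¹ := by rw [inv_div]
  rw [this, Complex.inv_im]
  have h0 : Complex.normSq (d / a) ≠ 0 := by
    rw [Ne, Complex.normSq_eq_zero]
    exact div_ne_zero hd ha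
  field_simp

/-- When `w = p + t * a` tends to `p`, the angles at `w` subtended by `p` and by the points `p + r *
d` and `p - s * d` differ in the limit by `π` or `-π`, depending on the side of the line from which
`w` comes. -/
theorem tendsto_angle {a d : ℂ} {r s : ℝ} (hr : 0 < r) (hs : 0 < s) (hv : (d / a).im ≠ 0) :
    Tendsto (fun t : ℝ => ((t * a - r * d) / (t * a)).arg - ((t * a + s * d) / (t * a)).arg)
      (𝓝[>] 0) (𝓝 ((-(d / a)).arg - (d / a).arg)) := by
  have ha : a ≠ 0 := by
    rintro rfl
    simp at hv
  set v := d / a with hv'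
  have h1 : Tendsto (fun t : ℝ => ((t : ℂ) - r * v).arg - ((t : ℂ) + s * v).arg) (𝓝[>] 0)
      (𝓝 ((-v).arg - v.arg)) := by
    refine Tendsto.mono_left ?_ nhdsWithin_le_nhds
    have e1 : (-v).arg = ((0 : ℝ) - r * v : ℂ).arg := by
      rw [Complex.ofReal_zero, zero_sub, ← mul_neg, Complex.arg_real_mul _ hr]
    have e2 : v.arg = ((0 : ℝ) + s * v : ℂ).arg := by
      rw [Complex.ofReal_zero, zero_add, Complex.arg_real_mul _ hs]
    rw [e1, e2]
    have c1 : ContinuousAt (fun t : ℝ => ((t : ℂ) - r * v).arg) 0 := by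
      refine ContinuousAt.comp (g := Complex.arg) (Complex.continuousAt_arg ?_)
        (by fun_prop)
      right
      simp [hr.ne', hv]
    have c2 : ContinuousAt (fun t : ℝ => ((t : ℂ) + s * v).arg) 0 := by
      refine ContinuousAt.comp (g := Complex.arg) (Complex.continuousAt_arg ?_)
        (by fun_prop)
      right
      simp [hs.ne', hv]
    exact c1.tendsto.sub c2.tendsto
  refine h1.congr' ?_
  filter_upwards [self_mem_nhdsWithin] with t ht
  have ht' : (0 : ℝ) < t := ht
  have htc : (t : ℂ) ≠ 0 := by exact_mod_cast ht'.ne'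
  have e1 : (t * a - r * d) / (t * a) = ((t⁻¹ : ℝ) : ℂ) * (t - r * v) := by
    rw [hv']; push_cast; field_simp
  have e2 : (t * a + s * d) / (t * a) = ((t⁻¹ : ℝ) : ℂ) * (t + s * v) := by
    rw [hv']; push_cast; field_simp
  rw [e1, e2, Complex.arg_real_mul _ (inv_pos.2 ht'), Complex.arg_real_mul _ (inv_pos.2 ht')]

/-- A continuum in `E` that contains points visible from `p` on both sides of a line through `p`
contains a point of this line that is visible from `p`. -/
theorem exists_visible_on_line (h : PolyEnv E V) {K : Set ℂ} {d z₁ z₂ : ℂ}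
    (hK : IsCompact K) (hKc : IsPreconnected K) (hKE : K ⊆ E) (hpK : p ∉ K)
    (hz1 : z₁ ∈ K) (hv1 : z₁ ∈ visibilitySet E p) (hz2 : z₂ ∈ K) (hv2 : z₂ ∈ visibilitySet E p)
    (h1 : 0 < ((z₁ - p) / d).im) (h2 : ((z₂ - p) / d).im < 0) :
    ∃ q ∈ K, q ∈ visibilitySet E p ∧ ((q - p) / d).im = 0 := by
  by_contra hcon
  push Not at hcon
  have hp : p ∈ E := mem_of_visible hv1
  have hd : d ≠ 0 := by rintro rfl; simp at h1
  have hinv : ∀ (r : ℝ) (e : ℂ), (e = d ∨ e = -d) → p + r * e ∈ K →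
      p + r * e ∉ visibilitySet E p := by
    intro r e he hr hvis
    refine hcon _ hr hvis ?_
    rcases he with rfl | rfl
    · simp [hd]
    · simp [hd, neg_div]
  -- Choose points `x₁ = p + r * d` and `x₂ = p - s * d` outside `E`, one on each half of the line
  -- and before any point of `K`. Since `E` has no holes, `(w - x₁) / (w - x₂)` has a logarithm `g₁
  -- - g₂` that is continuous on all of `E`, in particular at `p`.
  obtain ⟨r, hr, hrE, hrK⟩ := h.exists_notMem_before hp hK hKE hpK hd
    fun r _ => hinv r d (Or.inl rfl)
  obtain ⟨s, hs, hsE, hsK⟩ := h.exists_notMem_before hp hK hKE hpK (neg_ne_zero.2 hd)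
    fun r _ => hinv r (-d) (Or.inr rfl)
  obtain ⟨g₁, hg1, hg1'⟩ := h.exists_log hrE
  obtain ⟨g₂, hg2, hg2'⟩ := h.exists_log hsE
  set L : ℂ → Set ℂ := fun z => (fun t : ℝ => p + t * (z - p)) '' Ioc 0 1 with hL
  have hLc : ∀ z, IsPreconnected (L z) := fun z => isPreconnected_Ioc.image _ (by fun_prop)
  have hLz : ∀ z, z ∈ L z := fun z => ⟨1, ⟨one_pos, le_rfl⟩, by simp⟩
  have hLE : ∀ z ∈ visibilitySet E p, L z ⊆ E := by
    rintro z hz _ ⟨t, ht, rfl⟩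
    exact mem_visibilitySet_iff.1 hz t ht.1.le ht.2
  set S : Set ℂ := K ∪ L z₁ ∪ L z₂ with hS
  have hSc : IsPreconnected S :=
    (hKc.union z₁ hz1 (hLz z₁) (hLc z₁)).union z₂ (Or.inl hz2) (hLz z₂) (hLc z₂)
  have hSE : S ⊆ E := union_subset (union_subset hKE (hLE _ hv1)) (hLE _ hv2)
  have hLim : ∀ z x : ℂ, ((z - p) / d).im ≠ 0 → x ∈ L z → ((x - p) / d).im ≠ 0 := by
    rintro z _ hz ⟨t, ht, rfl⟩
    have : (p + t * (z - p) - p) / d = (t : ℂ) * ((z - p) / d) := by ring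
    rw [this, Complex.im_ofReal_mul]
    exact mul_ne_zero ht.1.ne' hz
  have hoff : ∀ w ∈ S, w ∉ segment ℝ p (p + r * d) ∧ w ∉ segment ℝ p (p + s * -d) := by
    intro w hw
    have aux : ∀ (u : ℝ) (e : ℂ), (e = d ∨ e = -d) → 0 < u →
        (∀ s : ℝ, 0 ≤ s → s ≤ u → p + s * e ∉ K) → w ∉ segment ℝ p (p + u * e) := by
      intro u e he hu huK hmem
      obtain ⟨t, ht0, ht1, ht⟩ := mem_segment_iff_real.1 hmem
      have hw' : w = p + ((t * u : ℝ) : ℂ) * e := by rw [ht]; push_cast; ring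
      have him : ((w - p) / d).im = 0 := by
        rw [hw', add_sub_cancel_left]
        rcases he with rfl | rfl
        · rw [mul_div_assoc, div_self hd, mul_one, Complex.ofReal_im]
        · rw [mul_div_assoc, neg_div, div_self hd, mul_neg, mul_one, Complex.neg_im,
            Complex.ofReal_im, neg_zero]
      rcases hw with (hw | hw) | hw
      · exact huK (t * u) (by positivity) (by nlinarith) (hw' ▸ hw)
      · exact hLim _ _ h1.ne' hw him
      · exact hLim _ _ h2.ne hw him
    exact ⟨aux r d (Or.inl rfl) hr hrK, aux s (-d) (Or.inr rfl) hs hsK⟩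
  have hwp : ∀ w ∈ S, w - p ≠ 0 := by
    intro w hw h0
    apply (hoff w hw).1
    rw [sub_eq_zero.1 h0]
    exact left_mem_segment ℝ _ _
  have hslit : ∀ w ∈ S, (w - (p + r * d)) / (w - p) ∈ Complex.slitPlane ∧
      (w - (p + s * -d)) / (w - p) ∈ Complex.slitPlane := by
    intro w hw
    obtain ⟨h3, h4⟩ := hoff w hw
    have e1 := div_mem_slitPlane h3
    have e2 := div_mem_slitPlane h4
    rw [← neg_div_neg_eq, neg_sub, neg_sub] at e1 e2
    exact ⟨e1, e2⟩
  -- A second logarithm of the same quotient, continuous on the connected set `S` because `S` avoids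
  -- the segments from `p` to `x₁` and to `x₂`. It differs from `g₁ - g₂` by a constant on `S`. But
  -- as `w` tends to `p` from `z₁` and from `z₂`, the imaginary part of `H` has limits that differ
  -- by `2π`, while `g₁ - g₂` is continuous at `p`.
  set H : ℂ → ℂ := fun w => Complex.log ((w - (p + r * d)) / (w - p)) -
    Complex.log ((w - (p + s * -d)) / (w - p)) with hH
  have hHc : ContinuousOn H S := by
    refine ContinuousOn.sub (ContinuousOn.clog ?_ fun w hw => (hslit w hw).1)
      (ContinuousOn.clog ?_ fun w hw => (hslit w hw).2)
    · exact ContinuousOn.div (by fun_prop) (by fun_prop) hwp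
    · exact ContinuousOn.div (by fun_prop) (by fun_prop) hwp
  have hconst := fun {x y : ℂ} (hx : x ∈ S) (hy : y ∈ S) =>
    hSc.eq_of_exp_eq_one (f := fun w => g₁ w - g₂ w - H w)
      (((hg1.mono hSE).sub (hg2.mono hSE)).sub hHc) (fun w hw => by
        have hw1 := Complex.slitPlane_ne_zero (hslit w hw).1
        have hw2 := Complex.slitPlane_ne_zero (hslit w hw).2
        have hw3 : w - (p + r * d) ≠ 0 := fun h0 => hw1 (by rw [h0, zero_div])
        have hw4 : w - (p + s * -d) ≠ 0 := fun h0 => hw2 (by rw [h0, zero_div])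
        rw [Complex.exp_sub, Complex.exp_sub, hg1' w (hSE hw), hg2' w (hSE hw), hH,
          Complex.exp_sub, Complex.exp_log hw1, Complex.exp_log hw2,
          div_div_div_cancel_right₀ (hwp w hw)]
        exact div_self (div_ne_zero hw3 hw4)) hx hy
  have hlim : ∀ z ∈ visibilitySet E p, L z ⊆ S → ((z - p) / d).im ≠ 0 →
      Tendsto (fun t : ℝ => (g₁ (p + t * (z - p)) - g₂ (p + t * (z - p)) -
        H (p + t * (z - p))).im) (𝓝[>] 0)
        (𝓝 ((g₁ p - g₂ p).im - ((-(d / (z - p))).arg - (d / (z - p)).arg))) := by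
    intro z hz hzS him
    have him' : (d / (z - p)).im ≠ 0 := by
      rw [im_inv_div]
      refine mul_ne_zero (neg_ne_zero.2 him) ?_
      rw [Ne, Complex.normSq_eq_zero]
      refine div_ne_zero hd ?_
      intro h0
      rw [h0] at him
      simp at him
    have hp' : Tendsto (fun t : ℝ => p + t * (z - p)) (𝓝[>] 0) (𝓝[E] p) := by
      refine tendsto_nhdsWithin_iff.2 ⟨?_, ?_⟩
      · have : Continuous (fun t : ℝ => p + t * (z - p)) := by fun_prop
        have := (this.tendsto 0).mono_left (nhdsWithin_le_nhds (s := Ioi 0))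
        simpa using this
      · filter_upwards [Ioc_mem_nhdsGT (zero_lt_one' ℝ)] with t ht
        exact hLE z hz ⟨t, ht, rfl⟩
    have hg : Tendsto (fun t : ℝ => (g₁ (p + t * (z - p)) - g₂ (p + t * (z - p))).im)
        (𝓝[>] 0) (𝓝 (g₁ p - g₂ p).im) :=
      (Complex.continuous_im.tendsto _).comp (((hg1 p hp).tendsto.comp hp').sub
        ((hg2 p hp).tendsto.comp hp'))
    refine (hg.sub (tendsto_angle hr hs him')).congr fun t => ?_
    rw [Complex.sub_im (g₁ _ - g₂ _), hH, Complex.sub_im (Complex.log _), Complex.log_im,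
      Complex.log_im]
    congr 4 <;> ring
  have hl1 := hlim z₁ hv1 (subset_union_right.trans subset_union_left) h1.ne'
  have hl2 := hlim z₂ hv2 subset_union_right h2.ne
  have heq : (fun t : ℝ => (g₁ (p + t * (z₁ - p)) - g₂ (p + t * (z₁ - p)) -
        H (p + t * (z₁ - p))).im) =ᶠ[𝓝[>] 0] fun t : ℝ =>
        (g₁ (p + t * (z₂ - p)) - g₂ (p + t * (z₂ - p)) - H (p + t * (z₂ - p))).im := by
    filter_upwards [Ioc_mem_nhdsGT (zero_lt_one' ℝ)] with t ht
    have := hconst (Or.inl (Or.inr ⟨t, ht, rfl⟩) : p + t * (z₁ - p) ∈ S)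
      (Or.inr ⟨t, ht, rfl⟩ : p + t * (z₂ - p) ∈ S)
    exact congrArg Complex.im this
  have hfin := tendsto_nhds_unique (hl1.congr' heq) hl2
  have hn : ∀ z : ℂ, ((z - p) / d).im ≠ 0 → 0 < Complex.normSq (d / (z - p)) := by
    intro z hz
    refine Complex.normSq_pos.2 (div_ne_zero hd fun h0 => ?_)
    rw [h0] at hz
    simp at hz
  rw [arg_neg_sub_arg_of_im_neg, arg_neg_sub_arg_of_im_pos] at hfin
  · linarith [Real.pi_pos]
  · rw [im_inv_div]
    nlinarith [hn z₂ h2.ne]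
  · rw [im_inv_div]
    nlinarith [hn z₁ h1.ne']

/-- If `p` sees both end points of a segment in `E`, it sees the segment. -/
theorem visible_segment (h : PolyEnv E V) {z₁ z₂ m : ℂ} (h1 : z₁ ∈ visibilitySet E p)
    (h2 : z₂ ∈ visibilitySet E p) (h12 : segment ℝ z₁ z₂ ⊆ E) (hm : m ∈ segment ℝ z₁ z₂) :
    m ∈ visibilitySet E p := by
  have hp : p ∈ E := mem_of_visible h1
  by_cases hmp : m = p
  · rw [hmp]
    change segment ℝ p p ⊆ E
    rw [segment_same]
    simpa using hp
  set d := m - p with hd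
  have hd0 : d ≠ 0 := sub_ne_zero.2 hmp
  obtain ⟨t, ht0, ht1, ht⟩ := mem_segment_iff_real.1 hm
  -- The point `m` lies on the line through `p` in the direction `d`, so the signed distances of
  -- `z₁` and `z₂` from this line balance: both points lie on the line, or one is an end point equal
  -- to `m`, or they are on opposite sides.
  have hcomb : (1 - t) * ((z₁ - p) / d).im + t * ((z₂ - p) / d).im = 0 := by
    have : ((1 - t : ℝ) : ℂ) * ((z₁ - p) / d) + (t : ℂ) * ((z₂ - p) / d) = 1 := by
      rw [← mul_div_assoc, ← mul_div_assoc, ← add_div, div_eq_one_iff_eq hd0, hd, ht]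
      push_cast; ring
    have := congrArg Complex.im this
    rw [Complex.add_im, Complex.im_ofReal_mul, Complex.im_ofReal_mul, Complex.one_im] at this
    exact this
  by_cases ha : ((z₁ - p) / d).im = 0
  · have hz := eq_real_mul_of_im_div_eq_zero hd0 ha
    set r := ((z₁ - p) / d).re
    by_cases hr : r = 0
    · rw [hr, Complex.ofReal_zero, zero_mul, sub_eq_zero] at hz
      rw [hz] at hm
      exact visible_of_mem_segment h2 hm
    · have hrc : (r : ℂ) ≠ 0 := by exact_mod_cast hr
      refine visible_of_collinear h1
        (((convex_segment z₁ z₂).segment_subset (left_mem_segment ℝ _ _) hm).trans h12)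
        (s := 1 - 1 / r) ?_
      push_cast
      field_simp
      rw [hd] at hz
      linear_combination -hz
  by_cases ht1' : t = 1
  · rw [ht, ht1']; simpa using h2
  by_cases ht0' : t = 0
  · rw [ht, ht0']; simpa using h1
  have htp : 0 < t := lt_of_le_of_ne ht0 (Ne.symm ht0')
  have htl : t < 1 := lt_of_le_of_ne ht1 ht1'
  have hpK : p ∉ segment ℝ z₁ z₂ := by
    intro hpm
    obtain ⟨s, -, -, hs⟩ := mem_segment_iff_real.1 hpm
    have e1 : d = ((t - s : ℝ) : ℂ) * (z₂ - z₁) := by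
      rw [hd, ht]; push_cast; linear_combination -hs
    have hts : ((t - s : ℝ) : ℂ) ≠ 0 := by
      intro h0
      rw [h0, zero_mul] at e1
      exact hd0 e1
    apply ha
    have : (z₁ - p) / d = ((-s / (t - s) : ℝ) : ℂ) := by
      rw [div_eq_iff hd0, e1]
      push_cast at hts ⊢
      field_simp
      linear_combination -hs
    rw [this, Complex.ofReal_im]
  -- The segment is transversal to the line, so it meets it only in `m`.
  have finish : ∀ q ∈ segment ℝ z₁ z₂, q ∈ visibilitySet E p → ((q - p) / d).im = 0 →
      m ∈ visibilitySet E p := by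
    intro q hq hqv him
    obtain ⟨s, -, -, hs⟩ := mem_segment_iff_real.1 hq
    have : (1 - s) * ((z₁ - p) / d).im + s * ((z₂ - p) / d).im = 0 := by
      rw [← him]
      have : (q - p) / d = ((1 - s : ℝ) : ℂ) * ((z₁ - p) / d) + (s : ℂ) * ((z₂ - p) / d) := by
        rw [hs]; push_cast; ring
      rw [this, Complex.add_im, Complex.im_ofReal_mul, Complex.im_ofReal_mul]
    have hst : (s - t) * ((z₁ - p) / d).im = 0 := by linear_combination s * hcomb - t * this
    rw [mul_eq_zero, or_iff_left ha, sub_eq_zero] at hst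
    rwa [ht, ← hst, ← hs]
  rcases lt_or_gt_of_ne ha with hlt | hgt
  · have hb : 0 < ((z₂ - p) / d).im := by
      by_contra hb
      push Not at hb
      nlinarith
    obtain ⟨q, hq, hqv, him⟩ := h.exists_visible_on_line (isCompact_segment z₁ z₂)
      (convex_segment _ _).isPreconnected h12 hpK (right_mem_segment ℝ _ _) h2
      (left_mem_segment ℝ _ _) h1 hb hlt
    exact finish q hq hqv him
  · have hb : ((z₂ - p) / d).im < 0 := by
      by_contra hb
      push Not at hb
      nlinarith
    obtain ⟨q, hq, hqv, him⟩ := h.exists_visible_on_line (isCompact_segment z₁ z₂)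
      (convex_segment _ _).isPreconnected h12 hpK (left_mem_segment ℝ _ _) h1
      (right_mem_segment ℝ _ _) h2 hgt hb
    exact finish q hq hqv him

end PolyEnv

end Visibility

/-! ## Regions -/

/-- The properties of the regions that agents are engaged to clear. -/
structure Region (E Q : Set ℂ) : Prop where
  isOpen : IsOpen Q
  conn : IsConnected Q
  subset : Q ⊆ interior E
  convex : ∀ x ∈ Q, ∀ y ∈ Q, segment ℝ x y ⊆ interior E → segment ℝ x y ⊆ Q
  conic : ∀ q, Conic Q q
  miss : ∀ q ∈ E, q ∉ Q → ∃ ψ : ℝ, ¬ CanAim E q Q ψ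

theorem exists_dir {p z : ℂ} (hz : z ≠ p) :
    ∃ φ r : ℝ, 0 < r ∧ z = p + r * Complex.exp (φ * Complex.I) := by
  obtain ⟨θ, -, -, h⟩ := exists_polar (z - p)
  exact ⟨θ, ‖z - p‖, norm_pos_iff.2 (sub_ne_zero.2 hz), by linear_combination h⟩

theorem PolyEnv.region_interior {E V : Set ℂ} (h : PolyEnv E V) : Region E (interior E) where
  isOpen := isOpen_interior
  conn := h.int_conn
  subset := subset_rfl
  convex _ _ _ _ hs := hs
  conic q := (h.conic q).interior
  -- Points outside `E` accumulate at `q`. By conicity the direction of one of them leaves `E`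
  -- immediately, so nothing at all can be seen in it.
  miss q _ hq := by
    obtain ⟨ε, hε, hc⟩ := h.conic q
    have hcl : q ∈ closure Eᶜ := by rw [closure_compl]; exact hq
    obtain ⟨x, hx, hxE⟩ := mem_closure_iff.1 hcl _ isOpen_ball (mem_ball_self hε)
    have hxq : x ≠ q := by
      rintro rfl
      contradiction
    obtain ⟨φ, r, hr, hxr⟩ := exists_dir hxq
    refine ⟨φ, ?_⟩
    rintro ⟨z, ⟨hz, s, hs, hzs⟩, hzq, -⟩
    have hs0 : 0 < s := by
      refine lt_of_le_of_ne hs fun h0 => hzq ?_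
      rw [hzs, ← h0]; simp
    obtain ⟨t, ht0, ht1, ht⟩ : ∃ t : ℝ, 0 < t ∧ t ≤ 1 ∧ t * r ≤ s := by
      refine ⟨min 1 (s / r), lt_min one_pos (by positivity), min_le_left _ _, ?_⟩
      calc min 1 (s / r) * r ≤ s / r * r := by gcongr; exact min_le_right _ _
        _ = s := by field_simp
    have hsc : (s : ℂ) ≠ 0 := by exact_mod_cast hs0.ne'
    apply hxE
    rw [← hc x hx t ht0 ht1]
    refine hz (mem_segment_iff_real.2 ⟨t * r / s, by positivity, (div_le_one hs0).2 ht, ?_⟩)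
    rw [hxr, hzs]
    push_cast
    field_simp
    ring

section Component

variable {E V Q C : Set ℂ} {p x₀ : ℂ}

theorem ray_subset_visibilitySet {φ : ℝ} : ray E p φ ⊆ visibilitySet E p := fun _ hx => hx.1

/-- The visible parameters form a closed bounded set that contains, with each of its elements, all
smaller nonnegative numbers. A ray is therefore convex, compact and conic, which the visibility set
in general is not known to be here. -/
theorem PolyEnv.exists_ray_eq_segment (h : PolyEnv E V) (hp : p ∈ E) (φ : ℝ) :
    ∃ b, ray E p φ = segment ℝ p b := by
  set e := Complex.exp (φ * Complex.I) with he
  have hen : ‖e‖ = 1 := Complex.norm_exp_ofReal_mul_I φ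
  set A : Set ℝ := {r | 0 ≤ r ∧ p + r * e ∈ visibilitySet E p} with hA
  have hAc : IsClosed A := by
    have : A = Ici 0 ∩ (fun r : ℝ => p + r * e) ⁻¹' visibilitySet E p := rfl
    rw [this]
    exact isClosed_Ici.inter ((isClosed_visibilitySet h.isClosed p).preimage (by fun_prop))
  obtain ⟨M, hM⟩ := h.compact.isBounded.exists_norm_le
  have hbdd : BddAbove A := by
    refine ⟨M + ‖p‖, fun r hr => ?_⟩
    have h1 := hM _ (visibilitySet_subset hr.2)
    have h2 := norm_sub_le (p + r * e) p
    rw [add_sub_cancel_left, norm_mul, hen, mul_one, Complex.norm_real,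
      Real.norm_of_nonneg hr.1] at h2
    linarith
  have hne : A.Nonempty := ⟨0, le_rfl, by
    rw [Complex.ofReal_zero, zero_mul, add_zero]
    change segment ℝ p p ⊆ E
    rw [segment_same]
    simpa using hp⟩
  have hmem := hAc.csSup_mem hne hbdd
  set ρ := sSup A
  refine ⟨p + ρ * e, subset_antisymm ?_ ?_⟩
  · rintro x ⟨hx, r, hr, rfl⟩
    have hrρ : r ≤ ρ := le_csSup hbdd ⟨hr, hx⟩
    rcases hmem.1.eq_or_lt with h0 | h0
    · have : r = 0 := by linarith
      rw [this]
      simpa using left_mem_segment ℝ _ _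
    · have hρ : (ρ : ℂ) ≠ 0 := by exact_mod_cast h0.ne'
      refine mem_segment_iff_real.2 ⟨r / ρ, by positivity, (div_le_one h0).2 hrρ, ?_⟩
      push_cast
      field_simp
      ring
  · intro x hx
    refine ⟨visible_of_mem_segment hmem.2 hx, ?_⟩
    obtain ⟨t, ht0, ht1, rfl⟩ := mem_segment_iff_real.1 hx
    exact ⟨t * ρ, mul_nonneg ht0 hmem.1, by push_cast; ring⟩

/-- Points hidden from `p` remain hidden when they move along a half-line from `p` inside `E`. -/
theorem hidden_of_hidden {x : ℂ} {t : ℝ} (ht : 0 < t) (hx : x ∉ visibilitySet E p)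
    (hE : segment ℝ x (p + t * (x - p)) ⊆ E) : p + t * (x - p) ∉ visibilitySet E p := by
  intro hv
  apply hx
  have htc : (t : ℂ) ≠ 0 := by exact_mod_cast ht.ne'
  refine visible_of_collinear hv (visible_comm.1 (show _ ∈ visibilitySet E x from hE))
    (s := 1 - t⁻¹) ?_
  push_cast
  field_simp
  ring

variable (h : PolyEnv E V) (hQ : Region E Q)

include h in
theorem isOpen_hidden (hQ : Region E Q) : IsOpen (Q \ visibilitySet E p) :=
  hQ.isOpen.sdiff (isClosed_visibilitySet h.isClosed p)

end Component

/-! ### Hidden components and visibility gaps -/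

/-- `C` is a connected component of the part of `Q` that is hidden from `p`. -/
def IsHiddenComponent (E : Set ℂ) (p : ℂ) (Q C : Set ℂ) : Prop :=
  ∃ x ∈ Q \ visibilitySet E p, C = connectedComponentIn (Q \ visibilitySet E p) x

theorem IsGapRegion.isHiddenComponent {E : Set ℂ} {p : ℂ} {Q C : Set ℂ} {φ : ℝ}
    (hC : IsGapRegion E p Q C φ) : IsHiddenComponent E p Q C := hC.1

namespace IsHiddenComponent

variable {E V Q C : Set ℂ} {p : ℂ}

theorem subset (hC : IsHiddenComponent E p Q C) : C ⊆ Q \ visibilitySet E p := by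
  obtain ⟨x, -, rfl⟩ := hC
  exact connectedComponentIn_subset _ _

theorem isConnected (hC : IsHiddenComponent E p Q C) : IsConnected C := by
  obtain ⟨x, hx, rfl⟩ := hC
  exact isConnected_connectedComponentIn_iff.2 hx

theorem eq_component (hC : IsHiddenComponent E p Q C) {y : ℂ} (hy : y ∈ C) :
    C = connectedComponentIn (Q \ visibilitySet E p) y := by
  obtain ⟨x, hx, rfl⟩ := hC
  exact connectedComponentIn_eq hy

theorem subset_of_inter (hC : IsHiddenComponent E p Q C) {D : Set ℂ} (hD : IsPreconnected D)
    (hDQ : D ⊆ Q \ visibilitySet E p) {y : ℂ} (hyD : y ∈ D) (hyC : y ∈ C) : D ⊆ C := by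
  rw [hC.eq_component hyC]
  exact hD.subset_connectedComponentIn hyD hDQ

theorem isOpen (hC : IsHiddenComponent E p Q C) (h : PolyEnv E V) (hQ : Region E Q) :
    IsOpen C := by
  obtain ⟨x, hx, rfl⟩ := hC
  exact (isOpen_hidden h hQ).connectedComponentIn

/-- Components of an open set are relatively closed in it, so a hidden frontier point in `Q` would
belong to the open set `C` itself. -/
theorem visible_of_mem_frontier (hC : IsHiddenComponent E p Q C) (h : PolyEnv E V)
    (hQ : Region E Q) {z : ℂ} (hz : z ∈ frontier C) (hzQ : z ∈ Q) : z ∈ visibilitySet E p := by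
  have hCo := hC.isOpen h hQ
  by_contra hv
  rw [hCo.frontier_eq] at hz
  obtain ⟨x, hx, rfl⟩ := hC
  exact hz.2 (mem_component_of_mem_closure (isOpen_hidden h hQ) hz.1 ⟨hzQ, hv⟩)

theorem exists_continuum (hC : IsHiddenComponent E p Q C) (h : PolyEnv E V)
    (hQ : Region E Q) {x y : ℂ} (hx : x ∈ C) (hy : y ∈ C) :
    ∃ K ⊆ C, IsCompact K ∧ IsPreconnected K ∧ x ∈ K ∧ y ∈ K := by
  have hpc := (hC.isOpen h hQ).isConnected_iff_isPathConnected.1 hC.isConnected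
  obtain ⟨γ, hγ⟩ := hpc.joinedIn x hx y hy
  exact ⟨range γ, range_subset_iff.2 hγ, isCompact_range γ.continuous,
    isPreconnected_range γ.continuous, ⟨0, γ.source⟩, ⟨1, γ.target⟩⟩

/-- The first visible point on a segment that starts in a hidden component. -/
theorem exists_first_visible (hC : IsHiddenComponent E p Q C) (h : PolyEnv E V)
    {x z : ℂ} (hx : x ∈ C) (hz : z ∈ visibilitySet E p)
    (hxz : segment ℝ x z ⊆ Q) : ∃ t : ℝ, 0 < t ∧ t ≤ 1 ∧
      x + t * (z - x) ∈ visibilitySet E p ∧ ∀ s : ℝ, 0 ≤ s → s < t → x + s * (z - x) ∈ C := by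
  set A : Set ℝ := {t | 0 ≤ t ∧ x + t * (z - x) ∈ visibilitySet E p} with hA
  have hAc : IsClosed A := by
    have : A = Ici 0 ∩ (fun r : ℝ => x + r * (z - x)) ⁻¹' visibilitySet E p := rfl
    rw [this]
    exact isClosed_Ici.inter ((isClosed_visibilitySet h.isClosed p).preimage (by fun_prop))
  have hbdd : BddBelow A := ⟨0, fun r hr => hr.1⟩
  have h1A : (1 : ℝ) ∈ A := ⟨zero_le_one, by simpa using hz⟩
  have hmem := hAc.csInf_mem ⟨1, h1A⟩ hbdd
  have hle : sInf A ≤ 1 := csInf_le hbdd h1A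
  set t := sInf A
  have ht0 : 0 < t := by
    refine lt_of_le_of_ne hmem.1 fun h0 => (hC.subset hx).2 ?_
    have := hmem.2
    rwa [← h0, Complex.ofReal_zero, zero_mul, add_zero] at this
  refine ⟨t, ht0, hle, hmem.2, fun s hs0 hs => ?_⟩
  refine hC.subset_of_inter (D := (fun r : ℝ => x + r * (z - x)) '' Ico 0 t)
    (isPreconnected_Ico.image _ (by fun_prop)) ?_ ⟨0, ⟨le_rfl, ht0⟩, by simp⟩ hx
    ⟨s, ⟨hs0, hs⟩, rfl⟩
  rintro _ ⟨r, ⟨hr0, hr⟩, rfl⟩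
  exact ⟨hxz (mem_segment_iff_real.2 ⟨r, hr0, by linarith, rfl⟩),
    fun hv => not_le.2 hr (csInf_le hbdd ⟨hr0, hv⟩)⟩

/-- If the vectors are not parallel, a line in the direction `±(a + b)` separates them. If they are
opposite, the perpendicular does. -/
theorem exists_separating_line {a b : ℂ} (ha : a ≠ 0) (hb : b ≠ 0)
    (hab : ∀ r : ℝ, 0 < r → b ≠ r * a) : ∃ d : ℂ, 0 < (a / d).im ∧ (b / d).im < 0 := by
  by_cases him : (b / a).im = 0
  · have e := eq_real_mul_of_im_div_eq_zero ha him
    set r := (b / a).re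
    have hr : r < 0 := by
      rcases lt_trichotomy r 0 with h | h | h
      · exact h
      · rw [h] at e; simp at e; exact absurd e hb
      · exact absurd e (hab r h)
    have e1 : a / (-Complex.I * a) = Complex.I := by
      field_simp
      rw [Complex.I_sq]
    refine ⟨-Complex.I * a, ?_, ?_⟩
    · rw [e1]; simp
    · rw [e, mul_div_assoc, e1, Complex.im_ofReal_mul, Complex.I_im, mul_one]
      exact hr
  · have hd : a + b ≠ 0 := by
      intro h0
      apply him
      rw [show b = -a by linear_combination h0, neg_div, div_self ha]
      simp
    have hsum : (a / (a + b)).im + (b / (a + b)).im = 0 := by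
      rw [← Complex.add_im, ← add_div, div_self hd, Complex.one_im]
    have hne : (a / (a + b)).im ≠ 0 := by
      intro h0
      apply him
      have e := eq_real_mul_of_im_div_eq_zero hd h0
      set r := (a / (a + b)).re
      have hr : (r : ℂ) ≠ 0 := by
        intro h1
        rw [h1, zero_mul] at e
        exact ha e
      have : b / a = ((1 / r - 1 : ℝ) : ℂ) := by
        rw [div_eq_iff ha]
        push_cast
        field_simp
        linear_combination -e
      rw [this, Complex.ofReal_im]
    rcases lt_or_gt_of_ne hne with hlt | hgt
    · refine ⟨-(a + b), ?_, ?_⟩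
      · rw [div_neg, Complex.neg_im]; linarith
      · rw [div_neg, Complex.neg_im]; linarith
    · exact ⟨a + b, hgt, by linarith⟩

/-- The part in `Q` of the frontier of a hidden component lies on one half-line from `p`. -/
theorem frontier_same_dir (hC : IsHiddenComponent E p Q C) (h : PolyEnv E V)
    (hQ : Region E Q) (hp : p ∉ Q) {z₁ z₂ : ℂ} (hz1 : z₁ ∈ frontier C) (hz1Q : z₁ ∈ Q)
    (hz2 : z₂ ∈ frontier C) (hz2Q : z₂ ∈ Q) : ∃ r : ℝ, 0 < r ∧ z₂ - p = r * (z₁ - p) := by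
  by_contra hcon
  push Not at hcon
  have hne : ∀ z ∈ Q, z - p ≠ 0 := fun z hz h0 => hp (by rwa [sub_eq_zero.1 h0] at hz)
  obtain ⟨d, hd1, hd2⟩ := exists_separating_line (hne z₁ hz1Q) (hne z₂ hz2Q) hcon
  have hlin : Continuous fun x : ℂ => ((x - p) / d).im := by fun_prop
  -- Replace each frontier point by one that is accessible from `C`: from a nearby point of `C` walk
  -- towards `z` up to the first visible point. Two such walks and a path inside `C` form a
  -- continuum whose only visible points are the two ends.
  have aux : ∀ z ∈ frontier C, z ∈ Q → ∀ O : Set ℝ, IsOpen O → ((z - p) / d).im ∈ O →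
      ∃ x ∈ C, ∃ t : ℝ, 0 < t ∧ x + t * (z - x) ∈ visibilitySet E p ∧
        (∀ s : ℝ, 0 ≤ s → s < t → x + s * (z - x) ∈ C) ∧
        ((x + t * (z - x) - p) / d).im ∈ O ∧ x + t * (z - x) ∈ Q := by
    intro z hz hzQ O hO hzO
    obtain ⟨ε, hε, hball⟩ := Metric.isOpen_iff.1 (hQ.isOpen.inter (hO.preimage hlin)) z
      ⟨hzQ, hzO⟩
    obtain ⟨x, hxb, hxC⟩ := mem_closure_iff.1 (frontier_subset_closure hz) _ isOpen_ball
      (mem_ball_self hε)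
    have hseg : segment ℝ x z ⊆ ball z ε :=
      (convex_ball z ε).segment_subset hxb (mem_ball_self hε)
    obtain ⟨t, ht0, ht1, htv, hts⟩ := hC.exists_first_visible h hxC
      (hC.visible_of_mem_frontier h hQ hz hzQ) (hseg.trans fun y hy => (hball hy).1)
    have hin := hball (hseg (mem_segment_iff_real.2 ⟨t, ht0.le, ht1, rfl⟩))
    exact ⟨x, hxC, t, ht0, htv, hts, hin.2, hin.1⟩
  obtain ⟨x₁, hx1, t₁, ht1, hv1, hs1, ho1, hq1⟩ := aux z₁ hz1 hz1Q (Ioi 0) isOpen_Ioi hd1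
  obtain ⟨x₂, hx2, t₂, ht2, hv2, hs2, ho2, hq2⟩ := aux z₂ hz2 hz2Q (Iio 0) isOpen_Iio hd2
  obtain ⟨K, hKC, hKc, hKp, hK1, hK2⟩ := hC.exists_continuum h hQ hx1 hx2
  set y₁ := x₁ + t₁ * (z₁ - x₁)
  set y₂ := x₂ + t₂ * (z₂ - x₂)
  have hsegC : ∀ {x z : ℂ} {t : ℝ}, 0 < t →
      (∀ s : ℝ, 0 ≤ s → s < t → x + s * (z - x) ∈ C) →
      ∀ q ∈ segment ℝ x (x + t * (z - x)), q = x + t * (z - x) ∨ q ∈ C := by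
    intro x z t ht hs q hq
    obtain ⟨r, hr0, hr1, hr⟩ := mem_segment_iff_real.1 hq
    have e : q = x + ((r * t : ℝ) : ℂ) * (z - x) := by rw [hr]; push_cast; ring
    rcases hr1.lt_or_eq with hlt | heq
    · right
      rw [e]
      exact hs _ (by positivity) (by nlinarith)
    · left
      rw [e, heq, one_mul]
  have hCQ : C ⊆ Q := fun x hx => (hC.subset hx).1
  have hqS : ∀ q ∈ K ∪ segment ℝ x₁ y₁ ∪ segment ℝ x₂ y₂, q = y₁ ∨ q = y₂ ∨ q ∈ C := by
    rintro q ((hq | hq) | hq)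
    · exact Or.inr (Or.inr (hKC hq))
    · exact (hsegC ht1 hs1 q hq).imp_right Or.inr
    · exact Or.inr (hsegC ht2 hs2 q hq)
  have hSQ : K ∪ segment ℝ x₁ y₁ ∪ segment ℝ x₂ y₂ ⊆ Q := by
    intro q hq
    rcases hqS q hq with rfl | rfl | hq
    · exact hq1
    · exact hq2
    · exact hCQ hq
  obtain ⟨q, hq, hqv, him⟩ := h.exists_visible_on_line (p := p) (d := d)
    (K := K ∪ segment ℝ x₁ y₁ ∪ segment ℝ x₂ y₂) (z₁ := y₁) (z₂ := y₂)
    ((hKc.union (isCompact_segment _ _)).union (isCompact_segment _ _))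
    ((hKp.union x₁ hK1 (left_mem_segment ℝ _ _) (convex_segment _ _).isPreconnected).union x₂
      (Or.inl hK2) (left_mem_segment ℝ _ _) (convex_segment _ _).isPreconnected)
    (hSQ.trans (hQ.subset.trans interior_subset)) (fun hpS => hp (hSQ hpS))
    (Or.inl (Or.inr (right_mem_segment ℝ _ _))) hv1 (Or.inr (right_mem_segment ℝ _ _)) hv2
    ho1 ho2
  -- The visible point on the separating line is neither end, as these are off the line, and it is
  -- not in the hidden set `C`.
  rcases hqS q hq with rfl | rfl | hqC
  · exact (ne_of_gt ho1) him
  · exact (ne_of_lt ho2) him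
  · exact (hC.subset hqC).2 hqv

/-- Every point in `Q` of the frontier of a hidden component lies on a visibility gap. -/
theorem isGapRegion (hC : IsHiddenComponent E p Q C) (h : PolyEnv E V)
    (hQ : Region E Q) (hp : p ∉ Q) {z : ℂ} (hz : z ∈ frontier C) (hzQ : z ∈ Q)
    {φ ρ : ℝ} (hρ : 0 ≤ ρ) (hφ : z = p + ρ * Complex.exp (φ * Complex.I)) :
    IsGapRegion E p Q C φ := by
  refine ⟨hC, ?_⟩
  have hCo := hC.isOpen h hQ
  have hQE : Q ⊆ E := hQ.subset.trans interior_subset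
  have hzv := hC.visible_of_mem_frontier h hQ hz hzQ
  set u := z - p with hu
  have hu0 : u ≠ 0 := fun h0 => hp (by rwa [sub_eq_zero.1 h0] at hzQ)
  have hun : 0 < ‖u‖ := norm_pos_iff.2 hu0
  have hz1 : p + ((1 : ℝ) : ℂ) * u = z := by rw [hu]; push_cast; ring
  set T : Set ℝ := (fun t : ℝ => p + t * u) ⁻¹' Qᶜ with hT
  have hTc : IsClosed T := hQ.isOpen.isClosed_compl.preimage (by fun_prop)
  have h1T : (1 : ℝ) ∉ T := fun h1 => h1 (by
    change p + ((1 : ℝ) : ℂ) * u ∈ Q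
    rw [hz1]; exact hzQ)
  -- Parametrize the half-line so that `p` has parameter `0` and `z` has parameter `1`. The gap is
  -- the largest interval about `z` that stays in `Q`, with parameters between `α < 1 < β`.
  obtain ⟨α, hα0, hα1, hαT, hα⟩ : ∃ α : ℝ, 0 ≤ α ∧ α < 1 ∧ α ∈ T ∧
      ∀ t, α < t → t ≤ 1 → p + t * u ∈ Q := by
    have hne : (T ∩ Iic 1).Nonempty := ⟨0, by simpa [hT] using hp, mem_Iic.2 zero_le_one⟩
    have hbdd : BddAbove (T ∩ Iic 1) := ⟨1, fun t ht => ht.2⟩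
    have hmem := (hTc.inter isClosed_Iic).csSup_mem hne hbdd
    refine ⟨sSup (T ∩ Iic 1), le_csSup hbdd ⟨by simpa [hT] using hp, mem_Iic.2 zero_le_one⟩,
      lt_of_le_of_ne hmem.2 fun h1 => h1T (h1 ▸ hmem.1), hmem.1, fun t ht ht1 => ?_⟩
    by_contra htQ
    exact not_le.2 ht (le_csSup hbdd ⟨htQ, ht1⟩)
  obtain ⟨β, hβ1, hβT, hβ⟩ : ∃ β : ℝ, 1 < β ∧ β ∈ T ∧
      ∀ t, 1 ≤ t → t < β → p + t * u ∈ Q := by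
    have hne : (T ∩ Ici 1).Nonempty := by
      obtain ⟨M, hM⟩ := h.compact.isBounded.exists_norm_le
      refine ⟨(|M| + ‖p‖ + 1) / ‖u‖ + 1, fun hmem => ?_, by
        have : 0 ≤ (|M| + ‖p‖ + 1) / ‖u‖ := by positivity
        rw [mem_Ici]; linarith⟩
      have h1 := hM _ (hQE hmem)
      have h3 := norm_sub_le (p + (((|M| + ‖p‖ + 1) / ‖u‖ + 1 : ℝ) : ℂ) * u) p
      rw [add_sub_cancel_left, norm_mul, Complex.norm_real,
        Real.norm_of_nonneg (by positivity), add_mul, div_mul_cancel₀ _ hun.ne'] at h3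
      linarith [le_abs_self M]
    have hbdd : BddBelow (T ∩ Ici 1) := ⟨1, fun t ht => ht.2⟩
    have hmem := (hTc.inter isClosed_Ici).csInf_mem hne hbdd
    refine ⟨sInf (T ∩ Ici 1), lt_of_le_of_ne hmem.2 fun h1 => h1T (h1 ▸ hmem.1), hmem.1,
      fun t ht ht1 => ?_⟩
    by_contra htQ
    exact not_le.2 ht1 (csInf_le hbdd ⟨htQ, ht⟩)
  have hin : ∀ t, α < t → t < β → p + t * u ∈ Q := by
    intro t h1 h2
    rcases le_total t 1 with ht | ht
    · exact hα t h1 ht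
    · exact hβ t ht h2
  have hvis : ∀ t, 0 ≤ t → t < β → p + t * u ∈ visibilitySet E p := by
    intro t h0 h1
    rw [mem_visibilitySet_iff]
    intro s hs0 hs1
    have e : p + s * (p + t * u - p) = p + ((s * t : ℝ) : ℂ) * u := by push_cast; ring
    rw [e]
    rcases le_total (s * t) 1 with hle | hle
    · have := mem_visibilitySet_iff.1 hzv (s * t) (by positivity) hle
      rwa [← hu] at this
    · exact hQE (hβ _ hle (by nlinarith))
  have hcont : Continuous fun t : ℝ => p + t * u := by fun_prop
  have hclos : ∀ {S : Set ℂ} {t : ℝ}, IsClosed S → (∀ t, α < t → t < β → p + t * u ∈ S) →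
      α ≤ t → t ≤ β → p + t * u ∈ S := by
    intro S t hS hSin h1 h2
    have hαβ : α ≠ β := by linarith
    have ht : t ∈ closure (Ioo α β) := by rw [closure_Ioo hαβ]; exact ⟨h1, h2⟩
    have hsub : (fun t : ℝ => p + t * u) '' Ioo α β ⊆ S := by
      rintro _ ⟨t, ht, rfl⟩
      exact hSin t ht.1 ht.2
    exact (hS.closure_subset_iff.2 hsub)
      (image_closure_subset_closure_image hcont ⟨t, ht, rfl⟩)
  have hβv : p + β * u ∈ visibilitySet E p :=
    hclos (isClosed_visibilitySet h.isClosed p) (fun t h1 h2 => hvis t (by linarith) h2)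
      (by linarith) le_rfl
  -- Points of `C` close to `z`, moved radially by the factor `t`, stay in `Q` and stay hidden,
  -- hence stay in `C`. So every point of the gap is a limit of `C`. The bound `1 + t` dominates all
  -- scaling factors that occur on the way.
  have hCcl : ∀ t, α < t → t < β → p + t * u ∈ closure C := by
    intro t h1 h2
    have ht0 : 0 < t := by linarith
    have hsegQ : segment ℝ z (p + t * u) ⊆ Q := by
      intro y hy
      obtain ⟨s, hs0, hs1, rfl⟩ := mem_segment_iff_real.1 hy
      have e : z + s * (p + t * u - z) = p + ((1 + s * (t - 1) : ℝ) : ℂ) * u := by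
        rw [hu]; push_cast; ring
      rw [e]
      refine hin _ ?_ ?_ <;> rcases le_total t 1 with h3 | h3 <;> nlinarith
    obtain ⟨δ, hδ, hthick⟩ := (isCompact_segment z (p + t * u)).exists_thickening_subset_open
      hQ.isOpen hsegQ
    rw [mem_closure_iff_nhds_basis nhds_basis_ball]
    intro ε hε
    obtain ⟨x, hx, hxC⟩ := mem_closure_iff.1 (frontier_subset_closure hz) (ball z
      (min δ ε / (1 + t))) isOpen_ball (mem_ball_self (by positivity))
    rw [mem_ball, dist_eq_norm, lt_div_iff₀ (by positivity)] at hx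
    have hn := norm_nonneg (x - z)
    have hsegx : segment ℝ x (p + t * (x - p)) ⊆ Q := by
      intro y hy
      obtain ⟨s, hs0, hs1, rfl⟩ := mem_segment_iff_real.1 hy
      refine hthick (mem_thickening_iff.2 ⟨z + s * (p + t * u - z),
        mem_segment_iff_real.2 ⟨s, hs0, hs1, rfl⟩, ?_⟩)
      rw [dist_eq_norm]
      have e : x + s * (p + t * (x - p) - x) - (z + s * (p + t * u - z)) =
          ((1 - s + s * t : ℝ) : ℂ) * (x - z) := by rw [hu]; push_cast; ring
      have h5 : 0 ≤ 1 - s + s * t := add_nonneg (by linarith) (by positivity)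
      have h6 : 1 - s + s * t ≤ 1 + t := by nlinarith
      rw [e, norm_mul, Complex.norm_real, Real.norm_of_nonneg h5]
      have : min δ ε ≤ δ := min_le_left _ _
      nlinarith [mul_le_mul_of_nonneg_right h6 hn]
    refine ⟨p + t * (x - p), ?_, ?_⟩
    · refine hC.subset_of_inter (convex_segment x (p + t * (x - p))).isPreconnected ?_
        (left_mem_segment ℝ _ _) hxC (right_mem_segment ℝ _ _)
      intro y hy
      refine ⟨hsegx hy, ?_⟩
      obtain ⟨s, hs0, hs1, rfl⟩ := mem_segment_iff_real.1 hy
      have e : x + s * (p + t * (x - p) - x) = p + ((1 - s + s * t : ℝ) : ℂ) * (x - p) := by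
        push_cast; ring
      rw [e]
      have h5 : 0 < 1 - s + s * t := by
        rcases hs1.lt_or_eq with h6 | h6
        · exact add_pos_of_pos_of_nonneg (by linarith) (by positivity)
        · rw [h6]; linarith
      refine hidden_of_hidden h5 (hC.subset hxC).2 ?_
      rw [← e]
      exact ((convex_segment _ _).segment_subset (left_mem_segment ℝ _ _) hy).trans
        (hsegx.trans hQE)
    · rw [mem_ball, dist_eq_norm]
      have e : p + t * (x - p) - (p + t * u) = (t : ℂ) * (x - z) := by rw [hu]; ring
      rw [e, norm_mul, Complex.norm_real, Real.norm_of_nonneg ht0.le]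
      have : min δ ε ≤ ε := min_le_right _ _
      nlinarith
  have hos : ∀ y ∈ openSegment ℝ (p + α * u) (p + β * u), ∃ t, α < t ∧ t < β ∧ y = p + t * u := by
    intro y hy
    obtain ⟨s, hs0, hs1, rfl⟩ := mem_openSegment_iff_real.1 hy
    exact ⟨α + s * (β - α), by nlinarith, by nlinarith, by push_cast; ring⟩
  have hs : ∀ y ∈ segment ℝ (p + α * u) (p + β * u), ∃ t, α ≤ t ∧ t ≤ β ∧ y = p + t * u := by
    intro y hy
    obtain ⟨s, hs0, hs1, rfl⟩ := mem_segment_iff_real.1 hy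
    exact ⟨α + s * (β - α), by nlinarith, by nlinarith, by push_cast; ring⟩
  have hfr : ∀ t, α < t → t < β → p + t * u ∈ frontier C := by
    intro t h1 h2
    rw [hCo.frontier_eq]
    exact ⟨hCcl t h1 h2, fun hmem => (hC.subset hmem).2 (hvis t (by linarith) h2)⟩
  have hfQ : ∀ t ∈ T, α ≤ t → t ≤ β → p + t * u ∈ frontier Q := by
    intro t htT h1 h2
    rw [hQ.isOpen.frontier_eq]
    exact ⟨hclos isClosed_closure (fun t h1 h2 => subset_closure (hin t h1 h2)) h1 h2, htT⟩
  have hray : ∀ t : ℝ, 0 ≤ t → p + t * u ∈ visibilitySet E p → p + t * u ∈ ray E p φ := by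
    intro t ht hv
    refine ⟨hv, t * ρ, mul_nonneg ht hρ, ?_⟩
    rw [hu, hφ]; push_cast; ring
  refine ⟨p + α * u, p + β * u, ⟨?_, ?_, hfQ α hαT le_rfl (by linarith),
    hfQ β hβT (by linarith) le_rfl⟩, ?_, hray α hα0 (hvis α hα0 (by linarith)),
    hray β (by linarith) hβv⟩
  · intro y hy
    obtain ⟨t, h1, h2, rfl⟩ := hos y hy
    exact hin t h1 h2
  · intro y hy
    obtain ⟨t, h1, h2, rfl⟩ := hs y hy
    refine hclos isClosed_frontier (fun t h1 h2 => ?_) h1 h2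
    rw [(isClosed_visibilitySet h.isClosed p).frontier_eq]
    refine ⟨hvis t (by linarith) h2, fun hi => ?_⟩
    obtain ⟨w, hw1, hw2⟩ := mem_closure_iff.1 (hCcl t h1 h2) _ isOpen_interior hi
    exact (hC.subset hw2).2 (interior_subset hw1)
  · intro y hy
    obtain ⟨t, h1, h2, rfl⟩ := hos y hy
    exact hfr t h1 h2

end IsHiddenComponent

/-- A segment in `E` that starts in the interior and along which `E` is locally convex stays in the
interior up to its end point, and so do the segments to nearby interior points. -/
theorem PolyEnv.exists_nearby_segments {E V : Set ℂ} (h : PolyEnv E V) {q y : ℂ}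
    (hq : q ∈ interior E) (hqy : segment ℝ q y ⊆ E) (hV : ∀ z ∈ segment ℝ q y, z ∉ V) :
    ∃ η > 0, ∀ y' ∈ ball y η, y' ∈ interior E → segment ℝ q y' ⊆ interior E := by
  set f : ℝ → ℂ := fun t => q + t * (y - q) with hf
  have hfc : Continuous f := by fun_prop
  have hfE : ∀ t, 0 ≤ t → t ≤ 1 → f t ∈ segment ℝ q y := fun t h0 h1 =>
    mem_segment_iff_real.2 ⟨t, h0, h1, rfl⟩
  -- At the first parameter `t₀` where the segment leaves the interior, compare a slightly earlier
  -- interior point and a slightly later point of `E`: local convexity makes their midpoint, the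
  -- point at `t₀`, interior.
  have hint : ∀ t, 0 ≤ t → t < 1 → f t ∈ interior E := by
    by_contra hcon
    push Not at hcon
    obtain ⟨t₁, ht10, ht11, ht1⟩ := hcon
    set A : Set ℝ := Ici 0 ∩ f ⁻¹' (interior E)ᶜ with hA
    have hAc : IsClosed A := isClosed_Ici.inter (isOpen_interior.isClosed_compl.preimage hfc)
    have hbdd : BddBelow A := ⟨0, fun r hr => hr.1⟩
    have hmem := hAc.csInf_mem ⟨t₁, ht10, ht1⟩ hbdd
    have hlt1 : sInf A < 1 := (csInf_le hbdd ⟨ht10, ht1⟩).trans_lt ht11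
    set t₀ := sInf A with ht₀
    have ht00 : 0 < t₀ := by
      refine lt_of_le_of_ne hmem.1 fun h0 => hmem.2 ?_
      rw [← h0]
      simpa [hf] using hq
    obtain ⟨ε, hε, hconv⟩ := h.convexAt (f t₀) (hV _ (hfE _ ht00.le hlt1.le))
    have hnear : ∀ᶠ t in 𝓝 t₀, f t ∈ ball (f t₀) ε :=
      hfc.continuousAt (ball_mem_nhds _ hε)
    obtain ⟨δ, hδ, hball⟩ := Metric.eventually_nhds_iff_ball.1 hnear
    obtain ⟨e, he0, heδ, he1, he2⟩ : ∃ e > 0, e < δ ∧ e ≤ t₀ ∧ e ≤ 1 - t₀ := by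
      refine ⟨min (δ / 2) (min t₀ (1 - t₀)), lt_min (by positivity) (lt_min ht00 (by linarith)),
        (min_le_left _ _).trans_lt (by linarith), (min_le_right _ _).trans (min_le_left _ _),
        (min_le_right _ _).trans (min_le_right _ _)⟩
    have hm : f (t₀ - e) ∈ interior (E ∩ ball (f t₀) ε) := by
      rw [interior_inter, isOpen_ball.interior_eq]
      refine ⟨?_, hball _ (by rw [mem_ball, Real.dist_eq]; simp [abs_of_pos he0, heδ])⟩
      by_contra hno
      have := csInf_le hbdd ⟨by rw [mem_Ici]; linarith, hno⟩
      linarith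
    have hp : f (t₀ + e) ∈ E ∩ ball (f t₀) ε :=
      ⟨hqy (hfE _ (by linarith) (by linarith)),
        hball _ (by rw [mem_ball, Real.dist_eq]; simp [abs_of_pos he0, heδ])⟩
    have := hconv.openSegment_interior_self_subset_interior hm hp
      (mem_openSegment_iff_real.2 ⟨1 / 2, by norm_num, by norm_num, by
        simp only [hf]; push_cast; ring⟩ : f t₀ ∈ _)
    exact hmem.2 (interior_mono inter_subset_left this)
  -- A segment to a nearby `y'` first follows the compact interior segment from `q` to `f τ`, and
  -- its remainder lies in a ball about `y` where the interior is convex.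
  obtain ⟨ε, hε, hconv⟩ := h.convexAt y (hV _ (right_mem_segment ℝ _ _))
  have hconv' : Convex ℝ (interior E ∩ ball y ε) := by
    have := hconv.interior
    rwa [interior_inter, isOpen_ball.interior_eq] at this
  obtain ⟨τ, hτ0, hτ1, hτ⟩ : ∃ τ : ℝ, 0 < τ ∧ τ < 1 ∧ f τ ∈ ball y ε := by
    have hnear : ∀ᶠ t in 𝓝 (1 : ℝ), f t ∈ ball y ε := by
      refine hfc.continuousAt (x := 1) ?_
      have : f 1 = y := by simp [hf]
      rw [this]
      exact ball_mem_nhds _ hε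
    obtain ⟨δ, hδ, hball⟩ := Metric.eventually_nhds_iff_ball.1 hnear
    refine ⟨1 - min (δ / 2) (1 / 2), ?_, ?_, hball _ ?_⟩
    · linarith [min_le_right (δ / 2) (1 / 2 : ℝ)]
    · linarith [lt_min (half_pos hδ) (by norm_num : (0 : ℝ) < 1 / 2)]
    · rw [mem_ball, Real.dist_eq]
      have h1 : 0 < min (δ / 2) (1 / 2 : ℝ) := lt_min (half_pos hδ) (by norm_num)
      have h2 := min_le_left (δ / 2) (1 / 2 : ℝ)
      rw [show 1 - min (δ / 2) (1 / 2 : ℝ) - 1 = -min (δ / 2) (1 / 2 : ℝ) by ring, abs_neg,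
        abs_of_pos h1]
      linarith
  have hseg : segment ℝ q (f τ) ⊆ interior E := by
    intro z hz
    obtain ⟨s, hs0, hs1, rfl⟩ := mem_segment_iff_real.1 hz
    have e : q + s * (f τ - q) = f (s * τ) := by simp only [hf]; push_cast; ring
    rw [e]
    exact hint _ (by positivity) (by nlinarith)
  obtain ⟨η₀, hη₀, hthick⟩ := (isCompact_segment q (f τ)).exists_thickening_subset_open
    isOpen_interior hseg
  obtain ⟨η₁, hη₁, hb1⟩ := Metric.isOpen_iff.1 isOpen_ball (f τ) hτ
  refine ⟨min (min η₀ η₁) ε, lt_min (lt_min hη₀ hη₁) hε, fun y' hy' hy'i z hz => ?_⟩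
  have hd : ‖y' - y‖ < min (min η₀ η₁) ε := by rwa [mem_ball, dist_eq_norm] at hy'
  have hd0 : ‖y' - y‖ < η₀ := hd.trans_le ((min_le_left _ _).trans (min_le_left _ _))
  have hd1 : ‖y' - y‖ < η₁ := hd.trans_le ((min_le_left _ _).trans (min_le_right _ _))
  have hd2 : ‖y' - y‖ < ε := hd.trans_le (min_le_right _ _)
  have hfirst : ∀ s : ℝ, 0 ≤ s → s ≤ τ → q + s * (y' - q) ∈ interior E := by
    intro s hs0 hs1
    refine hthick (mem_thickening_iff.2 ⟨f s, mem_segment_iff_real.2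
      ⟨s / τ, by positivity, (div_le_one hτ0).2 hs1, ?_⟩, ?_⟩)
    · have : (τ : ℂ) ≠ 0 := by exact_mod_cast hτ0.ne'
      simp only [hf]; push_cast; field_simp; ring
    · rw [dist_eq_norm, show q + s * (y' - q) - f s = (s : ℂ) * (y' - y) by simp only [hf]; ring,
        norm_mul, Complex.norm_real, Real.norm_of_nonneg hs0]
      nlinarith [norm_nonneg (y' - y)]
  obtain ⟨s, hs0, hs1, rfl⟩ := mem_segment_iff_real.1 hz
  rcases le_total s τ with hsτ | hsτ
  · exact hfirst s hs0 hsτ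
  · have hw : q + τ * (y' - q) ∈ interior E ∩ ball y ε := by
      refine ⟨hfirst τ hτ0.le le_rfl, hb1 ?_⟩
      rw [mem_ball, dist_eq_norm, show q + τ * (y' - q) - f τ = (τ : ℂ) * (y' - y) by
        simp only [hf]; ring, norm_mul, Complex.norm_real, Real.norm_of_nonneg hτ0.le]
      nlinarith [norm_nonneg (y' - y)]
    have hy'' : y' ∈ interior E ∩ ball y ε := ⟨hy'i, by rwa [mem_ball, dist_eq_norm]⟩
    have h1τ : (0 : ℝ) < 1 - τ := by linarith
    have h1τc : (1 - τ : ℂ) ≠ 0 := by exact_mod_cast h1τ.ne'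
    refine (hconv'.segment_subset hw hy'' (mem_segment_iff_real.2
      ⟨(s - τ) / (1 - τ), div_nonneg (by linarith) h1τ.le, (div_le_one h1τ).2 (by linarith), ?_⟩)).1
    push_cast; field_simp; ring

theorem countable_directions (q v : ℂ) :
    {ψ : ℝ | ∃ r : ℝ, 0 < r ∧ v = q + r * Complex.exp (ψ * Complex.I)}.Countable := by
  rcases eq_empty_or_nonempty
    {ψ : ℝ | ∃ r : ℝ, 0 < r ∧ v = q + r * Complex.exp (ψ * Complex.I)} with he | ⟨ψ₀, r₀, hr₀, h₀⟩
  · rw [he]; exact countable_empty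
  · refine (countable_range fun k : ℤ => ψ₀ + 2 * Real.pi * k).mono ?_
    rintro ψ ⟨r, hr, h⟩
    obtain ⟨-, k, hk⟩ := polar_unique hr hr₀ (by linear_combination h₀ - h :
      (r : ℂ) * Complex.exp (ψ * Complex.I) = r₀ * Complex.exp (ψ₀ * Complex.I))
    exact ⟨k, hk.symm⟩

/-- Only countably many directions hit `W`, whereas the directions in which `f` is positive form a
nonempty open set. -/
theorem exists_direction_avoiding {q : ℂ} {W : Set ℂ} (hW : W.Countable) (f : ℂ →L[ℝ] ℝ)
    (hf : f ≠ 0) : ∃ ψ : ℝ, 0 < f (Complex.exp (ψ * Complex.I)) ∧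
      ∀ v ∈ W, ∀ r : ℝ, 0 < r → v ≠ q + r * Complex.exp (ψ * Complex.I) := by
  have hO : IsOpen {ψ : ℝ | 0 < f (Complex.exp (ψ * Complex.I))} :=
    isOpen_Ioi.preimage (f := fun ψ : ℝ => f (Complex.exp (ψ * Complex.I)))
      (f.continuous.comp (by fun_prop))
  have hne : {ψ : ℝ | 0 < f (Complex.exp (ψ * Complex.I))}.Nonempty := by
    obtain ⟨w, hw⟩ : ∃ w, 0 < f w := by
      by_contra hcon
      push Not at hcon
      apply hf
      ext w
      have h1 := hcon w
      have h2 := hcon (-w)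
      rw [map_neg] at h2
      simp only [zero_apply]
      linarith
    have hw0 : w ≠ 0 := by rintro rfl; simp at hw
    obtain ⟨θ, -, -, hθ⟩ := exists_polar w
    refine ⟨θ, ?_⟩
    have : w = ‖w‖ • Complex.exp (θ * Complex.I) := by rw [Complex.real_smul]; exact hθ
    rw [this, map_smul, smul_eq_mul] at hw
    exact pos_of_mul_pos_right hw (norm_nonneg w)
  have hbad : (⋃ v ∈ W, {ψ : ℝ | ∃ r : ℝ, 0 < r ∧ v = q + r * Complex.exp (ψ * Complex.I)}).Countable :=
    hW.biUnion fun v _ => countable_directions q v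
  obtain ⟨ψ, hψ, hψ'⟩ := (hbad.dense_compl ℝ).inter_open_nonempty _ hO hne
  refine ⟨ψ, hψ, fun v hv r hr h => hψ' ?_⟩
  exact mem_biUnion hv ⟨r, hr, h⟩

namespace IsHiddenComponent

variable {E V Q C : Set ℂ} {p : ℂ}

/-- Otherwise `C` would be open and closed in the connected set `Q`, hence equal to it, although
part of `Q` is visible. -/
theorem exists_mem_frontier (hC : IsHiddenComponent E p Q C) (h : PolyEnv E V)
    (hQ : Region E Q) (hne : (Q ∩ visibilitySet E p).Nonempty) : ∃ z ∈ frontier C, z ∈ Q := by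
  by_contra hcon
  push Not at hcon
  have hCo := hC.isOpen h hQ
  obtain ⟨x, hx⟩ := hC.isConnected.nonempty
  have hsub : Q ⊆ C := hQ.conn.isPreconnected.subset_of_closure_inter_subset hCo
    ⟨x, (hC.subset hx).1, hx⟩ (fun z hz => by
      by_contra hzC
      exact hcon z (by rw [hCo.frontier_eq]; exact ⟨hz.1, hzC⟩) hz.2)
  obtain ⟨y, hyQ, hyv⟩ := hne
  exact (hC.subset (hsub hyQ)).2 hyv

end IsHiddenComponent

/-! ### Gap regions are again regions -/

namespace IsGapRegion

variable {E V Q C : Set ℂ} {p : ℂ} {φ : ℝ}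

theorem exists_mem_frontier (hC : IsGapRegion E p Q C φ) :
    ∃ z ∈ frontier C, z ∈ Q ∧ ∃ r : ℝ, 0 ≤ r ∧ z = p + r * Complex.exp (φ * Complex.I) := by
  obtain ⟨-, a, b, hgap, hfr, ⟨-, r, hr, ha⟩, ⟨-, s, hs, hb⟩⟩ := hC
  have hm : a + ((1 / 2 : ℝ) : ℂ) * (b - a) ∈ openSegment ℝ a b :=
    mem_openSegment_iff_real.2 ⟨1 / 2, by norm_num, by norm_num, rfl⟩
  refine ⟨_, hfr hm, hgap.1 hm, (r + s) / 2, by positivity, ?_⟩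
  rw [ha, hb]; push_cast; ring

theorem frontier_subset_ray (hC : IsGapRegion E p Q C φ) (h : PolyEnv E V) (hQ : Region E Q)
    (hp : p ∉ Q) : frontier C ∩ Q ⊆ ray E p φ := by
  rintro z ⟨hz, hzQ⟩
  have hC' := hC.isHiddenComponent
  refine ⟨hC'.visible_of_mem_frontier h hQ hz hzQ, ?_⟩
  obtain ⟨w, hw, hwQ, r, hr, hwr⟩ := hC.exists_mem_frontier
  obtain ⟨s, hs, hsz⟩ := hC'.frontier_same_dir h hQ hp hw hwQ hz hzQ
  refine ⟨s * r, by positivity, ?_⟩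
  rw [hwr] at hsz
  push_cast
  linear_combination hsz

/-- A connected set can leave `C` within `Q` only through the frontier of `C`, which is on the ray.
Thus `C` is a component of `Q` minus a segment, and the visibility set can be forgotten. -/
theorem subset_of_diff_ray (hC : IsGapRegion E p Q C φ) (h : PolyEnv E V) (hQ : Region E Q)
    (hp : p ∉ Q) {D : Set ℂ} (hD : IsPreconnected D) (hDQ : D ⊆ Q) (hDR : Disjoint D (ray E p φ))
    {y : ℂ} (hyD : y ∈ D) (hyC : y ∈ C) : D ⊆ C := by
  have hCo := hC.isHiddenComponent.isOpen h hQ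
  refine hD.subset_of_closure_inter_subset hCo ⟨y, hyD, hyC⟩ fun z hz => ?_
  by_contra hzC
  exact disjoint_left.1 hDR hz.2 (hC.frontier_subset_ray h hQ hp
    ⟨by rw [hCo.frontier_eq]; exact ⟨hz.1, hzC⟩, hDQ hz.2⟩)

theorem isClosed_ray (h : PolyEnv E V) (hpE : p ∈ E) : IsClosed (ray E p φ) := by
  obtain ⟨b, hb⟩ := h.exists_ray_eq_segment hpE φ
  rw [hb]
  exact isClosed_segment _ _

/-- If `y` were a limit of `C`, a segment from `q` to some point of `C` near `y` would stay in `Q`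
and off the ray, and would put `q` in `C`. -/
theorem notMem_closure (hC : IsGapRegion E p Q C φ) (h : PolyEnv E V) (hQ : Region E Q)
    (hpE : p ∈ E) (hp : p ∉ Q) {q y : ℂ} (hq : q ∈ Q) (hqC : q ∉ C) (hqy : segment ℝ q y ⊆ E)
    (hV : ∀ z ∈ segment ℝ q y, z ∉ V) (hR : Disjoint (segment ℝ q y) (ray E p φ)) :
    y ∉ closure C := by
  intro hy
  obtain ⟨η, hη, hnear⟩ := h.exists_nearby_segments (hQ.subset hq) hqy hV
  obtain ⟨δ, hδ, hthick⟩ := (isCompact_segment q y).exists_thickening_subset_open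
    (isClosed_ray h hpE (φ := φ)).isOpen_compl (disjoint_left.1 hR)
  obtain ⟨y', hy', hy'C⟩ := mem_closure_iff.1 hy (ball y (min η δ)) isOpen_ball
    (mem_ball_self (lt_min hη hδ))
  have hy'Q := (hC.isHiddenComponent.subset hy'C).1
  have hseg := hQ.convex q hq y' hy'Q
    (hnear y' (ball_subset_ball (min_le_left _ _) hy') (hQ.subset hy'Q))
  refine hqC (hC.subset_of_diff_ray h hQ hp (convex_segment q y').isPreconnected hseg ?_
    (right_mem_segment ℝ _ _) hy'C (left_mem_segment ℝ _ _))
  rw [disjoint_left]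
  intro z hz
  obtain ⟨s, hs0, hs1, rfl⟩ := mem_segment_iff_real.1 hz
  refine hthick (mem_thickening_iff.2 ⟨q + s * (y - q), mem_segment_iff_real.2
    ⟨s, hs0, hs1, rfl⟩, ?_⟩)
  rw [dist_eq_norm, show q + s * (y' - q) - (q + s * (y - q)) = (s : ℂ) * (y' - y) by ring,
    norm_mul, Complex.norm_real, Real.norm_of_nonneg hs0]
  have : ‖y' - y‖ < δ := by
    have := hy'
    rw [mem_ball, dist_eq_norm] at this
    exact this.trans_le (min_le_right _ _)
  nlinarith [norm_nonneg (y' - y)]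

/-- Suppose the segment from `x` to `y` contains a visible point. The first visible points met from
its two ends are on one ray from `p`, so they are the same point `z`. A continuum in `C` from `x` to
`y` joins the two sides of the line through `p` and `z`, so by `PolyEnv.exists_visible_on_line`,
applied at `z`, it contains a point of this line visible from `z`. Being collinear with `z` and `p`,
this point is visible from `p`, which is impossible in `C`. -/
theorem segment_subset (hC : IsGapRegion E p Q C φ) (h : PolyEnv E V) (hQ : Region E Q)
    (hp : p ∉ Q) {x y : ℂ} (hx : x ∈ C) (hy : y ∈ C) (hxy : segment ℝ x y ⊆ interior E) :
    segment ℝ x y ⊆ C := by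
  have hC' := hC.isHiddenComponent
  have hCo := hC'.isOpen h hQ
  have hxyQ := hQ.convex x (hC'.subset hx).1 y (hC'.subset hy).1 hxy
  have hQE : Q ⊆ E := hQ.subset.trans interior_subset
  by_contra hcon
  have hvis : ∃ z ∈ segment ℝ x y, z ∈ visibilitySet E p := by
    by_contra hno
    push Not at hno
    exact hcon (hC'.subset_of_inter (convex_segment x y).isPreconnected
      (fun z hz => ⟨hxyQ hz, hno z hz⟩) (left_mem_segment ℝ _ _) hx)
  obtain ⟨v, hv, hvv⟩ := hvis
  have hfront : ∀ x ∈ C, ∀ t : ℝ, ∀ w : ℂ, 0 < t → x + t * (w - x) ∈ visibilitySet E p →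
      (∀ s : ℝ, 0 ≤ s → s < t → x + s * (w - x) ∈ C) → x + t * (w - x) ∈ frontier C := by
    intro x _ t w ht hv hs
    rw [hCo.frontier_eq]
    refine ⟨?_, fun hm => (hC'.subset hm).2 hv⟩
    have hcont : Continuous fun r : ℝ => x + r * (w - x) := by fun_prop
    have : t ∈ closure (Ico 0 t) := by
      rw [closure_Ico ht.ne]; exact ⟨ht.le, le_rfl⟩
    refine closure_mono ?_ (image_closure_subset_closure_image hcont ⟨t, this, rfl⟩)
    rintro _ ⟨r, hr, rfl⟩
    exact hs r hr.1 hr.2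
  have hxv : segment ℝ x v ⊆ segment ℝ x y :=
    (convex_segment x y).segment_subset (left_mem_segment ℝ _ _) hv
  have hyv : segment ℝ y v ⊆ segment ℝ x y :=
    (convex_segment x y).segment_subset (right_mem_segment ℝ _ _) hv
  obtain ⟨t₁, ht10, ht11, hv1, hs1⟩ := hC'.exists_first_visible h hx hvv (hxv.trans hxyQ)
  obtain ⟨t₂, ht20, ht21, hv2, hs2⟩ := hC'.exists_first_visible h hy hvv (hyv.trans hxyQ)
  have hf1 := hfront x hx t₁ v ht10 hv1 hs1
  have hf2 := hfront y hy t₂ v ht20 hv2 hs2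
  have hm1 : x + t₁ * (v - x) ∈ segment ℝ x y :=
    hxv (mem_segment_iff_real.2 ⟨t₁, ht10.le, ht11, rfl⟩)
  have hm2 : y + t₂ * (v - y) ∈ segment ℝ x y :=
    hyv (mem_segment_iff_real.2 ⟨t₂, ht20.le, ht21, rfl⟩)
  obtain ⟨r, hr, hrel⟩ := hC'.frontier_same_dir h hQ hp hf1 (hxyQ hm1) hf2 (hxyQ hm2)
  obtain ⟨c, hc0, hc1, hc⟩ := mem_segment_iff_real.1 hv
  set z := x + t₁ * (v - x) with hz
  have hzp : z - p ≠ 0 := fun h0 => hp (by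
    have := hxyQ hm1
    rwa [sub_eq_zero.1 h0] at this)
  have hpseg : p ∉ segment ℝ x y := fun hpm => hp (hxyQ hpm)
  -- If `x` itself is on the line through `p` and `z`, it is visible from `z` and hence from `p`.
  by_cases hcol : ((x - p) / (z - p)).im = 0
  · have hxz := eq_real_mul_of_im_div_eq_zero hzp hcol
    set k := ((x - p) / (z - p)).re
    refine (hC'.subset hx).2 (visible_of_collinear hv1 (q := x) (s := 1 - k) ?_ ?_)
    · exact visible_comm.1 (((convex_segment x y).segment_subset (left_mem_segment ℝ _ _) hm1).trans
        (hxyQ.trans hQE))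
    · push_cast; linear_combination hxz
  · have hzeq : ∀ s : ℝ, ((x + s * (y - x) - p) / (z - p)).im = 0 → x + s * (y - x) = z := by
      intro s hs
      have e0 : z = x + ((t₁ * c : ℝ) : ℂ) * (y - x) := by
        rw [hz, hc]; push_cast; ring
      have e1 : ((x + ((t₁ * c : ℝ) : ℂ) * (y - x) - p) / (z - p)).im = 0 := by
        rw [← e0, div_self hzp, Complex.one_im]
      have expand : ∀ s : ℝ, ((x + s * (y - x) - p) / (z - p)).im =
          ((x - p) / (z - p)).im + s * ((y - x) / (z - p)).im := by
        intro s
        rw [← Complex.im_ofReal_mul, ← Complex.add_im]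
        congr 1; ring
      rw [expand] at hs e1
      have hne : ((y - x) / (z - p)).im ≠ 0 := by
        intro h0
        rw [h0] at e1
        exact hcol (by linarith)
      have : (s - t₁ * c) * ((y - x) / (z - p)).im = 0 := by linear_combination hs - e1
      rw [mul_eq_zero, or_iff_left hne, sub_eq_zero] at this
      rw [this, ← e0]
    obtain ⟨s2, -, -, hs2e⟩ := mem_segment_iff_real.1 hm2
    have hz2 : y + t₂ * (v - y) = z := by
      rw [hs2e]
      apply hzeq
      rw [← hs2e, hrel, mul_div_assoc, div_self hzp, mul_one, Complex.ofReal_im]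
    have hxim : ((x - z) / (z - p)).im = ((x - p) / (z - p)).im := by
      rw [show x - z = (x - p) - (z - p) by ring, sub_div, Complex.sub_im, div_self hzp]
      simp
    obtain ⟨k, hk0, hk⟩ : ∃ k : ℝ, 0 < k ∧ ((y - z) / (z - p)).im = -k * ((x - z) / (z - p)).im := by
      have hcc : 0 < c := by
        refine lt_of_le_of_ne hc0 fun h0 => (hC'.subset hx).2 ?_
        rw [← h0, Complex.ofReal_zero, zero_mul, add_zero] at hc
        rwa [hc] at hvv
      have e1 : v - z = (((1 - t₁) * c : ℝ) : ℂ) * (y - x) := by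
        rw [hz, hc]; push_cast; ring
      have e2 : z - x = ((t₁ * c : ℝ) : ℂ) * (y - x) := by rw [hz, hc]; push_cast; ring
      have e3 : y - z = ((1 - t₁ * c : ℝ) : ℂ) * (y - x) := by rw [hz, hc]; push_cast; ring
      have h1 : t₁ * c < 1 := by
        refine lt_of_le_of_ne (by nlinarith) fun h0 => ?_
        have : y = z := by
          rw [h0] at e3
          have : y - z = 0 := by rw [e3]; push_cast; ring
          exact sub_eq_zero.1 this
        exact (hC'.subset hy).2 (this ▸ hv1)
      have h2 : 0 < t₁ * c := by positivity
      refine ⟨(1 - t₁ * c) / (t₁ * c), div_pos (by linarith) h2, ?_⟩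
      have e4 : y - z = ((-((1 - t₁ * c) / (t₁ * c)) : ℝ) : ℂ) * (x - z) := by
        have h3 : ((t₁ * c : ℝ) : ℂ) ≠ 0 := by exact_mod_cast h2.ne'
        rw [show x - z = -(z - x) by ring, e2, e3]
        push_cast at h3 ⊢
        have h4 : (t₁ : ℂ) ≠ 0 := left_ne_zero_of_mul h3
        have h5 : (c : ℂ) ≠ 0 := right_ne_zero_of_mul h3
        field_simp
      rw [e4, mul_div_assoc, Complex.im_ofReal_mul]
    obtain ⟨K, hKC, hKc, hKp, hKx, hKy⟩ := hC'.exists_continuum h hQ hx hy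
    have hzK : z ∉ K := fun hzK => (hC'.subset (hKC hzK)).2 hv1
    have hKE : K ⊆ E := fun w hw => hQE (hC'.subset (hKC hw)).1
    have hsub : ∀ w ∈ segment ℝ x y, w ∈ visibilitySet E z := fun w hw =>
      ((convex_segment x y).segment_subset hm1 hw).trans (hxyQ.trans hQE)
    have fin : ∃ w ∈ K, w ∈ visibilitySet E z ∧ ((w - z) / (z - p)).im = 0 := by
      have hne : ((x - z) / (z - p)).im ≠ 0 := by rw [hxim]; exact hcol
      rcases lt_or_gt_of_ne hne with hlt | hgt
      · exact h.exists_visible_on_line hKc hKp hKE hzK hKy (hsub y (right_mem_segment ℝ _ _)) hKx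
          (hsub x (left_mem_segment ℝ _ _)) (by rw [hk]; nlinarith) hlt
      · exact h.exists_visible_on_line hKc hKp hKE hzK hKx (hsub x (left_mem_segment ℝ _ _)) hKy
          (hsub y (right_mem_segment ℝ _ _)) hgt (by rw [hk]; nlinarith)
    obtain ⟨w, hwK, hwv, hwim⟩ := fin
    have hwz := eq_real_mul_of_im_div_eq_zero hzp hwim
    set l := ((w - z) / (z - p)).re
    refine (hC'.subset (hKC hwK)).2 (visible_of_collinear hv1 hwv (s := -l) ?_)
    push_cast; linear_combination hwz

/-- The set `C` is a component of `Q` minus the ray; both `Q` and the ray, a segment, are conic. -/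
theorem conic (hC : IsGapRegion E p Q C φ) (h : PolyEnv E V) (hQ : Region E Q)
    (hpE : p ∈ E) (hp : p ∉ Q) (q : ℂ) : Conic C q := by
  have hC' := hC.isHiddenComponent
  obtain ⟨x, hx⟩ := hC'.isConnected.nonempty
  have hsub : C ⊆ Q \ ray E p φ := fun y hy =>
    ⟨(hC'.subset hy).1, fun hr => (hC'.subset hy).2 (ray_subset_visibilitySet hr)⟩
  have : C = connectedComponentIn (Q \ ray E p φ) x := by
    apply subset_antisymm
    · exact hC'.isConnected.isPreconnected.subset_connectedComponentIn hx hsub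
    · have hs := connectedComponentIn_subset (Q \ ray E p φ) x
      exact hC.subset_of_diff_ray h hQ hp isPreconnected_connectedComponentIn
        (hs.trans sdiff_subset) (disjoint_left.2 fun y hy => (hs hy).2)
        (mem_connectedComponentIn (hsub hx)) hx
  rw [this]
  obtain ⟨b, hb⟩ := h.exists_ray_eq_segment hpE φ
  rw [hb]
  exact ((hQ.conic q).inter (conic_segment p b q).compl).component x

/-- It suffices to find a direction from `q` that starts outside `C`, avoids the ray, and passes
through no point of `V`: then `notMem_closure` excludes every visible point in this direction from
the closure of `C`. A point `q` outside `Q` inherits a missed direction from `Q`. -/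
theorem miss (hC : IsGapRegion E p Q C φ) (h : PolyEnv E V) (hQ : Region E Q)
    (hpE : p ∈ E) (hp : p ∉ Q) {q : ℂ} (hqE : q ∈ E) (hqC : q ∉ C) : ∃ ψ, ¬ CanAim E q C ψ := by
  have hC' := hC.isHiddenComponent
  have hCQ : C ⊆ Q := fun y hy => (hC'.subset hy).1
  by_cases hqQ : q ∈ Q
  swap
  · obtain ⟨ψ, hψ⟩ := hQ.miss q hqE hqQ
    exact ⟨ψ, fun ⟨x, hx, hxq, hxC⟩ => hψ ⟨x, hx, hxq, closure_mono hCQ hxC⟩⟩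
  obtain ⟨δ, hδ, hball⟩ := Metric.isOpen_iff.1 hQ.isOpen q hqQ
  obtain ⟨b, hb⟩ := h.exists_ray_eq_segment hpE φ
  have key : ∃ ψ : ℝ, (∀ v ∈ V, ∀ r : ℝ, 0 < r → v ≠ q + r * Complex.exp (ψ * Complex.I)) ∧
      (∀ r : ℝ, 0 < r → q + r * Complex.exp (ψ * Complex.I) ∉ ray E p φ) ∧
      (∀ r : ℝ, 0 < r → r < δ → q + r * Complex.exp (ψ * Complex.I) ∉ C) := by
    have hrb : ∀ (ψ r : ℝ), 0 < r → r < δ → q + r * Complex.exp (ψ * Complex.I) ∈ ball q δ := by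
      intro ψ r hr hrδ
      rw [mem_ball, dist_eq_norm, add_sub_cancel_left, norm_mul, Complex.norm_exp_ofReal_mul_I,
        mul_one, Complex.norm_real, Real.norm_of_nonneg hr.le]
      exact hrδ
    by_cases hqR : q ∈ ray E p φ
    -- If `q` is on the ray, `C` is convex near `q` and does not contain `q`, so an open half-plane
    -- of directions avoids `C` near `q`.
    · have hconv : Convex ℝ (C ∩ ball q δ) := by
        refine convex_iff_segment_subset.2 fun x hx y hy => ?_
        have hs := (convex_ball q δ).segment_subset hx.2 hy.2
        exact subset_inter (hC.segment_subset h hQ hp hx.1 hy.1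
          (hs.trans (hball.trans hQ.subset))) hs
      obtain ⟨f, hf0, hf⟩ : ∃ f : ℂ →L[ℝ] ℝ, f ≠ 0 ∧ ∀ x ∈ C ∩ ball q δ, f x < f q := by
        rcases eq_empty_or_nonempty (C ∩ ball q δ) with he | ⟨x, hx⟩
        · refine ⟨Complex.reCLM, fun h0 => ?_, by simp [he]⟩
          have := congrArg (fun g : ℂ →L[ℝ] ℝ => g 1) h0
          simp at this
        · obtain ⟨f, hf⟩ := geometric_hahn_banach_open_point hconv
            ((hC'.isOpen h hQ).inter isOpen_ball) (fun hm => hqC hm.1)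
          refine ⟨f, ?_, hf⟩
          rintro rfl
          simpa using hf x hx
      have hqp : q - p ≠ 0 := fun h0 => hp (by rwa [sub_eq_zero.1 h0] at hqQ)
      -- The points `q ± (q - p)` exclude the two directions along the line that carries the ray.
      obtain ⟨ψ, hψ, hav⟩ := exists_direction_avoiding (q := q)
        (W := insert (q + (q - p)) (insert (q - (q - p)) V))
        ((h.finite.countable.insert _).insert _) f hf0
      refine ⟨ψ, fun v hv => hav v (by simp [hv]), fun r hr hmem => ?_, fun r hr hrδ hmem => ?_⟩
      · rw [hb] at hqR hmem
        obtain ⟨s, hs0, hs1, hs⟩ := mem_segment_iff_real.1 hqR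
        obtain ⟨t, ht0, ht1, ht⟩ := mem_segment_iff_real.1 hmem
        have e1 : q - p = (s : ℂ) * (b - p) := by rw [hs]; ring
        have e2 : (r : ℂ) * Complex.exp (ψ * Complex.I) = ((t - s : ℝ) : ℂ) * (b - p) := by
          push_cast; linear_combination ht - hs
        have hs0' : 0 < s := by
          refine lt_of_le_of_ne hs0 fun h0 => hqp ?_
          rw [e1, ← h0]; simp
        have hbp : b - p ≠ 0 := by
          intro h0
          rw [h0, mul_zero] at e1
          exact hqp e1
        have hts : t - s ≠ 0 := by
          intro h0
          rw [h0, Complex.ofReal_zero, zero_mul] at e2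
          simp [hr.ne'] at e2
        have htsc : ((t - s : ℝ) : ℂ) ≠ 0 := by exact_mod_cast hts
        have e3 : q - p = ((s / (t - s) : ℝ) : ℂ) * (r * Complex.exp (ψ * Complex.I)) := by
          rw [e1, e2]; push_cast at htsc ⊢; field_simp
        rcases lt_or_gt_of_ne hts with hlt | hgt
        · refine hav (q - (q - p)) (by simp) (-(s / (t - s)) * r)
            (mul_pos (neg_pos.2 (div_neg_of_pos_of_neg hs0' hlt)) hr) ?_
          rw [e3]; push_cast; ring
        · refine hav (q + (q - p)) (by simp) (s / (t - s) * r)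
            (mul_pos (div_pos hs0' hgt) hr) ?_
          rw [e3]; push_cast; ring
      · have := hf _ ⟨hmem, hrb ψ r hr hrδ⟩
        rw [map_add, ← Complex.real_smul, map_smul, smul_eq_mul] at this
        nlinarith
    -- If `q` is off the ray, a functional separates it from this segment. In the directions in
    -- which the functional grows the half-line never meets the ray, and a point of `C` on it close
    -- to `q` would put `q` in `C`.
    · obtain ⟨f, u, hfu, hfq⟩ := geometric_hahn_banach_closed_point
        (hb ▸ convex_segment p b : Convex ℝ (ray E p φ)) (isClosed_ray h hpE) hqR
      have hf0 : f ≠ 0 := by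
        rintro rfl
        have h1 := hfu p (by rw [hb]; exact left_mem_segment ℝ _ _)
        simp at h1 hfq
        linarith
      obtain ⟨ψ, hψ, hav⟩ := exists_direction_avoiding (q := q) h.finite.countable f hf0
      have hfar : ∀ r : ℝ, 0 ≤ r → q + r * Complex.exp (ψ * Complex.I) ∉ ray E p φ := by
        intro r hr hmem
        have := hfu _ hmem
        rw [map_add, ← Complex.real_smul, map_smul, smul_eq_mul] at this
        nlinarith [mul_nonneg hr hψ.le]
      refine ⟨ψ, hav, fun r hr => hfar r hr.le, fun r hr hrδ hmem => hqC ?_⟩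
      have hs : segment ℝ q (q + r * Complex.exp (ψ * Complex.I)) ⊆ ball q δ :=
        (convex_ball q δ).segment_subset (mem_ball_self hδ) (hrb ψ r hr hrδ)
      refine hC.subset_of_diff_ray h hQ hp (convex_segment q
        (q + r * Complex.exp (ψ * Complex.I))).isPreconnected (hs.trans hball)
        (disjoint_left.2 fun z hz => ?_) (right_mem_segment ℝ _ _) hmem (left_mem_segment ℝ _ _)
      obtain ⟨t, ht0, ht1, rfl⟩ := mem_segment_iff_real.1 hz
      have e : q + t * (q + r * Complex.exp (ψ * Complex.I) - q) =
          q + ((t * r : ℝ) : ℂ) * Complex.exp (ψ * Complex.I) := by push_cast; ring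
      rw [e]
      exact hfar _ (by positivity)
  obtain ⟨ψ, hψV, hψR, hψC⟩ := key
  refine ⟨ψ, ?_⟩
  rintro ⟨x, ⟨hx, ρ, hρ, hxρ⟩, hxq, hxC⟩
  have hρ0 : 0 < ρ := by
    refine lt_of_le_of_ne hρ fun h0 => hxq ?_
    rw [hxρ, ← h0]; simp
  obtain ⟨t, ht0, htδ, htρ⟩ : ∃ t > 0, t < δ ∧ t < ρ :=
    ⟨min δ ρ / 2, by positivity, by linarith [min_le_left δ ρ, lt_min hδ hρ0],
      by linarith [min_le_right δ ρ, lt_min hδ hρ0]⟩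
  have hseg : ∀ z ∈ segment ℝ (q + t * Complex.exp (ψ * Complex.I)) x, ∃ r : ℝ, 0 < r ∧ r ≤ ρ ∧
      z = q + r * Complex.exp (ψ * Complex.I) := by
    intro z hz
    obtain ⟨s, hs0, hs1, rfl⟩ := mem_segment_iff_real.1 hz
    refine ⟨t + s * (ρ - t), by nlinarith, by nlinarith, ?_⟩
    rw [hxρ]; push_cast; ring
  refine hC.notMem_closure h hQ hpE hp (q := q + t * Complex.exp (ψ * Complex.I)) (hball ?_)
    (hψC t ht0 htδ) ?_ ?_ ?_ hxC
  · rw [mem_ball, dist_eq_norm, add_sub_cancel_left, norm_mul, Complex.norm_exp_ofReal_mul_I,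
      mul_one, Complex.norm_real, Real.norm_of_nonneg (le_of_lt ht0)]
    exact htδ
  · intro z hz
    obtain ⟨r, hr0, hr1, rfl⟩ := hseg z hz
    refine hx (mem_segment_iff_real.2 ⟨r / ρ, by positivity, (div_le_one hρ0).2 hr1, ?_⟩)
    have : (ρ : ℂ) ≠ 0 := by exact_mod_cast hρ0.ne'
    rw [hxρ]; push_cast; field_simp; ring
  · intro z hz hzV
    obtain ⟨r, hr0, hr1, hr⟩ := hseg z hz
    exact hψV z hzV r hr0 hr
  · rw [disjoint_left]
    intro z hz
    obtain ⟨r, hr0, hr1, rfl⟩ := hseg z hz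
    exact hψR r hr0

theorem region (hC : IsGapRegion E p Q C φ) (h : PolyEnv E V) (hQ : Region E Q)
    (hpE : p ∈ E) (hp : p ∉ Q) : Region E C where
  isOpen := hC.isHiddenComponent.isOpen h hQ
  conn := hC.isHiddenComponent.isConnected
  subset := fun _ hx => hQ.subset (hC.isHiddenComponent.subset hx).1
  convex := fun _ hx _ hy => hC.segment_subset h hQ hp hx hy
  conic := hC.conic h hQ hpE hp
  miss := fun _ hqE hqC => hC.miss h hQ hpE hp hqE hqC

end IsGapRegion

/-! ## Sweep ranges and helpers -/

theorem exp_add_two_pi_mul_int (φ : ℝ) (k : ℤ) :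
    Complex.exp (((φ + 2 * Real.pi * k : ℝ) : ℂ) * Complex.I) = Complex.exp (φ * Complex.I) :=
  exp_mul_I_eq_iff.2 ⟨k, rfl⟩

theorem ray_add_two_pi_mul_int (E : Set ℂ) (p : ℂ) (φ : ℝ) (k : ℤ) :
    ray E p (φ + 2 * Real.pi * k) = ray E p φ := by
  simp only [ray, exp_add_two_pi_mul_int]

theorem canAim_add_two_pi_mul_int {E : Set ℂ} {p : ℂ} {Q : Set ℂ} {φ : ℝ} (k : ℤ) :
    CanAim E p Q (φ + 2 * Real.pi * k) ↔ CanAim E p Q φ := by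
  simp only [CanAim, ray_add_two_pi_mul_int]

section

variable {E V Q : Set ℂ} {p : ℂ}

/-- By conicity at `p`, a target closer than `ε / 2` can be pushed out to the distance `ε / 2`. So
the distances may be restricted to a compact interval that stays away from `0`, and projecting a
closed set along a compact factor keeps it closed. -/
theorem PolyEnv.isClosed_setOf_canAim (h : PolyEnv E V) (hQ : Conic Q p) (hp : p ∈ E) :
    IsClosed {φ | CanAim E p Q φ} := by
  obtain ⟨ε, hε, hEc, hQc⟩ : ∃ ε > 0,
      (∀ x ∈ ball p ε, ∀ s : ℝ, 0 < s → s ≤ 1 → (p + s * (x - p) ∈ E ↔ x ∈ E)) ∧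
      (∀ x ∈ ball p ε, ∀ s : ℝ, 0 < s → s ≤ 1 →
        (p + s * (x - p) ∈ closure Q ↔ x ∈ closure Q)) := by
    obtain ⟨ε₁, h1, h1'⟩ := h.conic p
    obtain ⟨ε₂, h2, h2'⟩ := hQ.closure
    exact ⟨min ε₁ ε₂, lt_min h1 h2,
      fun x hx => h1' x (ball_subset_ball (min_le_left _ _) hx),
      fun x hx => h2' x (ball_subset_ball (min_le_right _ _) hx)⟩
  obtain ⟨M, hM⟩ := h.compact.isBounded.exists_norm_le
  set I := Icc (ε / 2) (M + ‖p‖)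
  set F : Set (I × ℝ) := (fun x : I × ℝ =>
    p + ((x.1 : ℝ) : ℂ) * Complex.exp (x.2 * Complex.I)) ⁻¹' (visibilitySet E p ∩ closure Q)
    with hF
  have hFc : IsClosed F :=
    ((isClosed_visibilitySet h.isClosed p).inter isClosed_closure).preimage (by fun_prop)
  have key : {φ | CanAim E p Q φ} = Prod.snd '' F := by
    ext φ
    constructor
    · rintro ⟨x, ⟨hx, ρ, hρ, hxe⟩, hxp, hxQ⟩
      have hρ0 : 0 < ρ := by
        refine lt_of_le_of_ne hρ fun h0 => hxp ?_
        rw [hxe, ← h0]; simp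
      have hρM : ρ ≤ M + ‖p‖ := by
        have h1 := hM _ (visibilitySet_subset hx)
        have h2 := norm_sub_le x p
        rw [hxe, add_sub_cancel_left, norm_mul, Complex.norm_exp_ofReal_mul_I, mul_one,
          Complex.norm_real, Real.norm_of_nonneg hρ, ← hxe] at h2
        linarith
      by_cases hρε : ε / 2 ≤ ρ
      · exact ⟨(⟨ρ, hρε, hρM⟩, φ), ⟨by change p + _ ∈ _; rw [← hxe]; exact hx,
          by change p + _ ∈ _; rw [← hxe]; exact hxQ⟩, rfl⟩
      push Not at hρε
      set y : ℂ := p + ((ε / 2 : ℝ) : ℂ) * Complex.exp (φ * Complex.I) with hy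
      have hyb : y ∈ ball p ε := by
        rw [mem_ball, dist_eq_norm, hy, add_sub_cancel_left, norm_mul,
          Complex.norm_exp_ofReal_mul_I, mul_one, Complex.norm_real,
          Real.norm_of_nonneg (by linarith)]
        linarith
      have hxy : x = p + ((ρ / (ε / 2) : ℝ) : ℂ) * (y - p) := by
        have : (ε : ℂ) ≠ 0 := by exact_mod_cast hε.ne'
        rw [hxe, hy]
        push_cast
        field_simp
        ring
      have hs0 : 0 < ρ / (ε / 2) := by positivity
      have hs1 : ρ / (ε / 2) ≤ 1 := (div_le_one (by linarith)).2 hρε.le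
      have hyE : y ∈ E := by
        rw [← hEc y hyb _ hs0 hs1, ← hxy]; exact visibilitySet_subset hx
      have hyQ : y ∈ closure Q := by
        rw [← hQc y hyb _ hs0 hs1, ← hxy]; exact hxQ
      have hyV : y ∈ visibilitySet E p := by
        rw [mem_visibilitySet_iff]
        intro t h0 h1
        rcases h0.eq_or_lt with rfl | h0
        · simpa using hp
        · exact (hEc y hyb t h0 h1).2 hyE
      have hle : ε / 2 ≤ M + ‖p‖ := by
        have h1 := hM _ hyE
        have h2 := norm_sub_le y p
        rw [hy, add_sub_cancel_left, norm_mul, Complex.norm_exp_ofReal_mul_I, mul_one,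
          Complex.norm_real, Real.norm_of_nonneg (by linarith), ← hy] at h2
        linarith
      exact ⟨(⟨ε / 2, le_rfl, hle⟩, φ), ⟨hyV, hyQ⟩, rfl⟩
    · rintro ⟨⟨⟨ρ, hρ1, hρ2⟩, φ'⟩, ⟨h1, h2⟩, rfl⟩
      have hρ0 : 0 < ρ := by linarith
      refine ⟨_, ⟨h1, ρ, hρ0.le, rfl⟩, ?_, h2⟩
      intro h0
      simp [hρ0.ne'] at h0
  rw [key]
  exact isClosedMap_snd_of_compactSpace _ hFc

theorem CanHelp.canAim (hc : CanHelp E p Q) : ∃ φ, CanAim E p Q φ := by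
  obtain ⟨hp, q, hqQ, hqV⟩ := hc
  obtain ⟨φ, r, hr, hφ⟩ := exists_dir (p := p) (z := q) (by rintro rfl; exact hp hqQ)
  exact ⟨φ, q, ⟨hqV, r, hr.le, hφ⟩, by rintro rfl; exact hp hqQ, subset_closure hqQ⟩

theorem CanHelp.mem (hc : CanHelp E p Q) : p ∈ E := by
  obtain ⟨-, q, -, hqV⟩ := hc
  exact mem_of_visible hqV

/-- Cut the circle at a direction `ψ` in which the region is missed, and take the extreme directions
of the compact set in `[ψ, ψ + 2π]`. Since `ψ` itself is missed, the minimum exceeds `ψ` and the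
range is shorter than a full turn. -/
theorem CanHelp.exists_isSweepRange (hc : CanHelp E p Q) (h : PolyEnv E V) (hQ : Region E Q) :
    ∃ α β, IsSweepRange E p Q α β := by
  obtain ⟨ψ, hψ⟩ := hQ.miss p hc.mem hc.1
  set A := {φ | CanAim E p Q φ} with hA
  have hAc : IsClosed A := h.isClosed_setOf_canAim (hQ.conic p) hc.mem
  have hshift : ∀ φ ∈ A, ∃ k : ℤ, φ + 2 * Real.pi * k ∈ A ∩ Icc ψ (ψ + 2 * Real.pi) := by
    intro φ hφ
    obtain ⟨k, hk, -⟩ := existsUnique_add_zsmul_mem_Ico Real.two_pi_pos φ ψ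
    rw [zsmul_eq_mul, mul_comm (k : ℝ)] at hk
    exact ⟨k, (canAim_add_two_pi_mul_int k).2 hφ, Ico_subset_Icc_self hk⟩
  set B := A ∩ Icc ψ (ψ + 2 * Real.pi) with hB
  have hBc : IsCompact B := isCompact_Icc.inter_left hAc
  have hBne : B.Nonempty := by
    obtain ⟨φ, hφ⟩ := hc.canAim
    obtain ⟨k, hk⟩ := hshift φ hφ
    exact ⟨_, hk⟩
  have hα := hBc.sInf_mem hBne
  have hβ := hBc.sSup_mem hBne
  have hαψ : ψ < sInf B := by
    refine lt_of_le_of_ne hα.2.1 fun h0 => hψ ?_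
    rw [h0]
    exact hα.1
  refine ⟨sInf B, sSup B, csInf_le_csSup hBne hBc.bddBelow hBc.bddAbove, ?_, hα.1, hβ.1,
    fun φ hφ => ?_⟩
  · have := hβ.2.2
    linarith
  · obtain ⟨k, hk⟩ := hshift φ hφ
    exact ⟨k, csInf_le hBc.bddBelow hk, le_csSup hBc.bddAbove hk⟩

/-- By conicity at `p`, interior points close to `p` are visible from it. -/
theorem PolyEnv.canHelp_interior (h : PolyEnv E V) (hp : p ∈ E) (hpi : p ∉ interior E) :
    CanHelp E p (interior E) := by
  refine ⟨hpi, ?_⟩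
  obtain ⟨ε, hε, hc⟩ := h.conic p
  obtain ⟨x, hx, hxi⟩ := mem_closure_iff.1 (h.subset_closure hp) _ isOpen_ball (mem_ball_self hε)
  refine ⟨x, hxi, ?_⟩
  rw [mem_visibilitySet_iff]
  intro t h0 h1
  rcases h0.eq_or_lt with rfl | h0
  · simpa using hp
  · exact (hc x hx t h0 h1).2 (interior_subset hxi)

theorem IsSweepRange.eq_of_exp_eq {α β φ ψ : ℝ} (hs : IsSweepRange E p Q α β)
    (hφ : φ ∈ Icc α β) (hψ : ψ ∈ Icc α β)
    (he : Complex.exp (φ * Complex.I) = Complex.exp (ψ * Complex.I)) : φ = ψ := by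
  obtain ⟨k, hk⟩ := exp_mul_I_eq_iff.1 he
  rw [int_eq_zero_of_shift hk hφ.1 hφ.2 hψ.1 hψ.2 hs.lt] at hk
  simpa using hk

/-- Visible points of the region have a polar angle in the sweep range. -/
theorem IsSweepRange.exists_polar {α β : ℝ} (hs : IsSweepRange E p Q α β) {z : ℂ}
    (hzQ : z ∈ closure Q) (hzp : z ≠ p) (hz : z ∈ visibilitySet E p) :
    ∃ φ ∈ Icc α β, ∃ r : ℝ, 0 < r ∧ z = p + r * Complex.exp (φ * Complex.I) := by
  obtain ⟨φ, r, hr, hφ⟩ := exists_dir hzp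
  obtain ⟨k, hk⟩ := hs.between φ ⟨z, ⟨hz, r, hr.le, hφ⟩, hzp, hzQ⟩
  exact ⟨_, hk, r, hr, by rw [exp_add_two_pi_mul_int]; exact hφ⟩

end

/-- If nobody could help, every agent that sees a point of `C` would itself be in `C`. Starting from
an agent that sees some point of `C` and walking in the visibility graph, one would never leave `C`,
yet the walk leads to an agent on the boundary. -/
theorem StandingAssumptions.exists_canHelp {n N : ℕ} {P : Polygon ℂ n} {p : Fin N → ℂ}
    (hp : StandingAssumptions P p) {C : Set ℂ} (hC : C.Nonempty)
    (hCE : C ⊆ environment P) (hCb : Disjoint C (P.boundary ℝ)) :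
    ∃ l, CanHelp (environment P) (p l) C := by
  by_contra hno
  push Not at hno
  have hout : ∀ l x, x ∈ C → x ∈ visibilitySet (environment P) (p l) → p l ∈ C := by
    intro l x hx hv
    by_contra hl
    exact hno l ⟨hl, x, hx, hv⟩
  obtain ⟨x, hx⟩ := hC
  obtain ⟨i, hi⟩ := hp.visible x (hCE hx)
  obtain ⟨j, ⟨w⟩, hj⟩ := hp.boundary i
  have hiC := hout i x hx hi
  have : p j ∈ C := by
    clear hj hi
    induction w with
    | nil => exact hiC
    | cons hadj _ ih =>
      rw [visibilityGraph, SimpleGraph.fromRel_adj] at hadj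
      exact ih (hout _ _ hiC (hadj.2.elim visible_comm.1 id))
  exact disjoint_left.1 hCb this hj

/-! ## The number of gaps -/

/-- In the coordinates with origin `p` and first axis `e`, a half-disc at the point `a` of the first
axis, on the side given by the sign `s`, lies in `S`. -/
def OneSided (S : Set ℂ) (p e : ℂ) (s a : ℝ) : Prop :=
  ∃ ε > 0, ∀ x ∈ ball (a : ℂ) ε, 0 < s * x.im → p + x * e ∈ S

theorem OneSided.mono {S T : Set ℂ} {p e : ℂ} {s a : ℝ} (hS : OneSided S p e s a) (h : S ⊆ T) :
    OneSided T p e s a := by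
  obtain ⟨ε, hε, hx⟩ := hS
  exact ⟨ε, hε, fun x h1 h2 => h (hx x h1 h2)⟩

theorem dist_ofReal (a b : ℝ) : dist (a : ℂ) b = dist a b := by
  rw [Complex.dist_of_im_eq (by simp)]; simp

theorem isOpen_oneSided (S : Set ℂ) (p e : ℂ) (s : ℝ) : IsOpen {a | OneSided S p e s a} := by
  rw [Metric.isOpen_iff]
  rintro a ⟨ε, hε, hx⟩
  refine ⟨ε, hε, fun b hb => ⟨ε - dist b a, sub_pos.2 hb, fun x h1 h2 => hx x ?_ h2⟩⟩
  have h3 := dist_triangle x b a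
  rw [mem_ball] at h1 ⊢
  rw [dist_ofReal] at h3
  linarith

/-- A one-sided neighbourhood in `S` is one in the interior of `S`. -/
theorem OneSided.interior {S : Set ℂ} {p e : ℂ} {s a : ℝ} (he : e ≠ 0)
    (hS : OneSided S p e s a) : OneSided (interior S) p e s a := by
  obtain ⟨ε, hε, hx⟩ := hS
  refine ⟨ε, hε, fun x h1 h2 => ?_⟩
  have hO : IsOpen ((fun y : ℂ => (y - p) / e) ⁻¹' (ball (a : ℂ) ε ∩ {x | 0 < s * x.im})) := by
    refine (isOpen_ball.inter (isOpen_lt continuous_const ?_)).preimage ?_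
    · exact continuous_const.mul Complex.continuous_im
    · exact (continuous_id.sub continuous_const).div_const e
  refine mem_interior.2 ⟨_, ?_, hO, ?_⟩
  · rintro y ⟨h3, h4⟩
    have := hx _ h3 h4
    rwa [div_mul_cancel₀ _ he, add_sub_cancel] at this
  · have : (p + x * e - p) / e = x := by field_simp; ring
    rw [mem_preimage, this]
    exact ⟨h1, h2⟩

theorem eventually_mem_ball {X : Type*} [TopologicalSpace X] {f : X → ℂ} {x : X} {a : ℂ} {r : ℝ}
    (hf : ContinuousAt f x) (hx : f x = a) (hr : 0 < r) : ∀ᶠ y in 𝓝 x, f y ∈ ball a r :=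
  hf (by rw [hx]; exact ball_mem_nhds a hr)

theorem norm_mul_unit {e : ℂ} (he : ‖e‖ = 1) (x : ℂ) : ‖x * e‖ = ‖x‖ := by
  rw [norm_mul, he, mul_one]

theorem dist_coord {p e : ℂ} (he : ‖e‖ = 1) (x y : ℂ) : dist (p + x * e) (p + y * e) = dist x y := by
  rw [dist_eq_norm, dist_eq_norm, ← norm_mul_unit he (x - y)]
  congr 1
  ring

theorem segment_coord {p e x y z : ℂ} (hz : z ∈ segment ℝ x y) :
    p + z * e ∈ segment ℝ (p + x * e) (p + y * e) := by
  obtain ⟨t, h0, h1, rfl⟩ := mem_segment_iff_real.1 hz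
  exact mem_segment_iff_real.2 ⟨t, h0, h1, by ring⟩

section

variable {E V Q C : Set ℂ} {p e : ℂ} {ρ : ℝ}

/-- A hidden component contains a one-sided neighbourhood of each frontier point in the region. -/
theorem IsHiddenComponent.oneSided (hC : IsHiddenComponent E p Q C) (h : PolyEnv E V)
    (hQ : Region E Q) (he : ‖e‖ = 1) (hρ : 0 < ρ) (hz : p + ρ * e ∈ frontier C)
    (hzQ : p + ρ * e ∈ Q) : ∃ s : ℝ, (s = 1 ∨ s = -1) ∧ OneSided C p e s ρ := by
  have he0 : e ≠ 0 := by rintro rfl; simp at he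
  have hzv := hC.visible_of_mem_frontier h hQ hz hzQ
  obtain ⟨δ, hδ, hδQ⟩ := Metric.isOpen_iff.1 hQ.isOpen _ hzQ
  have hE : Q ⊆ E := hQ.subset.trans interior_subset
  have hmem : ∀ x : ℂ, x ∈ ball (ρ : ℂ) δ → p + x * e ∈ ball (p + ρ * e) δ := fun x hx => by
    rwa [mem_ball, dist_coord he]
  have hline : ∀ a : ℝ, (a : ℂ) ∈ ball (ρ : ℂ) δ → p + a * e ∈ visibilitySet E p := by
    intro a ha
    refine visible_of_collinear hzv (s := (ρ - a) / ρ) ?_ ?_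
    · exact ((convex_ball _ _).segment_subset (mem_ball_self hδ) (hmem _ ha)).trans
        (hδQ.trans hE)
    · have : (ρ : ℂ) ≠ 0 := by exact_mod_cast hρ.ne'
      push_cast
      field_simp
      ring
  -- Points on the line near the frontier point are visible, so `C` must accumulate there from at
  -- least one side.
  obtain ⟨s, hs, hacc⟩ : ∃ s : ℝ, (s = 1 ∨ s = -1) ∧
      ∀ δ' > 0, ∃ x ∈ ball (ρ : ℂ) δ', 0 < s * x.im ∧ p + x * e ∈ C := by
    by_contra hno
    push Not at hno
    obtain ⟨δ₁, h1, h1'⟩ := hno 1 (Or.inl rfl)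
    obtain ⟨δ₂, h2, h2'⟩ := hno (-1) (Or.inr rfl)
    obtain ⟨y, hy, hyC⟩ := mem_closure_iff.1 (frontier_subset_closure hz)
      (ball (p + ρ * e) (min δ (min δ₁ δ₂))) isOpen_ball (mem_ball_self (by positivity))
    obtain ⟨x, rfl⟩ : ∃ x, y = p + x * e := ⟨(y - p) / e, by field_simp; ring⟩
    rw [mem_ball, dist_coord he, lt_min_iff, lt_min_iff] at hy
    rcases lt_trichotomy x.im 0 with hx | hx | hx
    · exact h2' x hy.2.2 (by linarith) hyC
    · have hx' : x = (x.re : ℂ) := Complex.ext (by simp) (by simp [hx])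
      rw [hx'] at hyC hy
      exact (hC.subset hyC).2 (hline _ hy.1)
    · exact h1' x hy.2.1 (by linarith) hyC
  have hss : s * s = 1 := by rcases hs with rfl | rfl <;> norm_num
  -- If a point `y` on this side were visible, the line from `y` through a point `x` of `C` very
  -- close to the frontier point would meet the axis in a visible point. By
  -- `PolyEnv.visible_segment`, `x` would be visible.
  have hhid : ∀ y ∈ ball (ρ : ℂ) δ, 0 < s * y.im → p + y * e ∉ visibilitySet E p := by
    intro y hy hys hyv
    have hyim : y.im ≠ 0 := by rintro h0; simp [h0] at hys
    set l : ℂ → ℂ := fun x => y + ((y.im / (y.im - x.im) : ℝ) : ℂ) * (x - y) with hl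
    have hlc : ContinuousAt l (ρ : ℂ) := by
      have : y.im - ((ρ : ℂ)).im ≠ 0 := by simpa using hyim
      refine continuousAt_const.add (ContinuousAt.mul ?_ (by fun_prop))
      refine Complex.continuous_ofReal.continuousAt.comp (continuousAt_const.div ?_ this)
      exact continuousAt_const.sub Complex.continuous_im.continuousAt
    have hlρ : l ρ = ρ := by simp [hl, hyim]
    have hev : ∀ᶠ x in 𝓝 (ρ : ℂ), l x ∈ ball (ρ : ℂ) δ ∧ x ∈ ball (ρ : ℂ) δ ∧
        s * x.im < s * y.im := by
      refine (eventually_mem_ball hlc hlρ hδ).and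
        ((eventually_mem_ball continuousAt_id rfl hδ).and ?_)
      have : Continuous fun x : ℂ => s * x.im := continuous_const.mul Complex.continuous_im
      exact this.continuousAt.eventually_lt continuousAt_const (by simpa using hys)
    obtain ⟨δ', hδ', hb⟩ := Metric.eventually_nhds_iff_ball.1 hev
    obtain ⟨x, hx, hxs, hxC⟩ := hacc δ' hδ'
    obtain ⟨hlx, hxδ, hlt⟩ := hb x hx
    have hdpos : 0 < s * (y.im - x.im) := by linarith
    have hd0 : y.im - x.im ≠ 0 := by rintro h0; simp [h0] at hdpos
    have hlre : l x = ((l x).re : ℂ) := by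
      refine Complex.ext (by simp) ?_
      simp only [hl, Complex.add_im, Complex.im_ofReal_mul,
        Complex.sub_im, Complex.ofReal_im]
      field_simp
      ring
    have hxl : x ∈ segment ℝ y (l x) := by
      refine mem_segment_iff_real.2 ⟨(y.im - x.im) / y.im, ?_, ?_, ?_⟩
      · rw [show (y.im - x.im) / y.im = s * (y.im - x.im) / (s * y.im) by
          have : s ≠ 0 := by rintro rfl; simp at hss
          field_simp]
        positivity
      · rw [show (y.im - x.im) / y.im = s * (y.im - x.im) / (s * y.im) by
          have : s ≠ 0 := by rintro rfl; simp at hss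
          field_simp, div_le_one hys]
        linarith
      · have h1 : (y.im : ℂ) ≠ 0 := by exact_mod_cast hyim
        have h2 : (y.im : ℂ) - x.im ≠ 0 := by exact_mod_cast hd0
        simp only [hl]
        push_cast
        field_simp
        ring
    refine (hC.subset hxC).2 (h.visible_segment hyv (z₂ := p + l x * e) ?_ ?_ (segment_coord hxl))
    · rw [hlre] at hlx ⊢
      exact hline _ hlx
    · exact ((convex_ball _ _).segment_subset (hmem _ hy) (hmem _ hlx)).trans (hδQ.trans hE)
  refine ⟨s, hs, δ, hδ, ?_⟩
  obtain ⟨x, hx, hxs, hxC⟩ := hacc δ hδ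
  set H : Set ℂ := ball (ρ : ℂ) δ ∩ {y | 0 < s * y.im} with hH
  have hHc : Convex ℝ H := by
    refine (convex_ball _ _).inter (convex_halfSpace_gt (f := fun y : ℂ => s * y.im) ?_ 0)
    exact ⟨fun a b => by simp [mul_add], fun c a => by simp; ring⟩
  have hsub := hC.subset_of_inter (hHc.isPreconnected.image (fun y => p + y * e)
    (by fun_prop)) (by
      rintro _ ⟨y, ⟨hy1, hy2⟩, rfl⟩
      exact ⟨hδQ (hmem y hy1), hhid y hy1 hy2⟩) ⟨x, ⟨hx, hxs⟩, rfl⟩ hxC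
  exact fun y hy hys => hsub ⟨y, ⟨hy, hys⟩, rfl⟩

/-- If points beside a visible point are hidden, some point before it has no one-sided
neighbourhood in `E`. -/
theorem exists_not_oneSided (h : PolyEnv E V) (hC : Disjoint C (visibilitySet E p))
    (hpE : p ∈ E) (he : ‖e‖ = 1) (hρ : 0 < ρ) {s : ℝ} (hs : s = 1 ∨ s = -1)
    (hCs : OneSided C p e s ρ) : ∃ t : ℝ, 0 < t ∧ t ≤ ρ ∧ ¬ OneSided E p e s t := by
  by_contra hno
  push Not at hno
  have hss : s * s = 1 := by rcases hs with rfl | rfl <;> norm_num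
  obtain ⟨ε, hε, hc⟩ := h.conic p
  obtain ⟨δ, hδ, hδC⟩ := hCs
  -- The points `x η t`, for fixed `η`, run along a half-line from `p` that is tilted slightly to
  -- the side `s`.
  set x : ℝ → ℝ → ℂ := fun η t => t * (1 + η * s * Complex.I) with hx
  have hxc : Continuous fun z : ℝ × ℝ => x z.1 z.2 := by simp only [hx]; fun_prop
  have hx0 : ∀ t, x 0 t = t := fun t => by simp [hx]
  have hxim : ∀ η t, s * (x η t).im = t * η := fun η t => by
    simp only [hx]; simp; linear_combination t * η * hss
  set t₀ := min ρ (ε / 2) with ht₀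
  have ht₀0 : 0 < t₀ := lt_min hρ (by linarith)
  -- A single tilt works for all `t` in the compact interval from `t₀` to `ρ`; below `t₀` conicity
  -- at `p` takes over. Then `p` would see along the tilted half-line into `C`.
  have hev1 : ∀ᶠ η in 𝓝 (0 : ℝ), ∀ t ∈ Icc t₀ ρ, 0 < η → p + x η t * e ∈ E := by
    refine isCompact_Icc.eventually_forall_of_forall_eventually
      (P := fun η t => 0 < η → p + x η t * e ∈ E) fun t ht => ?_
    obtain ⟨r, hr, hrE⟩ := hno t (ht₀0.trans_le ht.1) ht.2
    have h1 : ∀ᶠ z : ℝ × ℝ in 𝓝 (0, t), x z.1 z.2 ∈ ball (t : ℂ) r :=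
      eventually_mem_ball hxc.continuousAt (hx0 _) hr
    have h2 : ∀ᶠ z : ℝ × ℝ in 𝓝 (0, t), 0 < z.2 :=
      continuousAt_snd.eventually (lt_mem_nhds (ht₀0.trans_le ht.1))
    filter_upwards [h1, h2] with z hz1 hz2 hz3
    exact hrE _ hz1 (by rw [hxim]; positivity)
  have hxcη : ∀ t, ContinuousAt (fun η => x η t) 0 := fun t => by
    simp only [hx]; fun_prop
  have hev2 : ∀ᶠ η in 𝓝 (0 : ℝ), x η ρ ∈ ball (ρ : ℂ) δ :=
    eventually_mem_ball (hxcη ρ) (hx0 _) hδ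
  have hev3 : ∀ᶠ η in 𝓝 (0 : ℝ), x η t₀ ∈ ball (0 : ℂ) ε := by
    refine hxcη t₀ (isOpen_ball.mem_nhds ?_)
    change x 0 t₀ ∈ _
    rw [hx0, mem_ball, dist_zero_right, Complex.norm_real, Real.norm_of_nonneg ht₀0.le]
    have := min_le_right ρ (ε / 2)
    linarith
  have hev := ((hev1.and (hev2.and hev3)).filter_mono nhdsWithin_le_nhds).and
    (self_mem_nhdsWithin : Ioi (0 : ℝ) ∈ 𝓝[>] 0)
  obtain ⟨η, ⟨h1, h2, h3⟩, hη⟩ := hev.exists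
  have hη' : 0 < η := hη
  refine disjoint_left.1 hC (hδC _ h2 (by rw [hxim]; positivity)) ?_
  rw [mem_visibilitySet_iff]
  intro t ht0 ht1
  rcases ht0.eq_or_lt with rfl | ht0
  · simpa using hpE
  have hscale : p + t * (p + x η ρ * e - p) = p + x η (t * ρ) * e := by
    simp only [hx]; push_cast; ring
  rw [hscale]
  by_cases htt : t₀ ≤ t * ρ
  · exact h1 _ ⟨htt, by nlinarith⟩ hη'
  push Not at htt
  have h4 := h1 t₀ ⟨le_rfl, min_le_left _ _⟩ hη'
  have h5 : p + x η t₀ * e ∈ ball p ε := by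
    rw [mem_ball, dist_eq_norm, add_sub_cancel_left, norm_mul_unit he]
    simpa using h3
  have h6 := (hc _ h5 (t * ρ / t₀) (by positivity) ((div_le_one ht₀0).2 htt.le)).2 h4
  convert h6 using 1
  have : (t₀ : ℂ) ≠ 0 := by exact_mod_cast ht₀0.ne'
  simp only [hx]
  push_cast
  field_simp
  ring

/-- The last point of a visible segment that has no one-sided neighbourhood in `E` is reflex. -/
theorem exists_last_not_oneSided (h : PolyEnv E V) (he : ‖e‖ = 1) {s : ℝ}
    (hv : p + ρ * e ∈ visibilitySet E p) (hρs : OneSided E p e s ρ)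
    (hb : ∃ t : ℝ, 0 < t ∧ t ≤ ρ ∧ ¬ OneSided E p e s t) :
    ∃ t : ℝ, 0 < t ∧ t < ρ ∧ ¬ OneSided E p e s t ∧
      (∀ t', t < t' → t' ≤ ρ → OneSided E p e s t') ∧ p + t * e ∈ V := by
  obtain ⟨t₀, h0, h1, h2⟩ := hb
  have hcp : IsCompact (Icc t₀ ρ ∩ {a | OneSided E p e s a}ᶜ) :=
    isCompact_Icc.inter_right (isOpen_oneSided E p e s).isClosed_compl
  obtain ⟨t, ⟨⟨ht1, ht2⟩, ht3⟩, hmax⟩ := hcp.exists_isGreatest ⟨t₀, ⟨le_rfl, h1⟩, h2⟩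
  have ht3' : ¬ OneSided E p e s t := ht3
  have ht0 : 0 < t := h0.trans_le ht1
  have htρ : t < ρ := lt_of_le_of_ne ht2 (by rintro rfl; exact ht3' hρs)
  have hlast : ∀ t', t < t' → t' ≤ ρ → OneSided E p e s t' := by
    intro t' h3 h4
    by_contra h5
    exact absurd (hmax ⟨⟨ht1.trans h3.le, h4⟩, h5⟩) (not_le.2 h3)
  refine ⟨t, ht0, htρ, ht3', hlast, ?_⟩
  by_contra hV
  obtain ⟨ε, hε, hconv⟩ := h.convexAt _ hV
  have hline : ∀ a : ℝ, 0 ≤ a → a ≤ ρ → p + a * e ∈ E := by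
    intro a ha0 ha1
    have h3 := mem_visibilitySet_iff.1 hv (a / ρ) (by have := ht0.trans htρ; positivity)
      ((div_le_one (ht0.trans htρ)).2 ha1)
    convert h3 using 1
    have : (ρ : ℂ) ≠ 0 := by exact_mod_cast (ht0.trans htρ).ne'
    push_cast
    field_simp
    ring
  obtain ⟨d, hd, hd1, hd2, hd3⟩ : ∃ d : ℝ, 0 < d ∧ d < ε ∧ d ≤ t ∧ t + d ≤ ρ := by
    refine ⟨min (ε / 2) (min t (ρ - t)), ?_, ?_, ?_, ?_⟩
    · have : 0 < ρ - t := by linarith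
      positivity
    · exact (min_le_left _ _).trans_lt (by linarith)
    · exact (min_le_right _ _).trans (min_le_left _ _)
    · have : min (ε / 2) (min t (ρ - t)) ≤ ρ - t := (min_le_right _ _).trans (min_le_right _ _)
      linarith
  obtain ⟨r, hr, hrE⟩ := hlast (t + d) (by linarith) hd3
  apply ht3'
  refine ⟨min (r / 2) ((ε - d) / 2), by have : 0 < ε - d := by linarith
                                        positivity, fun x hx hxs => ?_⟩
  have hxn : ‖x - t‖ < r / 2 ∧ ‖x - t‖ < (ε - d) / 2 := by
    rwa [mem_ball, dist_eq_norm, lt_min_iff] at hx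
  -- The given `x` is the midpoint of `t - d`, which is on the visible axis, and of `y`, which is in
  -- the free half-disc at `t + d`. Convexity near the blocked point would free it.
  set y : ℂ := ((t - d : ℝ) : ℂ) + 2 * (x - ((t - d : ℝ) : ℂ)) with hy
  have hyd : y - ((t + d : ℝ) : ℂ) = 2 * (x - t) := by rw [hy]; push_cast; ring
  have hyt : y - t = d + 2 * (x - t) := by rw [hy]; push_cast; ring
  have hyE : p + y * e ∈ E := by
    refine hrE y ?_ ?_
    · rw [mem_ball, dist_eq_norm, hyd, norm_mul, Complex.norm_two]
      linarith [hxn.1]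
    · have : s * y.im = 2 * (s * x.im) := by
        rw [hy]; simp; ring
      rw [this]
      linarith
  have hyb : p + y * e ∈ ball (p + t * e) ε := by
    rw [mem_ball, dist_coord he, dist_eq_norm, hyt]
    have h3 := norm_add_le (d : ℂ) (2 * (x - t))
    rw [norm_mul, Complex.norm_two, Complex.norm_real, Real.norm_of_nonneg hd.le] at h3
    linarith [hxn.2]
  have hab : p + ((t - d : ℝ) : ℂ) * e ∈ ball (p + t * e) ε := by
    rw [mem_ball, dist_coord he, dist_ofReal, Real.dist_eq, show t - d - t = -d by ring, abs_neg,
      abs_of_pos hd]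
    exact hd1
  refine (hconv.segment_subset ⟨hline _ (by linarith) (by linarith), hab⟩ ⟨hyE, hyb⟩
    (segment_coord (mem_segment_iff_real.2 ⟨1 / 2, by norm_num, by norm_num, ?_⟩))).1
  rw [hy]
  push_cast
  ring

/-- The reflex vertex `p + t * e` from which a gap with region `C` emanates. -/
structure IsGapCorner (E : Set ℂ) (p : ℂ) (Q C : Set ℂ) (e : ℂ) (s t : ℝ) : Prop where
  sign : s = 1 ∨ s = -1
  pos : 0 < t
  blocked : ¬ OneSided E p e s t
  beyond : ∃ ρ > t, p + ρ * e ∈ Q ∧ p + ρ * e ∈ visibilitySet E p ∧ OneSided C p e s ρ ∧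
    ∀ t', t < t' → t' ≤ ρ → OneSided E p e s t'

theorem IsGapRegion.exists_isGapCorner {φ : ℝ} (hC : IsGapRegion E p Q C φ) (h : PolyEnv E V)
    (hQ : Region E Q) (hpE : p ∈ E) (hp : p ∉ Q) :
    ∃ s t : ℝ, IsGapCorner E p Q C (Complex.exp (φ * Complex.I)) s t ∧
      p + t * Complex.exp (φ * Complex.I) ∈ V := by
  obtain ⟨z, hz, hzQ, ρ, hρ, rfl⟩ := hC.exists_mem_frontier
  have he := Complex.norm_exp_ofReal_mul_I φ
  have hρ0 : 0 < ρ := by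
    refine lt_of_le_of_ne hρ fun h0 => hp ?_
    rw [← h0] at hzQ
    simpa using hzQ
  have hC' := hC.isHiddenComponent
  have hv := hC'.visible_of_mem_frontier h hQ hz hzQ
  obtain ⟨s, hs, hCs⟩ := hC'.oneSided h hQ he hρ0 hz hzQ
  have hCE : C ⊆ E := fun x hx => interior_subset (hQ.subset (hC'.subset hx).1)
  obtain ⟨t, h1, h2, h3, h4, h5⟩ := exists_last_not_oneSided h he hv (hCs.mono hCE)
    (exists_not_oneSided h (disjoint_left.2 fun x hx => (hC'.subset hx).2) hpE he hρ0 hs hCs)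
  exact ⟨s, t, ⟨hs, h1, h3, ρ, h2, hzQ, hv, hCs, h4⟩, h5⟩

/-- Gap regions on the same side of the same reflex vertex agree. -/
theorem IsGapCorner.eq_of_sign_eq {C' : Set ℂ} {s t : ℝ} (hC : IsHiddenComponent E p Q C)
    (hC' : IsHiddenComponent E p Q C') (hQ : Region E Q) (he : ‖e‖ = 1)
    (hc : IsGapCorner E p Q C e s t) (hc' : IsGapCorner E p Q C' e s t) : C = C' := by
  have he0 : e ≠ 0 := by rintro rfl; simp at he
  have hss : s * s = 1 := by rcases hc.sign with rfl | rfl <;> norm_num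
  obtain ⟨ρ, hρ, -, -, hCs, hfree⟩ := hc.beyond
  obtain ⟨ρ', hρ', -, -, hCs', hfree'⟩ := hc'.beyond
  obtain ⟨δ, hδ, hδC⟩ := hCs
  obtain ⟨δ', hδ', hδC'⟩ := hCs'
  set x : ℝ → ℝ → ℂ := fun η t => t * (1 + η * s * Complex.I) with hx
  have hxc : Continuous fun z : ℝ × ℝ => x z.1 z.2 := by simp only [hx]; fun_prop
  have hx0 : ∀ t, x 0 t = t := fun t => by simp [hx]
  have hxim : ∀ η t, s * (x η t).im = t * η := fun η t => by
    simp only [hx]; simp; linear_combination t * η * hss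
  have ht := hc.pos
  have hpos : ∀ a ∈ uIcc ρ ρ', t < a := fun a ha => (lt_min hρ hρ').trans_le ha.1
  -- Beyond the corner the side `s` is free, so a slightly tilted copy of the interval between `ρ`
  -- and `ρ'` runs in the interior of `E` and joins the two components; it is radial, so it remains
  -- hidden.
  have hev1 : ∀ᶠ η in 𝓝 (0 : ℝ), ∀ t ∈ uIcc ρ ρ', 0 < η → p + x η t * e ∈ interior E := by
    refine isCompact_uIcc.eventually_forall_of_forall_eventually
      (P := fun η t => 0 < η → p + x η t * e ∈ interior E) fun a ha => ?_
    have ha1 : OneSided E p e s a := by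
      rcases le_max_iff.1 ha.2 with h1 | h1
      · exact hfree a (hpos a ha) h1
      · exact hfree' a (hpos a ha) h1
    obtain ⟨r, hr, hrE⟩ := ha1.interior he0
    have h1 : ∀ᶠ z : ℝ × ℝ in 𝓝 (0, a), x z.1 z.2 ∈ ball (a : ℂ) r :=
      eventually_mem_ball hxc.continuousAt (hx0 _) hr
    have h2 : ∀ᶠ z : ℝ × ℝ in 𝓝 (0, a), 0 < z.2 :=
      continuousAt_snd.eventually (lt_mem_nhds (ht.trans (hpos a ha)))
    filter_upwards [h1, h2] with z hz1 hz2 hz3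
    exact hrE _ hz1 (by rw [hxim]; positivity)
  have hxcη : ∀ t, ContinuousAt (fun η => x η t) 0 := fun t => by
    simp only [hx]; fun_prop
  have hev2 : ∀ᶠ η in 𝓝 (0 : ℝ), x η ρ ∈ ball (ρ : ℂ) δ :=
    eventually_mem_ball (hxcη ρ) (hx0 _) hδ
  have hev3 : ∀ᶠ η in 𝓝 (0 : ℝ), x η ρ' ∈ ball (ρ' : ℂ) δ' :=
    eventually_mem_ball (hxcη ρ') (hx0 _) hδ'
  have hev := ((hev1.and (hev2.and hev3)).filter_mono nhdsWithin_le_nhds).and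
    (self_mem_nhdsWithin : Ioi (0 : ℝ) ∈ 𝓝[>] 0)
  obtain ⟨η, ⟨h1, h2, h3⟩, hη⟩ := hev.exists
  have hη' : 0 < η := hη
  have hρ0 : 0 < ρ := ht.trans hρ
  have hρ0' : 0 < ρ' := ht.trans hρ'
  have hyC : p + x η ρ * e ∈ C := hδC _ h2 (by rw [hxim]; positivity)
  have hyC' : p + x η ρ' * e ∈ C' := hδC' _ h3 (by rw [hxim]; positivity)
  have hcoord : ∀ a ∈ segment ℝ (p + x η ρ * e) (p + x η ρ' * e), ∃ b ∈ uIcc ρ ρ',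
      a = p + x η b * e := by
    intro a ha
    obtain ⟨τ, hτ0, hτ1, rfl⟩ := mem_segment_iff_real.1 ha
    refine ⟨ρ + τ * (ρ' - ρ), ?_, by simp only [hx]; push_cast; ring⟩
    rw [← segment_eq_uIcc, segment_eq_image']
    exact ⟨τ, ⟨hτ0, hτ1⟩, by simp⟩
  have hsegE : segment ℝ (p + x η ρ * e) (p + x η ρ' * e) ⊆ interior E := by
    intro a ha
    obtain ⟨b, hb, rfl⟩ := hcoord a ha
    exact h1 b hb hη'
  have hsegQ := hQ.convex _ (hC.subset hyC).1 _ (hC'.subset hyC').1 hsegE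
  have hseg : segment ℝ (p + x η ρ * e) (p + x η ρ' * e) ⊆ Q \ visibilitySet E p := by
    intro a ha
    refine ⟨hsegQ ha, ?_⟩
    obtain ⟨b, hb, rfl⟩ := hcoord a ha
    have hb0 : 0 < b := ht.trans (hpos b hb)
    have heq : p + x η b * e = p + ((b / ρ : ℝ) : ℂ) * (p + x η ρ * e - p) := by
      have : (ρ : ℂ) ≠ 0 := by exact_mod_cast hρ0.ne'
      simp only [hx]; push_cast; field_simp; ring
    rw [heq]
    refine hidden_of_hidden (by positivity) (hC.subset hyC).2 ?_
    rw [← heq]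
    exact ((convex_segment _ _).segment_subset (left_mem_segment ℝ _ _) ha).trans
      (hsegE.trans interior_subset)
  have h4 : p + x η ρ' * e ∈ C :=
    hC.subset_of_inter (convex_segment _ _).isPreconnected hseg (left_mem_segment ℝ _ _) hyC
      (right_mem_segment ℝ _ _)
  rw [hC.eq_component h4, hC'.eq_component hyC']

/-- No reflex vertex carries gaps on both sides. -/
theorem IsGapCorner.sign_eq {C' : Set ℂ} {s s' t : ℝ} (h : PolyEnv E V) (he : ‖e‖ = 1)
    (hc : IsGapCorner E p Q C e s t) (hc' : IsGapCorner E p Q C' e s' t) : s = s' := by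
  wlog hs : 0 ≤ s generalizing s s' C C'
  · by_cases hs' : 0 ≤ s'
    · exact (this hc' hc hs').symm
    · rcases hc.sign with rfl | rfl
      · exact absurd zero_le_one hs
      · rcases hc'.sign with rfl | rfl
        · exact absurd zero_le_one hs'
        · rfl
  have hs1 : s = 1 := by
    rcases hc.sign with rfl | rfl
    · rfl
    · norm_num at hs
  subst hs1
  rcases hc'.sign with rfl | rfl
  · rfl
  exfalso
  have he0 : e ≠ 0 := by rintro rfl; simp at he
  obtain ⟨ρ, hρ, -, hv, -⟩ := hc.beyond
  have ht := hc.pos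
  have hline : ∀ a : ℝ, 0 ≤ a → a ≤ ρ → p + a * e ∈ E := by
    intro a ha0 ha1
    have h3 := mem_visibilitySet_iff.1 hv (a / ρ) (by have := ht.trans hρ; positivity)
      ((div_le_one (ht.trans hρ)).2 ha1)
    convert h3 using 1
    have : (ρ : ℂ) ≠ 0 := by exact_mod_cast (ht.trans hρ).ne'
    push_cast
    field_simp
    ring
  -- Near the corner the outside of `E` is connected. If it were present on both sides of the axis,
  -- it would have to cross the axis, which near the corner is visible from `p` and so inside `E`.
  obtain ⟨ε₀, hε₀, hloc⟩ := h.loc _ (hline t ht.le hρ.le)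
  set ε := min ε₀ (min t (ρ - t)) with hε
  have hε0 : 0 < ε := by
    have : 0 < ρ - t := by linarith
    positivity
  have hpre := (hloc ε hε0 (min_le_left _ _)).2
  have hex : ∀ σ : ℝ, ¬ OneSided E p e σ t →
      ∃ x ∈ ball (t : ℂ) ε, 0 < σ * x.im ∧ p + x * e ∉ E := by
    intro σ hσ
    by_contra hno
    push Not at hno
    exact hσ ⟨ε, hε0, fun x h1 h2 => hno x h1 h2⟩
  obtain ⟨x, hx, hx1, hxE⟩ := hex 1 hc.blocked
  obtain ⟨y, hy, hy1, hyE⟩ := hex (-1) hc'.blocked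
  have hcont : Continuous fun w : ℂ => ((w - p) / e).im :=
    Complex.continuous_im.comp ((continuous_id.sub continuous_const).div_const e)
  have hco : ∀ x : ℂ, (p + x * e - p) / e = x := fun x => by field_simp; ring
  have hmemb : ∀ x ∈ ball (t : ℂ) ε, p + x * e ∈ ball (p + t * e) ε := fun x hx => by
    rwa [mem_ball, dist_coord he]
  obtain ⟨w, ⟨hw, hwE⟩, hw0⟩ := hpre.intermediate_value ⟨hmemb y hy, hyE⟩ ⟨hmemb x hx, hxE⟩
    hcont.continuousOn (show (0 : ℝ) ∈ Icc _ _ by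
      constructor
      · simp only [hco]; linarith
      · simp only [hco]; linarith)
  have hwr := eq_real_mul_of_im_div_eq_zero he0 hw0
  set a := ((w - p) / e).re
  have hwa : w = p + a * e := by linear_combination hwr
  apply hwE
  rw [hwa] at hw ⊢
  rw [mem_ball, dist_coord he, dist_ofReal, Real.dist_eq] at hw
  have h1 : ε ≤ t := (min_le_right _ _).trans (min_le_left _ _)
  have h2 : ε ≤ ρ - t := (min_le_right _ _).trans (min_le_right _ _)
  rw [abs_lt] at hw
  exact hline a (by linarith) (by linarith)

/-- Assigning to a gap its corner is injective. The same corner means the same direction, as the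
range is shorter than a full turn; then the same side, by `IsGapCorner.sign_eq`; then the same
hidden component, by `IsGapCorner.eq_of_sign_eq`. -/
theorem IsSweepRange.gaps_finite_and_ncard_le {α β : ℝ} (hs : IsSweepRange E p Q α β)
    (h : PolyEnv E V) (hQ : Region E Q) (hpE : p ∈ E) (hp : p ∉ Q) :
    {g : Set ℂ × ℝ | IsGapRegion E p Q g.1 g.2 ∧ g.2 ∈ Icc α β}.Finite ∧
      {g : Set ℂ × ℝ | IsGapRegion E p Q g.1 g.2 ∧ g.2 ∈ Icc α β}.ncard ≤ V.ncard := by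
  set G := {g : Set ℂ × ℝ | IsGapRegion E p Q g.1 g.2 ∧ g.2 ∈ Icc α β}
  have hex : ∀ g : Set ℂ × ℝ, ∃ v : ℂ, g ∈ G → v ∈ V ∧ ∃ s t : ℝ,
      IsGapCorner E p Q g.1 (Complex.exp (g.2 * Complex.I)) s t ∧
      p + t * Complex.exp (g.2 * Complex.I) = v := by
    intro g
    by_cases hg : g ∈ G
    · obtain ⟨s, t, h1, h2⟩ := hg.1.exists_isGapCorner h hQ hpE hp
      exact ⟨_, fun _ => ⟨h2, s, t, h1, rfl⟩⟩
    · exact ⟨0, fun h1 => absurd h1 hg⟩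
  choose f hf using hex
  have hmaps : MapsTo f G V := fun g hg => (hf g hg).1
  have hinj : InjOn f G := by
    rintro ⟨C, φ⟩ hg ⟨C', φ'⟩ hg' hff
    obtain ⟨-, s, t, hc, hv⟩ := hf _ hg
    obtain ⟨-, s', t', hc', hv'⟩ := hf _ hg'
    rw [← hv, ← hv'] at hff
    obtain ⟨rfl, k, hk⟩ := polar_unique hc.pos hc'.pos (add_left_cancel hff)
    have hφ : φ = φ' := hs.eq_of_exp_eq hg.2 hg'.2 (exp_mul_I_eq_iff.2 ⟨k, hk⟩)
    change φ = φ' at hφ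
    subst hφ
    have he := Complex.norm_exp_ofReal_mul_I φ
    obtain rfl := hc.sign_eq h he hc'
    rw [Prod.mk.injEq]
    exact ⟨hc.eq_of_sign_eq hg.1.isHiddenComponent hg'.1.isHiddenComponent hQ he hc', rfl⟩
  exact ⟨Finite.of_injOn hmaps hinj h.finite, ncard_le_ncard_of_injOn f hmaps hinj h.finite⟩

end

theorem ncard_reflex_le {n : ℕ} (P : Polygon ℂ n) :
    {x | ∃ i, IsReflex P i ∧ P i = x}.ncard ≤ reflexCount P :=
  ncard_image_le (toFinite {i | IsReflex P i})

/-! ## Frames -/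

/-- Points near `x` have polar angles near that of `x`. -/
theorem exists_ball_polar {p x : ℂ} {φ ρ η : ℝ} (hρ : 0 < ρ)
    (hx : x = p + ρ * Complex.exp (φ * Complex.I)) (hη : 0 < η) :
    ∃ δ > 0, ∀ y ∈ ball x δ, ∃ ψ r : ℝ, 0 < r ∧ |ψ - φ| < η ∧
      y = p + r * Complex.exp (ψ * Complex.I) := by
  have hρc : (ρ : ℂ) ≠ 0 := by exact_mod_cast hρ.ne'
  have hxp : x - p ≠ 0 := by rw [hx, add_sub_cancel_left]; simp [hρc]
  have hcont : ContinuousAt (fun y : ℂ => ((y - p) / (x - p)).arg) x := by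
    refine ContinuousAt.comp (g := Complex.arg) ?_
      ((continuous_id.sub continuous_const).div_const _).continuousAt
    refine Complex.continuousAt_arg ?_
    simp [div_self hxp]
  have h1 : ∀ᶠ y in 𝓝 x, |((y - p) / (x - p)).arg| < η := by
    have := hcont.abs.eventually_lt (continuousAt_const (y := η)) (by simpa [div_self hxp] using hη)
    exact this
  have h2 : ∀ᶠ y in 𝓝 x, y ≠ p := isOpen_ne.mem_nhds (sub_ne_zero.1 hxp)
  obtain ⟨δ, hδ, hb⟩ := Metric.eventually_nhds_iff_ball.1 (h1.and h2)
  refine ⟨δ, hδ, fun y hy => ?_⟩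
  obtain ⟨h3, h4⟩ := hb y hy
  set w := (y - p) / (x - p) with hw
  have hw0 : w ≠ 0 := div_ne_zero (sub_ne_zero.2 h4) hxp
  refine ⟨φ + w.arg, ρ * ‖w‖, mul_pos hρ (norm_pos_iff.2 hw0), by simpa using h3, ?_⟩
  have hyw : y = p + w * (x - p) := by rw [hw]; field_simp; ring
  rw [hyw, hx]
  nth_rewrite 1 [← Complex.norm_mul_exp_arg_mul_I w]
  push_cast
  rw [add_mul, Complex.exp_add]
  ring

/-- The light that sweeps over an interval of directions sweeps over a closed set. -/
theorem isClosed_swept {E : Set ℂ} (hE : IsClosed E) (p : ℂ) (a b : ℝ) :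
    IsClosed {x | ∃ φ ∈ Icc a b, x ∈ ray E p φ} := by
  set F : Set (Icc a b × ℂ) := {z | z.2 ∈ visibilitySet E p ∧
    z.2 = p + (‖z.2 - p‖ : ℝ) * Complex.exp (((z.1 : ℝ) : ℂ) * Complex.I)} with hF
  have hFc : IsClosed F := by
    refine IsClosed.inter ((isClosed_visibilitySet hE p).preimage continuous_snd)
      (isClosed_eq continuous_snd (by fun_prop))
  have : {x | ∃ φ ∈ Icc a b, x ∈ ray E p φ} = Prod.snd '' F := by
    ext x
    constructor
    · rintro ⟨φ, hφ, hx, ρ, hρ, hxe⟩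
      refine ⟨(⟨φ, hφ⟩, x), ⟨hx, ?_⟩, rfl⟩
      have : ‖x - p‖ = ρ := by
        rw [hxe, add_sub_cancel_left, norm_mul, Complex.norm_exp_ofReal_mul_I, mul_one,
          Complex.norm_real, Real.norm_of_nonneg hρ]
      change x = p + ((‖x - p‖ : ℝ) : ℂ) * _
      rw [this]
      exact hxe
    · rintro ⟨⟨⟨φ, hφ⟩, y⟩, ⟨h1, h2⟩, rfl⟩
      exact ⟨φ, hφ, h1, _, norm_nonneg _, h2⟩
  rw [this]
  exact isClosedMap_snd_of_compactSpace _ hFc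

theorem isClosed_ray {E : Set ℂ} (hE : IsClosed E) (p : ℂ) (φ : ℝ) : IsClosed (ray E p φ) := by
  have := isClosed_swept hE p φ φ
  simpa using this

/-- An engaged agent together with the region it clears and its start angle. -/
structure Frame (N : ℕ) where
  agent : Fin N
  region : Set ℂ
  start : ℝ
  task : Task N

namespace Frame

variable {N : ℕ}

/-- The frame after the searchlight has turned to the direction `φ`. -/
def turn (f : Frame N) (φ : ℝ) : Frame N := { f with task := { f.task with angle := φ } }

/-- The frame after the child `l` has been engaged to clear `C`. -/
def engage (f : Frame N) (C : Set ℂ) (l : Fin N) : Frame N :=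
  { f with task := { f.task with gaps := f.task.gaps \ {(C, f.task.angle)}, child := some l } }

/-- The frame after the child has reported completion. -/
def release (f : Frame N) : Frame N := { f with task := { f.task with child := none } }

/-- The part of the region of an engaged agent for which the agent itself is still responsible. -/
def own (E : Set ℂ) (p : Fin N → ℂ) (f : Frame N) : Set ℂ :=
  {x | (x ∈ f.region ∧ ∃ φ ∈ Ioc f.task.angle f.task.finish, x ∈ ray E (p f.agent) φ) ∨
    ∃ g ∈ f.task.gaps, x ∈ g.1}

/-- The invariants of a single engaged agent. -/
structure Good (E : Set ℂ) (p : Fin N → ℂ) (f : Frame N) : Prop where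
  region : Region E f.region
  canHelp : CanHelp E (p f.agent) f.region
  range : IsSweepRange E (p f.agent) f.region f.start f.task.finish
  start_le : f.start ≤ f.task.angle
  le_finish : f.task.angle ≤ f.task.finish
  of_mem_gaps : ∀ g ∈ f.task.gaps, IsGapRegion E (p f.agent) f.region g.1 g.2 ∧
    g.2 ∈ Icc f.task.angle f.task.finish
  mem_gaps : ∀ C φ, IsGapRegion E (p f.agent) f.region C φ →
    φ ∈ Ioc f.task.angle f.task.finish → (C, φ) ∈ f.task.gaps

variable {E V : Set ℂ} {p : Fin N → ℂ} {f : Frame N}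

theorem Good.new {Q : Set ℂ} {l : Fin N} {α β : ℝ} (hQ : Region E Q) (hl : CanHelp E (p l) Q)
    (hs : IsSweepRange E (p l) Q α β) (i : Option (Fin N)) :
    Good E p ⟨l, Q, α, newTask E (p l) i Q α β⟩ where
  region := hQ
  canHelp := hl
  range := hs
  start_le := le_rfl
  le_finish := hs.le
  of_mem_gaps _ hg := hg
  mem_gaps _ _ h1 h2 := ⟨h1, Ioc_subset_Icc_self h2⟩

theorem Good.next_le (hf : f.Good E p) {φ : ℝ} (hφ : IsNextAngle f.task φ) :
    φ ≤ f.task.finish := by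
  rcases hφ.1 with ⟨C, hC⟩ | ⟨-, h⟩
  · exact (hf.of_mem_gaps _ hC).2.2
  · exact h.le

theorem Good.turn (hf : f.Good E p) {φ ψ : ℝ} (hφ : IsNextAngle f.task φ)
    (h1 : f.task.angle ≤ ψ) (h2 : ψ ≤ φ) : (f.turn ψ).Good E p where
  region := hf.region
  canHelp := hf.canHelp
  range := hf.range
  start_le := hf.start_le.trans h1
  le_finish := h2.trans (hf.next_le hφ)
  of_mem_gaps g hg :=
    ⟨(hf.of_mem_gaps g hg).1, h2.trans (hφ.2 g hg), (hf.of_mem_gaps g hg).2.2⟩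
  mem_gaps C χ h3 h4 := hf.mem_gaps C χ h3 ⟨h1.trans_lt h4.1, h4.2⟩

theorem Good.engage (hf : f.Good E p) (C : Set ℂ) (l : Fin N) : (f.engage C l).Good E p where
  region := hf.region
  canHelp := hf.canHelp
  range := hf.range
  start_le := hf.start_le
  le_finish := hf.le_finish
  of_mem_gaps g hg := hf.of_mem_gaps g hg.1
  -- The removed gap is at the current angle, whereas the invariant concerns only gaps strictly
  -- beyond it.
  mem_gaps D φ h1 h2 := by
    refine ⟨hf.mem_gaps D φ h1 h2, fun h3 => ?_⟩
    rw [mem_singleton_iff, Prod.mk.injEq] at h3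
    exact h2.1.ne' h3.2

theorem Good.release (hf : f.Good E p) : f.release.Good E p where
  region := hf.region
  canHelp := hf.canHelp
  range := hf.range
  start_le := hf.start_le
  le_finish := hf.le_finish
  of_mem_gaps := hf.of_mem_gaps
  mem_gaps := hf.mem_gaps

theorem Good.gaps_finite_and_ncard_le (hf : f.Good E p) (h : PolyEnv E V) :
    f.task.gaps.Finite ∧ f.task.gaps.ncard ≤ V.ncard := by
  obtain ⟨h1, h2⟩ := hf.range.gaps_finite_and_ncard_le h hf.region hf.canHelp.mem hf.canHelp.1
  have hsub : f.task.gaps ⊆ {g : Set ℂ × ℝ | IsGapRegion E (p f.agent) f.region g.1 g.2 ∧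
      g.2 ∈ Icc f.start f.task.finish} := fun g hg =>
    ⟨(hf.of_mem_gaps g hg).1, hf.start_le.trans (hf.of_mem_gaps g hg).2.1,
      (hf.of_mem_gaps g hg).2.2⟩
  exact ⟨h1.subset hsub, (ncard_le_ncard hsub h1).trans h2⟩

theorem Good.own_subset (hf : f.Good E p) : f.own E p ⊆ f.region := by
  rintro x (hx | ⟨g, hg, hx⟩)
  · exact hx.1
  · exact ((hf.of_mem_gaps g hg).1.isHiddenComponent.subset hx).1

/-- The part that is still to be cleared is bounded inside the region by the current ray. -/
theorem Good.frontier_own_subset (hf : f.Good E p) (h : PolyEnv E V) :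
    frontier (f.own E p) ∩ f.region ⊆ ray E (p f.agent) f.task.angle := by
  rintro x ⟨hx, hxQ⟩
  by_contra hray
  have hQ := hf.region
  set q := p f.agent with hq
  have hqQ : q ∉ f.region := hf.canHelp.1
  have hs := hf.range
  -- To contradict that `x` is a frontier point, it suffices to find a neighbourhood contained in
  -- the own part or disjoint from it.
  have hconst : ∀ U : Set ℂ, IsOpen U → x ∈ U → U ⊆ f.own E p ∨ Disjoint U (f.own E p) → False := by
    rintro U hU hxU (hsub | hdisj)
    · exact hx.2 (mem_interior.2 ⟨U, hsub, hU, hxU⟩)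
    · obtain ⟨y, hy, hyo⟩ := mem_closure_iff.1 hx.1 U hU hxU
      exact disjoint_left.1 hdisj hy hyo
  by_cases hv : x ∈ visibilitySet E q
  · have hxq : x ≠ q := by rintro rfl; exact hqQ hxQ
    obtain ⟨φ, hφ, ρ, hρ, hxe⟩ := hs.exists_polar (subset_closure hxQ) hxq hv
    have hne : φ ≠ f.task.angle := by
      rintro rfl
      exact hray ⟨hv, ρ, hρ.le, hxe⟩
    -- The first term keeps nearby directions on the same side of the current angle. The second, a
    -- third of the angle left over by the sweep range, makes directions within `η` of the range
    -- unambiguous modulo `2π`.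
    set η := min |φ - f.task.angle| ((f.start + 2 * Real.pi - f.task.finish) / 3) with hη
    have hη0 : 0 < η := by
      have h1 : 0 < |φ - f.task.angle| := abs_pos.2 (sub_ne_zero.2 hne)
      have h2 : 0 < f.start + 2 * Real.pi - f.task.finish := by linarith [hs.lt]
      positivity
    have hη1 : η ≤ |φ - f.task.angle| := min_le_left _ _
    have hη2 : η ≤ (f.start + 2 * Real.pi - f.task.finish) / 3 := min_le_right _ _
    obtain ⟨δ₁, hδ₁, hpol⟩ := exists_ball_polar hρ hxe hη0
    obtain ⟨δ₂, hδ₂, hball⟩ := Metric.isOpen_iff.1 hQ.isOpen x hxQ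
    set B := ball x (min δ₁ δ₂) with hB
    have hBQ : B ⊆ f.region := (ball_subset_ball (min_le_right _ _)).trans hball
    have hangle : ∀ y ∈ B, ∀ χ ∈ Icc f.start f.task.finish, y ∈ ray E q χ → |χ - φ| < η := by
      intro y hy χ hχ hyr
      obtain ⟨ψ, r, hr, hψ, hye⟩ := hpol y (ball_subset_ball (min_le_left _ _) hy)
      obtain ⟨-, r', hr', hye'⟩ := hyr
      have hyq : y ≠ q := by rintro rfl; exact hqQ (hBQ hy)
      have hr0 : 0 < r' := by
        refine lt_of_le_of_ne hr' fun h0 => hyq ?_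
        rw [hye', ← h0]; simp
      obtain ⟨-, k, hk⟩ := polar_unique hr0 hr (add_left_cancel (hye'.symm.trans hye))
      rw [abs_lt] at hψ
      have := int_eq_zero_of_shift hk (c := f.start - η) (d := f.task.finish + η)
        (by linarith [hχ.1]) (by linarith [hχ.2]) (by linarith [hφ.1, hψ.1])
        (by linarith [hφ.2, hψ.2]) (by linarith [hs.lt])
      rw [this] at hk
      rw [abs_lt]
      constructor <;> simp at hk <;> linarith [hψ.1, hψ.2]
    -- As `x` is visible, every hidden component that meets the ball has a frontier point in it, so
    -- the direction of its gap is close to that of `x`.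
    have hcomp : ∀ y ∈ B, ∀ C, IsHiddenComponent E q f.region C → y ∈ C →
        ∃ z ∈ B, z ∈ frontier C ∧ z ∈ f.region := by
      intro y hy C hC hyC
      have hseg : segment ℝ y x ⊆ B :=
        (convex_ball _ _).segment_subset hy (mem_ball_self (lt_min hδ₁ hδ₂))
      obtain ⟨t, ht0, ht1, htv, htC⟩ := hC.exists_first_visible h hyC hv (hseg.trans hBQ)
      have hzB : y + t * (x - y) ∈ B := hseg (mem_segment_iff_real.2 ⟨t, ht0.le, ht1, rfl⟩)
      refine ⟨_, hzB, ⟨?_, ?_⟩, hBQ hzB⟩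
      · have hc : Continuous fun s : ℝ => y + s * (x - y) := by fun_prop
        have hm : t ∈ closure (Ico 0 t) := by
          rw [closure_Ico ht0.ne]
          exact ⟨ht0.le, le_rfl⟩
        exact closure_mono (by rintro _ ⟨s, hs, rfl⟩; exact htC s hs.1 hs.2)
          (image_closure_subset_closure_image hc ⟨t, hm, rfl⟩)
      · exact fun hi => (hC.subset (interior_subset hi)).2 htv
    -- Behind the current ray everything near `x` has been dealt with: a remaining gap would have a
    -- direction at or past the current angle. Ahead of it everything near `x`, visible or hidden,
    -- is still owned.
    refine hconst B isOpen_ball (mem_ball_self (lt_min hδ₁ hδ₂)) ?_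
    rcases lt_or_gt_of_ne hne with hlt | hgt
    · right
      rw [disjoint_left]
      have hlow : ∀ χ, |χ - φ| < η → χ < f.task.angle := by
        intro χ hχ
        have h1 := hχ.trans_le hη1
        rw [abs_of_neg (by linarith : φ - f.task.angle < 0), abs_lt] at h1
        linarith [h1.2]
      rintro y hy (⟨-, χ, hχ, hyr⟩ | ⟨g, hg, hyg⟩)
      · exact absurd (hlow χ (hangle y hy χ ⟨hf.start_le.trans hχ.1.le, hχ.2⟩ hyr))
          (not_lt.2 hχ.1.le)
      · obtain ⟨hgr, hg1, hg2⟩ := hf.of_mem_gaps g hg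
        obtain ⟨z, hzB, hzf, hzQ⟩ := hcomp y hy _ hgr.isHiddenComponent hyg
        have hzr := hgr.frontier_subset_ray h hQ hqQ ⟨hzf, hzQ⟩
        exact absurd (hlow _ (hangle z hzB _ ⟨hf.start_le.trans hg1, hg2⟩ hzr)) (not_lt.2 hg1)
    · left
      have hhigh : ∀ χ, |χ - φ| < η → f.task.angle < χ := by
        intro χ hχ
        have h1 := hχ.trans_le hη1
        rw [abs_of_pos (by linarith : 0 < φ - f.task.angle), abs_lt] at h1
        linarith [h1.1]
      have hpolar : ∀ z ∈ B, z ∈ visibilitySet E q → ∃ χ ∈ Ioc f.task.angle f.task.finish,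
          ∃ r : ℝ, 0 ≤ r ∧ z = q + r * Complex.exp (χ * Complex.I) := by
        intro z hz hzv
        obtain ⟨χ, hχ, r, hr, hze⟩ := hs.exists_polar (subset_closure (hBQ hz))
          (by rintro rfl; exact hqQ (hBQ hz)) hzv
        exact ⟨χ, ⟨hhigh χ (hangle z hz χ hχ ⟨hzv, r, hr.le, hze⟩), hχ.2⟩, r, hr.le, hze⟩
      intro y hy
      by_cases hyv : y ∈ visibilitySet E q
      · obtain ⟨χ, hχ, r, hr, hye⟩ := hpolar y hy hyv
        exact Or.inl ⟨hBQ hy, χ, hχ, hyv, r, hr, hye⟩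
      · have hyC : y ∈ connectedComponentIn (f.region \ visibilitySet E q) y :=
          mem_connectedComponentIn ⟨hBQ hy, hyv⟩
        have hC : IsHiddenComponent E q f.region
            (connectedComponentIn (f.region \ visibilitySet E q) y) := ⟨y, ⟨hBQ hy, hyv⟩, rfl⟩
        obtain ⟨z, hzB, hzf, hzQ⟩ := hcomp y hy _ hC hyC
        obtain ⟨χ, hχ, r, hr, hze⟩ := hpolar z hzB (hC.visible_of_mem_frontier h hQ hzf hzQ)
        exact Or.inr ⟨_, hf.mem_gaps _ χ (hC.isGapRegion h hQ hqQ hzf hzQ hr hze) hχ, hyC⟩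
  · have hC : IsHiddenComponent E q f.region
        (connectedComponentIn (f.region \ visibilitySet E q) x) := ⟨x, ⟨hxQ, hv⟩, rfl⟩
    -- A hidden component is owned entirely or not at all, according to whether it is among the
    -- remaining gap regions.
    refine hconst _ (hC.isOpen h hQ) (mem_connectedComponentIn ⟨hxQ, hv⟩) ?_
    by_cases hg : ∃ g ∈ f.task.gaps, g.1 = connectedComponentIn (f.region \ visibilitySet E q) x
    · obtain ⟨g, hg, hgC⟩ := hg
      exact Or.inl fun y hy => Or.inr ⟨g, hg, hgC ▸ hy⟩
    · right
      rw [disjoint_left]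
      rintro y hy (⟨-, χ, -, hyr⟩ | ⟨g, hgm, hyg⟩)
      · exact (hC.subset hy).2 hyr.1
      · exact hg ⟨g, hgm, ((hf.of_mem_gaps g hgm).1.isHiddenComponent.eq_component hyg).trans
          (hC.eq_component hy).symm⟩

/-- A newly engaged agent is responsible for its whole region, except for its first ray. -/
theorem region_subset_own_new (h : PolyEnv E V) {Q : Set ℂ} {l : Fin N} {α β : ℝ}
    (hQ : Region E Q) (hl : CanHelp E (p l) Q) (hs : IsSweepRange E (p l) Q α β)
    (i : Option (Fin N)) :
    Q ⊆ own E p ⟨l, Q, α, newTask E (p l) i Q α β⟩ ∪ ray E (p l) α := by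
  intro x hx
  by_cases hv : x ∈ visibilitySet E (p l)
  · obtain ⟨φ, hφ, r, hr, hxe⟩ := hs.exists_polar (subset_closure hx)
      (by rintro rfl; exact hl.1 hx) hv
    rcases hφ.1.eq_or_lt with h0 | h0
    · have hxr : x ∈ ray E (p l) φ := ⟨hv, r, hr.le, hxe⟩
      exact Or.inr (h0 ▸ hxr)
    · exact Or.inl (Or.inl ⟨hx, φ, ⟨h0, hφ.2⟩, hv, r, hr.le, hxe⟩)
  · have hC : IsHiddenComponent E (p l) Q
        (connectedComponentIn (Q \ visibilitySet E (p l)) x) := ⟨x, ⟨hx, hv⟩, rfl⟩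
    obtain ⟨z, hz, hzQ⟩ := hC.exists_mem_frontier h hQ hl.2
    obtain ⟨φ, hφ, r, hr, hze⟩ := hs.exists_polar (subset_closure hzQ)
      (by rintro rfl; exact hl.1 hzQ) (hC.visible_of_mem_frontier h hQ hz hzQ)
    have hm : x ∈ connectedComponentIn (Q \ visibilitySet E (p l)) x :=
      mem_connectedComponentIn ⟨hx, hv⟩
    exact Or.inl (Or.inr ⟨(_, φ), ⟨hC.isGapRegion h hQ hl.1 hz hzQ hr.le hze, hφ⟩, hm⟩)

end Frame

/-! ## The stack of engaged agents -/

variable {N : ℕ}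

/-- The engaged agents, from the most recently engaged one to the root. -/
inductive IsStack (E : Set ℂ) (p : Fin N → ℂ) : List (Frame N) → Prop
  | nil : IsStack E p []
  | root (f : Frame N) : f.Good E p → f.task.parent = none → f.region = interior E →
      IsStack E p [f]
  | push (f g : Frame N) (L : List (Frame N)) : IsStack E p (g :: L) → f.Good E p →
      f.task.parent = some g.agent → g.task.child = some f.agent →
      IsGapRegion E (p g.agent) g.region f.region g.task.angle → IsStack E p (f :: g :: L)

namespace IsStack

variable {E V : Set ℂ} {p : Fin N → ℂ} {f : Frame N} {L : List (Frame N)}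

theorem good (hL : IsStack E p (f :: L)) : f.Good E p := by
  cases hL <;> assumption

theorem tail (hL : IsStack E p (f :: L)) : IsStack E p L := by
  cases hL
  · exact nil
  · assumption

theorem good_of_mem (hL : IsStack E p L) : ∀ g ∈ L, g.Good E p := by
  induction hL with
  | nil => simp
  | root f hf _ _ => simpa using hf
  | push f g L _ hf _ _ _ ih => simpa [hf] using ih

theorem child_ne_none (hL : IsStack E p (f :: L)) : ∀ g ∈ L, g.task.child ≠ none := by
  induction L generalizing f with
  | nil => simp
  | cons g L ih =>
    cases hL with
    | push _ _ _ hL _ _ hc _ =>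
      intro k hk
      rcases List.mem_cons.1 hk with rfl | hk
      · simp [hc]
      · exact ih hL k hk

/-- The region of a frame is hidden from its parent and contained in the parent's region, so
induction down the stack shows that no ancestor sees it. For this reason an agent able to help is
never already engaged. -/
theorem disjoint_visibilitySet (hL : IsStack E p (f :: L)) :
    ∀ g ∈ L, Disjoint f.region (visibilitySet E (p g.agent)) := by
  induction L generalizing f with
  | nil => simp
  | cons g L ih =>
    cases hL with
    | push _ _ _ hL _ _ _ hgap =>
      have hsub := hgap.isHiddenComponent.subset
      intro k hk
      rcases List.mem_cons.1 hk with rfl | hk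
      · exact disjoint_left.2 fun x hx => (hsub hx).2
      · exact (ih hL k hk).mono_left fun x hx => (hsub hx).1

/-- The head of a stack may be replaced by a frame with the same connections. -/
theorem replace_head (hL : IsStack E p (f :: L)) {f' : Frame N} (hf' : f'.Good E p)
    (ha : f'.agent = f.agent) (hr : f'.region = f.region)
    (hp : f'.task.parent = f.task.parent) : IsStack E p (f' :: L) := by
  cases hL with
  | root _ hf h1 h2 => exact root _ hf' (hp.trans h1) (hr.trans h2)
  | push _ g L hL hf h1 h2 h3 =>
    exact push _ _ _ hL hf' (hp.trans h1) (by rw [ha]; exact h2) (by rw [hr]; exact h3)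

end IsStack

/-- The tasks of the agents are those recorded in the stack. -/
def Records (T : Fin N → Option (Task N)) (L : List (Frame N)) : Prop :=
  ∀ i τ, T i = some τ ↔ ∃ f ∈ L, f.agent = i ∧ f.task = τ

namespace Records

variable {T : Fin N → Option (Task N)} {f : Frame N} {L : List (Frame N)}

theorem eq_none (hT : Records T L) {i : Fin N} (hi : i ∉ L.map Frame.agent) : T i = none := by
  rw [Option.eq_none_iff_forall_ne_some]
  intro τ hτ
  obtain ⟨g, hg, rfl, -⟩ := (hT i τ).1 hτ
  exact hi (List.mem_map_of_mem hg)

theorem push (hT : Records T L) (hf : f.agent ∉ L.map Frame.agent) :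
    Records (Function.update T f.agent (some f.task)) (f :: L) := by
  intro i τ
  rw [List.exists_mem_cons_iff]
  by_cases hi : i = f.agent
  · subst hi
    rw [Function.update_self, Option.some_inj]
    constructor
    · exact fun h => Or.inl ⟨rfl, h⟩
    · rintro (⟨-, h⟩ | ⟨g, hg, hga, -⟩)
      · exact h
      · exact absurd (hga ▸ List.mem_map_of_mem hg) hf
  · rw [Function.update_of_ne hi, hT]
    simp [Ne.symm hi]

theorem pop (hT : Records T (f :: L)) (hf : f.agent ∉ L.map Frame.agent) :
    Records (fun k => if k = f.agent then none else T k) L := by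
  intro i τ
  by_cases hi : i = f.agent
  · subst hi
    simp only [if_true, reduceCtorEq, false_iff]
    rintro ⟨g, hg, hga, -⟩
    exact hf (hga ▸ List.mem_map_of_mem hg)
  · simp only [hi, if_false]
    rw [hT, List.exists_mem_cons_iff]
    simp [Ne.symm hi]

theorem update_head (hT : Records T (f :: L)) (hf : f.agent ∉ L.map Frame.agent) {f' : Frame N}
    (ha : f'.agent = f.agent) : Records (Function.update T f.agent (some f'.task)) (f' :: L) := by
  have h1 := (hT.pop hf).push (f := f') (by rwa [ha])
  convert h1 using 1
  funext k
  rw [ha]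
  by_cases hk : k = f.agent
  · subst hk; simp
  · simp [hk]

end Records

/-- The stack represents the state of the network. -/
structure Represents (E : Set ℂ) (p : Fin N → ℂ) (c : Config N) (L : List (Frame N)) : Prop where
  records : Records c.task L
  nodup : (L.map Frame.agent).Nodup
  stack : IsStack E p L
  child_head : ∀ f ∈ L.head?, f.task.child = none

/-- The head of the stack, if any, stops waiting for its child. -/
def releaseHead : List (Frame N) → List (Frame N)
  | [] => []
  | f :: L => f.release :: L

/-- The actions, in terms of the stack, and their durations. -/
inductive StackMove (E : Set ℂ) (p : Fin N → ℂ) (ω : ℝ) :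
    List (Frame N) → List (Frame N) → ℝ → Prop
  | slew (f : Frame N) (L : List (Frame N)) (φ : ℝ) : IsNextAngle f.task φ → f.task.angle < φ →
      StackMove E p ω (f :: L) (f.turn φ :: L) ((φ - f.task.angle) / ω)
  | engage (f : Frame N) (L : List (Frame N)) (l : Fin N) (C : Set ℂ) (α β : ℝ) :
      (C, f.task.angle) ∈ f.task.gaps → CanHelp E (p l) C → IsSweepRange E (p l) C α β →
      StackMove E p ω (f :: L)
        (⟨l, C, α, newTask E (p l) (some f.agent) C α β⟩ :: f.engage C l :: L) 0
  | complete (f : Frame N) (L : List (Frame N)) : f.task.gaps = ∅ →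
      f.task.angle = f.task.finish → StackMove E p ω (f :: L) (releaseHead L) 0

section

variable {E V : Set ℂ} {p : Fin N → ℂ} {ω : ℝ} {c c' : Config N} {L : List (Frame N)}

/-- Every engaged agent below the top of the stack waits for the one above it, so only the top can
act. -/
theorem Represents.exists_head (hR : Represents E p c L) {i : Fin N} {τ : Task N}
    (hi : c.task i = some τ) (hτ : τ.child = none) :
    ∃ f L', L = f :: L' ∧ f.agent = i ∧ f.task = τ := by
  obtain ⟨f, hf, h1, h2⟩ := (hR.records i τ).1 hi
  cases L with
  | nil => simp at hf
  | cons g L =>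
    rcases List.mem_cons.1 hf with rfl | hf
    · exact ⟨f, L, rfl, h1, h2⟩
    · exact absurd (h2 ▸ hτ) (hR.stack.child_ne_none f hf)

theorem Frame.Good.region_of_mem_gaps {f : Frame N} (hf : f.Good E p) (h : PolyEnv E V)
    {g : Set ℂ × ℝ} (hg : g ∈ f.task.gaps) : Region E g.1 :=
  (hf.of_mem_gaps g hg).1.region h hf.region hf.canHelp.mem hf.canHelp.1

theorem Represents.step (hR : Represents E p c L) (h : PolyEnv E V) (hs : Step E p ω c c') :
    ∃ L' dt, StackMove E p ω L L' dt ∧ c'.time = c.time + dt ∧ Represents E p c' L' := by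
  cases hs with
  | slew i τ φ hi hτ hφ hlt =>
    obtain ⟨f, L, rfl, rfl, rfl⟩ := hR.exists_head hi hτ
    have hnd := List.nodup_cons.1 hR.nodup
    refine ⟨_, _, .slew f L φ hφ hlt, rfl, ?_, hR.nodup, ?_, ?_⟩
    · exact hR.records.update_head hnd.1 (f' := f.turn φ) rfl
    · exact hR.stack.replace_head (hR.stack.good.turn hφ hlt.le le_rfl) rfl rfl rfl
    · simpa [Frame.turn] using hτ
  | engage i l τ C α β hi hτ hC hl hhelp hrange =>
    obtain ⟨f, L, rfl, rfl, rfl⟩ := hR.exists_head hi hτ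
    have hnd := List.nodup_cons.1 hR.nodup
    have hl' : l ∉ ((f.engage C l) :: L).map Frame.agent := by
      intro hm
      obtain ⟨g, hg, hgl⟩ := List.mem_map.1 hm
      rcases List.mem_cons.1 hg with rfl | hg
      · change f.agent = l at hgl
        rw [← hgl, hi] at hl
        cases hl
      · rw [(hR.records l g.task).2 ⟨g, List.mem_cons_of_mem _ hg, hgl, rfl⟩] at hl
        cases hl
    refine ⟨_, _, .engage f L l C α β hC hhelp hrange, (add_zero _).symm, ?_, ?_, ?_, ?_⟩
    · exact (hR.records.update_head hnd.1 (f' := f.engage C l) rfl).push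
        (f := ⟨l, C, α, newTask E (p l) (some f.agent) C α β⟩) hl'
    · exact List.nodup_cons.2 ⟨hl', hR.nodup⟩
    · exact .push _ _ _ (hR.stack.replace_head (hR.stack.good.engage C l) rfl rfl rfl)
        (.new (hR.stack.good.region_of_mem_gaps h hC) hhelp hrange _) rfl rfl
        (hR.stack.good.of_mem_gaps _ hC).1
    · rintro g hg
      cases hg
      rfl
  | complete i τ hi hτ hgaps hfin =>
    obtain ⟨f, L, rfl, rfl, rfl⟩ := hR.exists_head hi hτ
    have hnd := List.nodup_cons.1 hR.nodup
    refine ⟨_, _, .complete f L hgaps hfin, (add_zero _).symm, ?_⟩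
    have hpop := hR.records.pop hnd.1
    cases hR.stack with
    | root _ hf hpar hreg =>
      refine ⟨?_, List.nodup_nil, .nil, by simp [releaseHead]⟩
      intro k τ
      have : ∀ k, k ≠ f.agent → c.task k = none := fun k hk => hR.records.eq_none (by simpa using hk)
      simp only [releaseHead, List.not_mem_nil, false_and, exists_false, iff_false]
      by_cases hk : k = f.agent
      · simp [hk]
      · simp [hk, this k hk]
    | push _ g L hL hf hpar hch hgap =>
      have hnd' := List.nodup_cons.1 hnd.2
      refine ⟨?_, hnd.2, hL.replace_head hL.good.release rfl rfl rfl, ?_⟩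
      · have hup := hpop.update_head hnd'.1 (f' := g.release) rfl
        change Records _ (g.release :: L)
        convert hup using 1
        funext k
        rw [hpar]
        by_cases hk : k = g.agent
        · subst hk
          have hne : g.agent ≠ f.agent := by
            intro heq
            exact hnd.1 (by rw [← heq]; simp)
          have : c.task g.agent = some g.task :=
            (hR.records _ _).2 ⟨g, by simp, rfl, rfl⟩
          simp [hne, this, Frame.release]
        · have hk' : g.agent ≠ k := Ne.symm hk
          rw [Function.update_of_ne hk]
          by_cases hkf : k = f.agent
          · simp [hkf]
          · cases hck : c.task k <;> simp [hkf, hk', hck]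
      · rintro k hk
        cases hk
        rfl

/-- As long as an agent is engaged, some action is possible. -/
theorem Represents.exists_step (h : PolyEnv E V)
    (hhelp : ∀ C, Region E C → ∃ l, CanHelp E (p l) C) {f : Frame N}
    (hR : Represents E p c (f :: L)) : ∃ c', Step E p ω c c' := by
  have hf := hR.stack.good
  have htask : c.task f.agent = some f.task := (hR.records _ _).2 ⟨f, by simp, rfl, rfl⟩
  have hchild : f.task.child = none := hR.child_head f rfl
  by_cases hgap : ∃ C, (C, f.task.angle) ∈ f.task.gaps
  · obtain ⟨C, hC⟩ := hgap
    have hCr := hf.region_of_mem_gaps h hC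
    obtain ⟨l, hl⟩ := hhelp C hCr
    obtain ⟨α, β, hs⟩ := hl.exists_isSweepRange h hCr
    have hsub := (hf.of_mem_gaps _ hC).1.isHiddenComponent.subset
    refine ⟨_, .engage c f.agent l f.task C α β htask hchild hC ?_ hl hs⟩
    -- The head does not see the region because it is behind its gap, and the other engaged agents
    -- do not even see the region of the head.
    apply hR.records.eq_none
    intro hm
    obtain ⟨g, hg, rfl⟩ := List.mem_map.1 hm
    obtain ⟨x, hxC, hxv⟩ := hl.2
    rcases List.mem_cons.1 hg with rfl | hg
    · exact (hsub hxC).2 hxv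
    · exact disjoint_left.1 (hR.stack.disjoint_visibilitySet g hg) (hsub hxC).1 hxv
  push Not at hgap
  by_cases hne : f.task.gaps.Nonempty
  · obtain ⟨g, hg, hmin⟩ :=
      exists_min_image f.task.gaps Prod.snd (hf.gaps_finite_and_ncard_le h).1 hne
    refine ⟨_, .slew c f.agent f.task g.2 htask hchild ⟨Or.inl ⟨g.1, hg⟩, fun k hk => ?_⟩ ?_⟩
    · exact hmin k hk
    · refine lt_of_le_of_ne (hf.of_mem_gaps g hg).2.1 fun h0 => hgap g.1 ?_
      rw [h0]
      exact hg
  · rw [not_nonempty_iff_eq_empty] at hne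
    rcases hf.le_finish.eq_or_lt with h0 | h0
    · exact ⟨_, .complete c f.agent f.task htask hchild hne h0⟩
    · exact ⟨_, .slew c f.agent f.task _ htask hchild ⟨Or.inr ⟨hne, rfl⟩, by simp [hne]⟩ h0⟩

/-! ## Time and number of actions -/

/-- A bound on the time that an agent needs to clear a region if it has `d` ancestors. -/
noncomputable def taskTime (N : ℕ) (ω : ℝ) (r d : ℕ) : ℝ :=
  2 * Real.pi / ω * ∑ j ∈ Finset.range (N - d), (r : ℝ) ^ j

theorem taskTime_nonneg (hω : 0 < ω) (r d : ℕ) : 0 ≤ taskTime N ω r d := by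
  unfold taskTime; positivity

/-- One full turn, plus the tasks of up to `r` children at the next depth; at depth `N` the sum is
empty. -/
theorem taskTime_eq {d : ℕ} (hd : d < N) (r : ℕ) :
    taskTime N ω r d = 2 * Real.pi / ω + r * taskTime N ω r (d + 1) := by
  have : N - d = N - (d + 1) + 1 := by omega
  rw [taskTime, taskTime, this, geom_sum_succ]
  ring

/-- A bound on the time that is needed to empty the stack. -/
noncomputable def stackTime (N : ℕ) (ω : ℝ) (r : ℕ) : List (Frame N) → ℝ
  | [] => 0
  | f :: L => (f.task.finish - f.task.angle) / ω +
      f.task.gaps.ncard * taskTime N ω r (L.length + 1) + stackTime N ω r L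

theorem stackTime_nonneg (hω : 0 < ω) (r : ℕ) (hL : IsStack E p L) :
    0 ≤ stackTime N ω r L := by
  induction L with
  | nil => exact le_rfl
  | cons f L ih =>
    have h1 := ih hL.tail
    have h2 := taskTime_nonneg (N := N) hω r (L.length + 1)
    have h3 : 0 ≤ (f.task.finish - f.task.angle) / ω :=
      div_nonneg (sub_nonneg.2 hL.good.le_finish) hω.le
    unfold stackTime
    positivity

/-- The new sweep is shorter than a full turn and has at most `V.ncard ≤ r` gaps. The strict bound
`hd` leaves room for the new frame. -/
theorem stackTime_new_le (h : PolyEnv E V) (hω : 0 < ω) {r : ℕ} (hr : V.ncard ≤ r) {Q : Set ℂ}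
    (hQ : Region E Q) {l : Fin N} (hl : CanHelp E (p l) Q) {α β : ℝ}
    (hs : IsSweepRange E (p l) Q α β) (i : Option (Fin N)) (hd : L.length < N) :
    stackTime N ω r (⟨l, Q, α, newTask E (p l) i Q α β⟩ :: L) ≤
      taskTime N ω r L.length + stackTime N ω r L := by
  have hncard := ((Frame.Good.new hQ hl hs i).gaps_finite_and_ncard_le h).2.trans hr
  rw [stackTime, taskTime_eq hd]
  refine add_le_add (add_le_add ?_ ?_) le_rfl
  · have := hs.lt
    change (β - α) / ω ≤ _
    gcongr
    linarith
  · have := taskTime_nonneg (N := N) hω r (L.length + 1)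
    gcongr

theorem stackTime_releaseHead (ω : ℝ) (r : ℕ) (L : List (Frame N)) :
    stackTime N ω r (releaseHead L) = stackTime N ω r L := by
  cases L <;> rfl

/-- Slewing turns remaining angle into elapsed time. Engaging spends the budget reserved for one gap
on the budget of the new task. The agents on the stack are distinct, which bounds the depth. -/
theorem StackMove.stackTime_le (h : PolyEnv E V) (hω : 0 < ω) {r : ℕ} (hr : V.ncard ≤ r)
    {L' : List (Frame N)} {dt : ℝ} (hm : StackMove E p ω L L' dt) (hL : IsStack E p L)
    (hN : L'.length ≤ N) : dt + stackTime N ω r L' ≤ stackTime N ω r L := by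
  cases hm with
  | slew f L φ hφ hlt =>
    simp only [stackTime, Frame.turn]
    have : (f.task.finish - f.task.angle) / ω =
        (φ - f.task.angle) / ω + (f.task.finish - φ) / ω := by ring
    linarith
  | engage f L l C α β hC hl hs =>
    have hnew := stackTime_new_le h hω hr (hL.good.region_of_mem_gaps h hC) hl hs (some f.agent)
      (L := f.engage C l :: L) (by simpa using hN)
    have hcard := ncard_sdiff_singleton_add_one hC (hL.good.gaps_finite_and_ncard_le h).1
    have hcard' : (f.task.gaps.ncard : ℝ) =
        (f.task.gaps \ {(C, f.task.angle)}).ncard + 1 := by exact_mod_cast hcard.symm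
    rw [zero_add]
    refine hnew.trans ?_
    simp only [stackTime, Frame.engage, List.length_cons]
    rw [hcard']
    linarith
  | complete f L hg ha =>
    rw [zero_add, stackTime_releaseHead]
    simp [stackTime, hg, ha]

/-- A bound on the number of actions in clearing a region if at most `m` agents can be engaged in
a chain of descendants. -/
def taskSteps (r : ℕ) : ℕ → ℕ
  | 0 => 0
  -- Per gap: one turn, one engagement and the child's task; at the end, one last turn and the
  -- completion.
  | m + 1 => r * (2 + taskSteps r m) + 2

open Classical in
/-- Whether the head of the stack may have to turn before its next other action. -/
noncomputable def Frame.mayTurn (f : Frame N) : ℕ :=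
  if (∃ C, (C, f.task.angle) ∈ f.task.gaps) ∨ (f.task.gaps = ∅ ∧ f.task.angle = f.task.finish)
  then 0 else 1

theorem Frame.mayTurn_le (f : Frame N) : f.mayTurn ≤ 1 := by
  unfold mayTurn; split_ifs <;> simp

/-- A bound on the number of actions that are needed to empty the stack. -/
noncomputable def stackSteps (N r : ℕ) : List (Frame N) → ℕ
  | [] => 0
  | f :: L => f.task.gaps.ncard * (2 + taskSteps r (N - (L.length + 1))) + f.mayTurn + 1 +
      stackSteps N r L

theorem stackSteps_releaseHead (r : ℕ) (L : List (Frame N)) :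
    stackSteps N r (releaseHead L) = stackSteps N r L := by
  cases L <;> rfl

/-- A turn changes `Frame.mayTurn` from `1` to `0`, since its target is exactly where another action
is due. An engagement may change it back to `1`; the `2` counted with each gap pays for this and for
the engagement. -/
theorem StackMove.stackSteps_lt (h : PolyEnv E V) {r : ℕ} (hr : V.ncard ≤ r)
    {L' : List (Frame N)} {dt : ℝ} (hm : StackMove E p ω L L' dt) (hL : IsStack E p L)
    (hN : L'.length ≤ N) : stackSteps N r L' < stackSteps N r L := by
  cases hm with
  | slew f L φ hφ hlt =>
    have h1 : f.mayTurn = 1 := by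
      refine if_neg ?_
      rintro (⟨C, hC⟩ | ⟨hg, ha⟩)
      · exact absurd (hφ.2 _ hC) (not_le.2 hlt)
      · rcases hφ.1 with ⟨C, hC⟩ | ⟨-, h2⟩
        · simp [hg] at hC
        · exact hlt.ne (ha.trans h2.symm)
    have h2 : (f.turn φ).mayTurn = 0 := if_pos hφ.1
    simp only [stackSteps, h1, h2]
    simp only [Frame.turn]
    omega
  | engage f L l C α β hC hl hs =>
    have hcard := ncard_sdiff_singleton_add_one hC (hL.good.gaps_finite_and_ncard_le h).1
    set f' : Frame N := ⟨l, C, α, newTask E (p l) (some f.agent) C α β⟩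
    have hncard : f'.task.gaps.ncard ≤ r :=
      ((Frame.Good.new (hL.good.region_of_mem_gaps h hC) hl hs _).gaps_finite_and_ncard_le
        h).2.trans hr
    have h1 := f'.mayTurn_le
    have h2 := (f.engage C l).mayTurn_le
    have hlen : N - (L.length + 1) = N - (L.length + 1 + 1) + 1 := by
      simp only [List.length_cons] at hN
      omega
    simp only [stackSteps, List.length_cons]
    rw [← hcard, hlen, taskSteps]
    change f'.task.gaps.ncard * _ + _ + 1 +
      ((f.task.gaps \ {(C, f.task.angle)}).ncard * _ + _ + 1 + _) < _
    have h3 : f'.task.gaps.ncard * (2 + taskSteps r (N - (L.length + 1 + 1))) ≤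
        r * (2 + taskSteps r (N - (L.length + 1 + 1))) := by gcongr
    rw [add_mul, one_mul]
    omega
  | complete f L hg ha =>
    rw [stackSteps_releaseHead]
    simp only [stackSteps]
    omega

end

/-! ## Clearing -/

section

variable {N : ℕ} {E V : Set ℂ} {p : Fin N → ℂ} {ω : ℝ}

/-- The points for which some engaged agent is still responsible. -/
def dirty (E : Set ℂ) (p : Fin N → ℂ) (L : List (Frame N)) : Set ℂ :=
  {x | ∃ f ∈ L, x ∈ f.own E p}

/-- The points that are illuminated by the engaged agents. -/
def lights (E : Set ℂ) (p : Fin N → ℂ) (L : List (Frame N)) : Set ℂ :=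
  {x | ∃ f ∈ L, x ∈ ray E (p f.agent) f.task.angle}

theorem dirty_cons (f : Frame N) (L : List (Frame N)) :
    dirty E p (f :: L) = f.own E p ∪ dirty E p L := by
  ext x; simp [dirty]

theorem lights_cons (f : Frame N) (L : List (Frame N)) :
    lights E p (f :: L) = ray E (p f.agent) f.task.angle ∪ lights E p L := by
  ext x; simp [lights]

theorem isClosed_lights (hE : IsClosed E) (L : List (Frame N)) : IsClosed (lights E p L) := by
  induction L with
  | nil => simp [lights]
  | cons f L ih =>
    rw [lights_cons]
    exact (isClosed_ray hE _ _).union ih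

theorem IsStack.dirty_subset {L : List (Frame N)} (hL : IsStack E p L) :
    dirty E p L ⊆ interior E := by
  rintro x ⟨f, hf, hx⟩
  have := hL.good_of_mem f hf
  exact this.region.subset (this.own_subset hx)

/-- Inside `E` a region is bounded by gaps of its ancestors, and each ancestor waits with its
searchlight directed along the gap in question. -/
theorem IsStack.frontier_region_subset (h : PolyEnv E V) {f : Frame N} {L : List (Frame N)}
    (hL : IsStack E p (f :: L)) : frontier f.region ∩ interior E ⊆ lights E p L := by
  induction L generalizing f with
  | nil =>
    cases hL with
    | root _ _ _ hr =>
      rintro x ⟨hx, hxi⟩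
      rw [hr, isOpen_interior.frontier_eq] at hx
      exact absurd hxi hx.2
  | cons g L ih =>
    cases hL with
    | push _ _ _ hL _ _ _ hgap =>
      rintro x ⟨hx, hxi⟩
      rw [lights_cons]
      have hg := hL.good
      by_cases hxg : x ∈ g.region
      · exact Or.inl (hgap.frontier_subset_ray h hg.region hg.canHelp.1 ⟨hx, hxg⟩)
      · refine Or.inr (ih hL ⟨?_, hxi⟩)
        rw [hg.region.isOpen.frontier_eq]
        exact ⟨closure_mono (fun y hy => (hgap.isHiddenComponent.subset hy).1)
          (frontier_subset_closure hx), hxg⟩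

/-- Light separates the part that is still to be cleared from the rest of the environment. -/
theorem IsStack.frontier_dirty_subset (h : PolyEnv E V) {L : List (Frame N)}
    (hL : IsStack E p L) : frontier (dirty E p L) ∩ interior E ⊆ lights E p L := by
  induction L with
  | nil => simp [dirty]
  | cons f L ih =>
    rintro x ⟨hx, hxi⟩
    rw [dirty_cons] at hx
    rw [lights_cons]
    have hf := hL.good
    rcases frontier_union_subset _ _ hx with h1 | h1
    · by_cases hxf : x ∈ f.region
      · exact Or.inl (hf.frontier_own_subset h ⟨h1.1, hxf⟩)
      · refine Or.inr (hL.frontier_region_subset h ⟨?_, hxi⟩)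
        rw [hf.region.isOpen.frontier_eq]
        exact ⟨closure_mono hf.own_subset (frontier_subset_closure h1.1), hxf⟩
    · exact Or.inr (ih hL.tail ⟨h1.2, hxi⟩)

theorem _root_.IsPreconnected.subset_of_disjoint_frontier {S D : Set ℂ} (hS : IsPreconnected S)
    (hd : Disjoint S (frontier D)) (hne : (S ∩ D).Nonempty) : S ⊆ D := by
  have hsub : S ⊆ interior D ∪ interior Dᶜ := by
    intro x hx
    by_contra hno
    rw [interior_compl, mem_union, not_or, mem_compl_iff, not_not] at hno
    exact disjoint_left.1 hd hx ⟨hno.2, hno.1⟩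
  obtain ⟨y, hyS, hyD⟩ := hne
  have hy : y ∈ interior D := (hsub hyS).resolve_right fun h => interior_subset h hyD
  exact (hS.subset_left_of_subset_union isOpen_interior isOpen_interior
    (disjoint_compl_right.mono interior_subset interior_subset) hsub ⟨y, hyS, hy⟩).trans
    interior_subset

/-- A curve that avoids the light does not leave the part that is still to be cleared. -/
theorem IsStack.mem_closure_dirty_of_nonseparable (h : PolyEnv E V) {L : List (Frame N)}
    (hL : IsStack E p L) {Λ : Set ℂ} (hΛ : lights E p L ⊆ Λ) {x y : ℂ}
    (hxy : Nonseparable E Λ x y) (hy : y ∈ closure (dirty E p L)) :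
    x ∈ closure (dirty E p L) := by
  obtain ⟨γ, hγE, hγΛ⟩ := hxy
  set D := dirty E p L
  have hyE : y ∈ E :=
    closure_minimal (hL.dirty_subset.trans interior_subset) h.isClosed hy
  have hyΛ : y ∉ lights E p L := fun hh => hγΛ 1 (by rw [γ.target]; exact hΛ hh)
  have hfr := hL.frontier_dirty_subset h
  obtain ⟨ε₀, hε₀, hloc⟩ := h.loc y hyE
  obtain ⟨ε₁, hε₁, hball⟩ :=
    Metric.isOpen_iff.1 (isClosed_lights (p := p) h.isClosed L).isOpen_compl y hyΛ
  have hpre := (hloc (min ε₀ ε₁) (lt_min hε₀ hε₁) (min_le_left _ _)).1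
  -- The point `y` may be on the boundary of `E`, so connectedness of the interior in a small unlit
  -- disc is what places the whole of it in the dirty set, including the end of the curve.
  have hnear : interior E ∩ ball y (min ε₀ ε₁) ⊆ D := by
    refine hpre.subset_of_disjoint_frontier (disjoint_left.2 fun z hz hzf => ?_) ?_
    · exact hball (ball_subset_ball (min_le_right _ _) hz.2) (hfr ⟨hzf, hz.1⟩)
    · obtain ⟨z, hz, hzD⟩ := mem_closure_iff.1 hy _ isOpen_ball
        (mem_ball_self (lt_min hε₀ hε₁))
      exact ⟨z, ⟨hL.dirty_subset hzD, hz⟩, hzD⟩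
  set g : ℝ → ℂ := ⇑γ.extend with hg
  have hgc : Continuous g := γ.continuous_extend
  have hgE : ∀ s ∈ Ioo (0 : ℝ) 1, g s ∈ interior E ∧ g s ∉ Λ := by
    intro s hs
    have hs' : s ∈ Icc (0 : ℝ) 1 := Ioo_subset_Icc_self hs
    rw [hg, γ.extend_apply hs']
    refine ⟨hγE _ ?_ ?_, hγΛ _⟩
    · exact fun h0 => hs.1.ne' (congrArg Subtype.val h0)
    · exact fun h1 => hs.2.ne (congrArg Subtype.val h1)
  have hsub : g '' Ioo 0 1 ⊆ D := by
    refine (isPreconnected_Ioo.image g hgc.continuousOn).subset_of_disjoint_frontier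
      (disjoint_left.2 ?_) ?_
    · rintro _ ⟨s, hs, rfl⟩ hf
      exact (hgE s hs).2 (hΛ (hfr ⟨hf, (hgE s hs).1⟩))
    · have h1 : ∀ᶠ s in 𝓝[<] (1 : ℝ), g s ∈ ball y (min ε₀ ε₁) := by
        refine (eventually_mem_ball hgc.continuousAt ?_ (lt_min hε₀ hε₁)).filter_mono
          nhdsWithin_le_nhds
        rw [hg, γ.extend_one]
      have h2 : ∀ᶠ s in 𝓝[<] (1 : ℝ), s ∈ Ioo (0 : ℝ) 1 := Ioo_mem_nhdsLT one_pos
      obtain ⟨s, hs1, hs2⟩ := (h1.and h2).exists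
      exact ⟨g s, ⟨s, hs2, rfl⟩, hnear ⟨(hgE s hs2).1, hs1⟩⟩
  have h0 : (0 : ℝ) ∈ closure (Ioo (0 : ℝ) 1) := by
    rw [closure_Ioo zero_ne_one]
    exact ⟨le_rfl, zero_le_one⟩
  have := image_closure_subset_closure_image hgc ⟨0, h0, rfl⟩
  rw [hg, γ.extend_zero] at this
  exact closure_mono hsub this

/-- The stack after the searchlight of its head has been turning for a time `s`. -/
def advance (ω : ℝ) : List (Frame N) → ℝ → List (Frame N)
  | [], _ => []
  | f :: L, s => f.turn (f.task.angle + ω * s) :: L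

theorem advance_zero (ω : ℝ) (L : List (Frame N)) : advance ω L 0 = L := by
  cases L <;> simp [advance, Frame.turn]

/-- What the sweep takes away from the dirty set lies in a closed sector, every point of which is
lit at some moment of the sweep. -/
theorem mem_closure_dirty_advance (hE : IsClosed E) (hω : 0 < ω) (L : List (Frame N)) {s s' : ℝ}
    {y : ℂ} (hy : y ∈ closure (dirty E p (advance ω L s)))
    (hlit : ∀ u ∈ Icc s s', y ∉ lights E p (advance ω L u)) :
    y ∈ closure (dirty E p (advance ω L s')) := by
  cases L with
  | nil => simpa [advance] using hy
  | cons f L =>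
    set S : Set ℂ := {x | ∃ φ ∈ Icc (f.task.angle + ω * s) (f.task.angle + ω * s'),
      x ∈ ray E (p f.agent) φ} with hS
    have hsub : dirty E p (advance ω (f :: L) s) ⊆ dirty E p (advance ω (f :: L) s') ∪ S := by
      simp only [advance, dirty_cons]
      rintro x ((⟨hx, φ, hφ, hxφ⟩ | hx) | hx)
      · by_cases hle : φ ≤ f.task.angle + ω * s'
        · exact Or.inr ⟨φ, ⟨hφ.1.le, hle⟩, hxφ⟩
        · exact Or.inl (Or.inl (Or.inl ⟨hx, φ, ⟨not_le.1 hle, hφ.2⟩, hxφ⟩))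
      · exact Or.inl (Or.inl (Or.inr hx))
      · exact Or.inl (Or.inr hx)
    have h1 := closure_mono hsub hy
    rw [closure_union, (isClosed_swept hE _ _ _).closure_eq] at h1
    rcases h1 with h1 | ⟨φ, hφ, hyφ⟩
    · exact h1
    · refine absurd ?_ (hlit ((φ - f.task.angle) / ω) ⟨?_, ?_⟩)
      · rw [advance, lights_cons]
        refine Or.inl ?_
        have : f.task.angle + ω * ((φ - f.task.angle) / ω) = φ := by field_simp; ring
        simp only [Frame.turn, this]
        exact hyφ
      · rw [le_div_iff₀ hω]
        linarith [hφ.1]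
      · rw [div_le_iff₀ hω]
        linarith [hφ.2]

theorem dirty_releaseHead (L : List (Frame N)) : dirty E p (releaseHead L) = dirty E p L := by
  cases L with
  | nil => rfl
  | cons f L => simp only [releaseHead, dirty_cons]; rfl

theorem StackMove.duration_nonneg {L₁ L₂ : List (Frame N)} {dt : ℝ}
    (hm : StackMove E p ω L₁ L₂ dt) (hω : 0 < ω) : 0 ≤ dt := by
  cases hm with
  | slew g L φ hφ hlt => exact div_nonneg (sub_nonneg.2 hlt.le) hω.le
  | engage => exact le_rfl
  | complete => exact le_rfl

/-- An action does not make an unlit point of the part that is still to be cleared leave it. -/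
theorem StackMove.mem_closure_dirty {L₁ L₂ : List (Frame N)} {dt : ℝ}
    (hm : StackMove E p ω L₁ L₂ dt) (hω : 0 < ω) (h : PolyEnv E V) (hstack : IsStack E p L₁) {y : ℂ}
    (hy : y ∈ closure (dirty E p (advance ω L₁ dt))) (hlit : y ∉ lights E p L₂) :
    y ∈ closure (dirty E p L₂) := by
  cases hm with
  | slew g L φ hφ hlt =>
    have : g.task.angle + ω * ((φ - g.task.angle) / ω) = φ := by field_simp; ring
    rwa [advance, this] at hy
  | engage g L l C α β hC hl hs =>
    rw [advance_zero] at hy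
    have hCr := hstack.good.region_of_mem_gaps h hC
    have hnew := Frame.region_subset_own_new (p := p) h hCr hl hs (some g.agent)
    set g' : Frame N := ⟨l, C, α, newTask E (p l) (some g.agent) C α β⟩
    rw [lights_cons, mem_union, not_or] at hlit
    -- The region passes from the parent to the child, and only the first ray of the child can be
    -- lost; it is lit at that moment.
    have hsub : dirty E p (g :: L) ⊆
        dirty E p (g' :: g.engage C l :: L) ∪ ray E (p l) α := by
      simp only [dirty_cons]
      rintro x ((hx | ⟨G, hG, hx⟩) | hx)
      · exact Or.inl (Or.inr (Or.inl (Or.inl hx)))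
      · by_cases hGC : G = (C, g.task.angle)
        · subst hGC
          rcases hnew hx with h1 | h1
          · exact Or.inl (Or.inl h1)
          · exact Or.inr h1
        · exact Or.inl (Or.inr (Or.inl (Or.inr ⟨G, ⟨hG, hGC⟩, hx⟩)))
      · exact Or.inl (Or.inr (Or.inr hx))
    have h1 := closure_mono hsub hy
    rw [closure_union, (isClosed_ray h.isClosed _ _).closure_eq] at h1
    exact h1.resolve_right hlit.1
  | complete g L hg ha =>
    rw [advance_zero] at hy
    rw [dirty_releaseHead]
    refine closure_mono ?_ hy
    rw [dirty_cons]
    rintro x ((⟨-, φ, hφ, -⟩ | ⟨G, hG, -⟩) | hx)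
    · rw [ha] at hφ
      exact absurd hφ.1 (not_lt.2 hφ.2)
    · simp [hg] at hG
    · exact hx

/-! ### The invariant along an execution -/

/-- An execution together with the stacks of engaged agents. -/
structure IsRun (E : Set ℂ) (p : Fin N → ℂ) (ω : ℝ) (f : ℕ → Config N)
    (L : ℕ → List (Frame N)) : Prop where
  time_zero : (f 0).time = 0
  zero : ∃ l α β, CanHelp E (p l) (interior E) ∧ IsSweepRange E (p l) (interior E) α β ∧
    L 0 = [⟨l, interior E, α, newTask E (p l) none (interior E) α β⟩]
  represents : ∀ k, Represents E p (f k) (L k)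
  next : ∀ k, (∃ dt, StackMove E p ω (L k) (L (k + 1)) dt ∧
    (f (k + 1)).time = (f k).time + dt) ∨ (L k = [] ∧ L (k + 1) = [] ∧ f (k + 1) = f k)

/-- The stacks are built recursively along the execution. It can halt only with an empty stack,
because a nonempty one always admits an action. -/
theorem IsExecution.exists_run (h : PolyEnv E V)
    (hhelp : ∀ C, Region E C → ∃ l, CanHelp E (p l) C) {root : Fin N}
    (hroot : CanHelp E (p root) (interior E)) {f : ℕ → Config N}
    (hf : IsExecution E p root ω f) : ∃ L, IsRun E p ω f L := by
  obtain ⟨⟨ht, hidle, α, β, hs, htask⟩, hstep⟩ := hf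
  set L₀ : List (Frame N) :=
    [⟨root, interior E, α, newTask E (p root) none (interior E) α β⟩] with hL₀
  have h0 : Represents E p (f 0) L₀ := by
    refine ⟨?_, by simp [hL₀], .root _ (.new h.region_interior hroot hs none) rfl rfl, ?_⟩
    · intro i τ
      by_cases hi : i = root
      · subst hi; simp [hL₀, htask]
      · simp [hL₀, hidle i hi, Ne.symm hi]
    · rintro g hg
      cases hg
      rfl
  have hnext : ∀ (k : ℕ) (L : {L // Represents E p (f k) L}),
      ∃ L' : {L' // Represents E p (f (k + 1)) L'}, (∃ dt, StackMove E p ω L.1 L'.1 dt ∧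
        (f (k + 1)).time = (f k).time + dt) ∨ (L.1 = [] ∧ L'.1 = [] ∧ f (k + 1) = f k) := by
    rintro k ⟨L, hL⟩
    rcases hstep k with hk | ⟨hk, hfk⟩
    · obtain ⟨L', dt, h1, h2, h3⟩ := hL.step h hk
      exact ⟨⟨L', h3⟩, Or.inl ⟨dt, h1, h2⟩⟩
    · cases L with
      | nil => exact ⟨⟨[], by rw [hfk]; exact hL⟩, Or.inr ⟨rfl, rfl, hfk⟩⟩
      | cons g L =>
        obtain ⟨c', hc'⟩ := hL.exists_step (ω := ω) h hhelp
        exact absurd hc' (hk c')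
  choose F hF using hnext
  let S : ∀ k, {L // Represents E p (f k) L} := fun k => Nat.rec ⟨L₀, h0⟩ F k
  exact ⟨fun k => (S k).1, ht, ⟨root, α, β, hroot, hs, rfl⟩, fun k => (S k).2,
    fun k => hF k (S k)⟩

namespace IsRun

variable {f : ℕ → Config N} {L : ℕ → List (Frame N)}

theorem time_le_succ (hr : IsRun E p ω f L) (hω : 0 < ω) (k : ℕ) :
    (f k).time ≤ (f (k + 1)).time := by
  rcases hr.next k with ⟨dt, hm, ht⟩ | ⟨-, -, ht⟩
  · linarith [hm.duration_nonneg hω]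
  · rw [ht]

theorem time_nonneg (hr : IsRun E p ω f L) (hω : 0 < ω) (k : ℕ) : 0 ≤ (f k).time := by
  rw [← hr.time_zero]
  exact monotone_nat_of_le_succ (hr.time_le_succ hω) k.zero_le

theorem length_le (hr : IsRun E p ω f L) (k : ℕ) : (L k).length ≤ N := by
  simpa using (hr.represents k).nodup.length_le_card

theorem advance_duration (hr : IsRun E p ω f L) (hω : 0 < ω) (h : PolyEnv E V) (k : ℕ) {y : ℂ}
    (hy : y ∈ closure (dirty E p (advance ω (L k) ((f (k + 1)).time - (f k).time))))
    (hlit : y ∉ lights E p (L (k + 1))) : y ∈ closure (dirty E p (L (k + 1))) := by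
  rcases hr.next k with ⟨dt, hm, ht⟩ | ⟨h1, h2, -⟩
  · rw [ht, add_sub_cancel_left] at hy
    exact hm.mem_closure_dirty hω h (hr.represents k).stack hy hlit
  · rw [h1] at hy
    simp [advance, dirty] at hy

/-- During an action only the head turns, and never past its next angle, so the stack invariants
hold at intermediate times too. -/
theorem isStack_advance (hr : IsRun E p ω f L) (hω : 0 < ω) {k : ℕ} {t : ℝ}
    (ht : t ∈ Icc (f k).time (f (k + 1)).time) :
    IsStack E p (advance ω (L k) (t - (f k).time)) := by
  have hstack := (hr.represents k).stack
  have hzero : (f (k + 1)).time = (f k).time → IsStack E p (advance ω (L k) (t - (f k).time)) := by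
    intro heq
    rw [show t - (f k).time = 0 by linarith [ht.1, ht.2], advance_zero]
    exact hstack
  rcases hr.next k with ⟨dt, hm, hdt⟩ | ⟨-, -, heq⟩
  · generalize hL₁ : L k = L₁ at *
    generalize L (k + 1) = L₂ at *
    cases hm with
    | slew g L φ hφ hlt =>
      rw [hdt] at ht
      have h1 : t - (f k).time ≤ (φ - g.task.angle) / ω := by linarith [ht.2]
      rw [le_div_iff₀ hω] at h1
      refine hstack.replace_head (hstack.good.turn hφ ?_ ?_) rfl rfl rfl
      · have : 0 ≤ ω * (t - (f k).time) := mul_nonneg hω.le (sub_nonneg.2 ht.1)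
        linarith
      · linarith
    | engage => exact hzero (by rw [hdt, add_zero])
    | complete => exact hzero (by rw [hdt, add_zero])
  · exact hzero (by rw [heq])

theorem lights_advance_subset (hr : IsRun E p ω f L) {k : ℕ} {t : ℝ}
    (ht : t ∈ Icc (f k).time (f (k + 1)).time) :
    lights E p (advance ω (L k) (t - (f k).time)) ⊆ illuminated E p ω f t := by
  have hR := hr.represents k
  generalize L k = L₁ at *
  cases L₁ with
  | nil => simp [advance, lights]
  | cons g L =>
    rw [advance, lights_cons]
    rintro x (hx | ⟨g', hg', hx⟩)
    · refine ⟨k, g.agent, g.task, ht, (hR.records _ _).2 ⟨g, by simp, rfl, rfl⟩, ?_⟩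
      rw [Task.angleAt, if_pos (hR.child_head g rfl)]
      exact hx
    · refine ⟨k, g'.agent, g'.task, ht, (hR.records _ _).2 ⟨g', by simp [hg'], rfl, rfl⟩, ?_⟩
      rw [Task.angleAt, if_neg (hR.stack.child_ne_none g' hg')]
      exact hx

/-- The point is followed through sweeps and actions. Several instantaneous actions may occur at the
time `t'`; the hypothesis `h0` is required only for step `0` and for steps that begin before `t'`,
and the rest is reached by induction over the steps. -/
theorem mem_closure_dirty_of_unlit (hr : IsRun E p ω f L) (hω : 0 < ω) (h : PolyEnv E V) {y : ℂ}
    {t' t : ℝ} (hlit : ∀ s ∈ Icc t' t, y ∉ illuminated E p ω f s)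
    (h0 : ∀ k, (k = 0 ∨ (f k).time < t') → t' ∈ Icc (f k).time (f (k + 1)).time →
      y ∈ closure (dirty E p (advance ω (L k) (t' - (f k).time))))
    (ht0 : 0 ≤ t') (k : ℕ) : ∀ s ∈ Icc (f k).time (f (k + 1)).time, s ∈ Icc t' t →
      y ∈ closure (dirty E p (advance ω (L k) (s - (f k).time))) := by
  have hmove : ∀ k s s', s ≤ s' → s ∈ Icc (f k).time (f (k + 1)).time →
      s' ∈ Icc (f k).time (f (k + 1)).time → t' ≤ s → s' ≤ t →
      y ∈ closure (dirty E p (advance ω (L k) (s - (f k).time))) →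
      y ∈ closure (dirty E p (advance ω (L k) (s' - (f k).time))) := by
    intro k s s' hss hs hs' h1 h2 hy
    refine mem_closure_dirty_advance h.isClosed hω _ hy fun u hu hl => ?_
    have h3 : u + (f k).time ∈ Icc (f k).time (f (k + 1)).time :=
      ⟨by linarith [hu.1, hs.1], by linarith [hu.2, hs'.2]⟩
    refine hlit (u + (f k).time) ⟨by linarith [hu.1], by linarith [hu.2]⟩
      (hr.lights_advance_subset h3 ?_)
    rwa [add_sub_cancel_right]
  induction k with
  | zero =>
    intro s hs hst
    have h1 : t' ∈ Icc (f 0).time (f (0 + 1)).time :=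
      ⟨by rw [hr.time_zero]; exact ht0, hst.1.trans hs.2⟩
    exact hmove 0 t' s hst.1 h1 hs le_rfl hst.2 (h0 0 (Or.inl rfl) h1)
  | succ k ih =>
    intro s hs hst
    rcases lt_or_ge (f (k + 1)).time t' with hlt | hge
    · have h1 : t' ∈ Icc (f (k + 1)).time (f (k + 1 + 1)).time := ⟨hlt.le, hst.1.trans hs.2⟩
      exact hmove _ t' s hst.1 h1 hs le_rfl hst.2 (h0 _ (Or.inr hlt) h1)
    · have hk : (f (k + 1)).time ∈ Icc (f (k + 1)).time (f (k + 1 + 1)).time :=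
        ⟨le_rfl, hr.time_le_succ hω _⟩
      have hkt : (f (k + 1)).time ∈ Icc t' t := ⟨hge, hs.1.trans hst.2⟩
      have h1 := ih _ ⟨hr.time_le_succ hω k, le_rfl⟩ hkt
      have h2 := hr.advance_duration hω h k h1 fun hl => hlit _ hkt
        (hr.lights_advance_subset hk (by rwa [sub_self, advance_zero]))
      refine hmove (k + 1) _ s hs.1 hk hs hge hst.2 ?_
      rwa [sub_self, advance_zero]

/-- Initially everything except the first ray of the root is in the closure of the dirty set. A
contaminated point that stays unlit remains in this closure, and unlit curves transport the property
to the points it recontaminates. -/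
theorem mem_closure_dirty_of_contaminated (hr : IsRun E p ω f L) (hω : 0 < ω) (h : PolyEnv E V)
    {x : ℂ} {t : ℝ} (hc : Contaminated E (illuminated E p ω f) x t) : 0 ≤ t ∧
      ∀ k, t ∈ Icc (f k).time (f (k + 1)).time →
        x ∈ closure (dirty E p (advance ω (L k) (t - (f k).time))) := by
  induction hc with
  | init x hxE hx =>
    refine ⟨le_rfl, fun k hk => ?_⟩
    refine hr.mem_closure_dirty_of_unlit hω h (t' := 0) (t := 0) (fun s hs => ?_) ?_ le_rfl k 0 hk
      ⟨le_rfl, le_rfl⟩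
    · rw [show s = 0 from le_antisymm hs.2 hs.1]
      exact hx
    · rintro k (rfl | hk) hk'
      · have hlit := fun hl => hx (hr.lights_advance_subset hk' hl)
        rw [hr.time_zero, sub_zero, advance_zero] at hlit ⊢
        obtain ⟨l, α, β, hl, hs, hL⟩ := hr.zero
        rw [hL] at hlit ⊢
        rw [lights_cons] at hlit
        have hsub := Frame.region_subset_own_new (p := p) h h.region_interior hl hs none
        have h1 := closure_mono hsub (h.subset_closure hxE)
        rw [closure_union, (isClosed_ray h.isClosed _ _).closure_eq] at h1
        rw [dirty_cons]
        exact closure_mono subset_union_left (h1.resolve_right fun hl => hlit (Or.inl hl))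
      · exact absurd (hr.time_nonneg hω k) (not_le.2 hk)
  | spread x y t' t hxE hy htt hlit hsep ih =>
    obtain ⟨ht', ih⟩ := ih
    refine ⟨ht'.trans htt.le, fun k hk => ?_⟩
    exact (hr.isStack_advance hω hk).mem_closure_dirty_of_nonseparable h
      (hr.lights_advance_subset hk) hsep
      (hr.mem_closure_dirty_of_unlit hω h hlit (fun k _ => ih k) ht' k t hk ⟨htt.le, le_rfl⟩)

theorem isClear_of_eq_nil (hr : IsRun E p ω f L) (hω : 0 < ω) (h : PolyEnv E V) {k : ℕ}
    (hk : L k = []) : IsClear E (illuminated E p ω f) (f k).time := by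
  intro x _ hx
  have := (hr.mem_closure_dirty_of_contaminated hω h hx).2 k ⟨le_rfl, hr.time_le_succ hω k⟩
  rw [hk] at this
  simp [advance, dirty] at this

theorem isDone_of_eq_nil (hr : IsRun E p ω f L) {k : ℕ} (hk : L k = []) : (f k).IsDone := by
  intro i
  refine (hr.represents k).records.eq_none ?_
  simp [hk]

theorem exists_eq_nil (hr : IsRun E p ω f L) (h : PolyEnv E V) : ∃ k, L k = [] := by
  by_contra hno
  push Not at hno
  have hlt : ∀ k, stackSteps N V.ncard (L (k + 1)) < stackSteps N V.ncard (L k) := by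
    intro k
    rcases hr.next k with ⟨dt, hm, -⟩ | ⟨h1, -⟩
    · exact hm.stackSteps_lt h le_rfl (hr.represents k).stack (hr.length_le _)
    · exact absurd h1 (hno k)
  exact not_strictAnti_of_wellFoundedLT (fun k => stackSteps N V.ncard (L k))
    (strictAnti_nat_of_succ_lt hlt)

theorem time_le (hr : IsRun E p ω f L) (hω : 0 < ω) (h : PolyEnv E V) {r : ℕ} (hV : V.ncard ≤ r)
    (k : ℕ) : (f k).time ≤ 2 * Real.pi / ω * ∑ j ∈ Finset.range N, (r : ℝ) ^ j := by
  -- Elapsed time plus potential never increases, and initially it is at most the budget of one task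
  -- at depth `0`.
  have key : ∀ k, (f k).time + stackTime N ω r (L k) ≤ taskTime N ω r 0 := by
    intro k
    induction k with
    | zero =>
      obtain ⟨l, α, β, hl, hs, hL⟩ := hr.zero
      rw [hr.time_zero, zero_add, hL]
      have := stackTime_new_le h hω hV h.region_interior hl hs none (L := []) l.pos
      simpa [stackTime] using this
    | succ k ih =>
      rcases hr.next k with ⟨dt, hm, ht⟩ | ⟨h1, h2, h3⟩
      · have := hm.stackTime_le h hω hV (hr.represents k).stack (hr.length_le _)
        linarith
      · rw [h2, h3, ← h1]
        exact ih
  have h1 := key k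
  have h2 := stackTime_nonneg hω r (hr.represents k).stack
  rw [taskTime, Nat.sub_zero] at h1
  linarith

end IsRun

end

/-! ### Existence of executions and the final assembly -/

theorem exists_isExecution {N : ℕ} {E : Set ℂ} {p : Fin N → ℂ} {root : Fin N} {ω α β : ℝ}
    (hs : IsSweepRange E (p root) (interior E) α β) : ∃ f, IsExecution E p root ω f := by
  classical
  set c₀ : Config N := ⟨0, fun i =>
    if i = root then some (newTask E (p root) none (interior E) α β) else none⟩ with hc₀
  let next : Config N → Config N := fun c => if hc : ∃ c', Step E p ω c c' then hc.choose else c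
  refine ⟨fun k => next^[k] c₀, ⟨rfl, fun i hi => by simp [hc₀, hi], α, β, hs, by simp [hc₀]⟩,
    fun k => ?_⟩
  simp only [Function.iterate_succ_apply']
  by_cases hc : ∃ c', Step E p ω (next^[k] c₀) c'
  · left
    simp only [next, dif_pos hc]
    exact hc.choose_spec
  · right
    exact ⟨fun c hcc => hc ⟨c, hcc⟩, dif_neg hc⟩

end Searchlight

theorem mainTheorem4 {n N : ℕ} (P : Polygon ℂ n) (hP : Searchlight.IsSimple P)
    (p : Fin N → ℂ) (hp : Searchlight.StandingAssumptions P p)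
    (root : Fin N) (hroot : p root ∈ P.boundary ℝ) (ω : ℝ) (hω : 0 < ω) :
    (∃ f, Searchlight.IsExecution (Searchlight.environment P) p root ω f) ∧
    ∀ f, Searchlight.IsExecution (Searchlight.environment P) p root ω f →
      ∃ k, (f k).IsDone ∧
        Searchlight.IsClear (Searchlight.environment P)
          (Searchlight.illuminated (Searchlight.environment P) p ω f) (f k).time ∧
        (f k).time ≤ 2 * Real.pi / ω *
          ∑ j ∈ Finset.range N, (Searchlight.reflexCount P : ℝ) ^ j ∧
        (Searchlight.reflexCount P ≠ 1 →
          (f k).time ≤ 2 * Real.pi / ω *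
            ((1 - (Searchlight.reflexCount P : ℝ) ^ N) / (1 - (Searchlight.reflexCount P : ℝ)))) := by
  open Searchlight in
  obtain ⟨hE, hb⟩ := hP.polyEnv
  have hhelp : ∀ C, Region (environment P) C → ∃ l, CanHelp (environment P) (p l) C :=
    fun C hC => hp.exists_canHelp hC.conn.nonempty (hC.subset.trans interior_subset)
      (Set.disjoint_left.2 fun x hx hxb => (hb x hxb).2 (hC.subset hx))
  have hroot' := hE.canHelp_interior (hb _ hroot).1 (hb _ hroot).2
  refine ⟨?_, fun f hf => ?_⟩
  · obtain ⟨α, β, hs⟩ := hroot'.exists_isSweepRange hE hE.region_interior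
    exact exists_isExecution hs
  · obtain ⟨L, hr⟩ := hf.exists_run hE hhelp hroot'
    obtain ⟨k, hk⟩ := hr.exists_eq_nil hE
    have htime := hr.time_le hω hE (ncard_reflex_le P) k
    refine ⟨k, hr.isDone_of_eq_nil hk, hr.isClear_of_eq_nil hω hE hk, htime, fun h1 => ?_⟩
    have h1' : (reflexCount P : ℝ) ≠ 1 := by exact_mod_cast h1
    rwa [geom_sum_eq h1', ← neg_div_neg_eq (_ - _), neg_sub, neg_sub] at htime
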